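/- Let $\mathcal T$ be the standard ideal triangulation of the figure eight knot complement $M$ by two tetrahedra with vertices $1,2,3,4$ in positive order, in which the faces $(2,3,4),(1,3,4),(1,2,4),(1,2,3)$ of the first tetrahedron are glued, with vertices in this order, to the faces $(2,4,3),(2,4,1),(3,4,1),(3,2,1)$ of the second. Let $u_{ij}$ and $v_{ij}$ ($i\neq j$ in $\{1,2,3,4\}$) be coordinates on $\mathbb C^{24}$ attached to the oriented edges $ij$ of the first and of the second tetrahedron. The $\mathrm{PGL}(3,\mathbb C)$ deformation variety $\mathrm{Defor}(M,\mathcal T)\subset\mathbb C^{24}$ is the set of all points that satisfy (1) the internal relations: for $z=u$ and for $z=v$, and for every even permutation $(i,j,k,l)$ of $(1,2,3,4)$, $z_{ij}z_{ik}z_{il}=-1$ and $z_{ik}(1-z_{ij})=1$; (2) the face relations: for each pair of glued faces, the product of their two face coordinates is $1$, where the face $ijk$ of a tetrahedron with fourth vertex $l$ has the face coordinate $-z_{il}z_{jl}z_{kl}$; that is, $$u_{21}u_{31}u_{41}v_{21}v_{31}v_{41}=u_{12}u_{32}u_{42}v_{13}v_{23}v_{43}=u_{13}u_{23}u_{43}v_{12}v_{32}v_{42}=u_{14}u_{24}u_{34}v_{14}v_{24}v_{34}=1;$$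 (3) the edge relations: for each oriented edge of $\mathcal T$, the product of the coordinates of all oriented edges of the tetrahedra that are identified with it is $1$; that is, $$u_{13}u_{14}u_{23}v_{21}v_{24}v_{31}=u_{31}u_{32}u_{41}v_{12}v_{13}v_{42}=u_{21}u_{24}u_{34}v_{23}v_{41}v_{43}=u_{12}u_{42}u_{43}v_{14}v_{32}v_{34}=1.$$ Theorem. There are three irreducible Zariski closed subsets $D_1,D_2,D_3$ of $\mathbb C^{24}$, none of which contains another, such that $\mathrm{Defor}(M,\mathcal T)=D_1\cup D_2\cup D_3$. Each $D_i$ is a smooth affine variety of dimension $2$. Moreover $D_1\cap D_2\cap D_3\neq\emptyset$, and $\mathrm{Defor}(M,\mathcal T)$ is connected (in the usual topology of $\mathbb C^{24}$). -/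

import Mathlib

open MvPolynomial

/-- The combinatorial data of an oriented ideal triangulation with `n` tetrahedra, each with
vertices `0, 1, 2, 3` in positive order. The face of the tetrahedron `T` opposite to the vertex
`l` is glued to a face of the tetrahedron `(glue T l).1`; the permutation `σ = (glue T l).2` sends
the vertices `i ≠ l` of the face to the vertices they are glued to, and sends `l` to the vertex
opposite to the target face. -/
structure IdealTriangulation (n : ℕ) where
  glue : Fin n → Fin 4 → Fin n × Equiv.Perm (Fin 4)
  /-- Gluing maps of the two sides of a face are inverse to each other. -/
  glue_glue : ∀ T l, glue (glue T l).1 ((glue T l).2 l) = (T, (glue T l).2⁻¹)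
  /-- A face is never glued to itself. -/
  glue_ne : ∀ T l, ((glue T l).1, (glue T l).2 l) ≠ (T, l)
  /-- Gluing maps reverse the orientation of the faces. -/
  sign_glue : ∀ T l, Equiv.Perm.sign (glue T l).2 = -1

/-- The oriented edges `ij` (`i ≠ j`) of `n` tetrahedra, as triples `(T, i, j)`. They index the
coordinates `z_{ij}(T)`; there are `12 n` of them. -/
abbrev OrientedEdge (n : ℕ) : Type :=
  {e : Fin n × Fin 4 × Fin 4 // e.2.1 ≠ e.2.2}

/-- The oriented edge from `i` to `j` of the tetrahedron `T`. -/
def orientedEdge {n : ℕ} (T : Fin n) (i j : Fin 4) (h : i ≠ j) : OrientedEdge n :=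
  ⟨(T, i, j), h⟩

/-- The face coordinate `z_{ijk} = - z_{il} z_{jl} z_{kl}` of the face of `T` opposite to the
vertex `l`, the face being oriented as a part of the boundary of `T`. -/
noncomputable def faceCoord {n : ℕ} (z : OrientedEdge n → ℂ) (T : Fin n) (l : Fin 4) : ℂ :=
  -∏ i : {i : Fin 4 // i ≠ l}, z (orientedEdge T i l i.2)

namespace IdealTriangulation

variable {n : ℕ} (𝒯 : IdealTriangulation n)

/-- Two oriented edges of tetrahedra that are glued to each other across one face. -/
def GluedEdges (e e' : OrientedEdge n) : Prop :=
  ∃ l : Fin 4, l ≠ e.1.2.1 ∧ l ≠ e.1.2.2 ∧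
    e'.1 = ((𝒯.glue e.1.1 l).1, (𝒯.glue e.1.1 l).2 e.1.2.1, (𝒯.glue e.1.1 l).2 e.1.2.2)

/-- Two oriented edges of tetrahedra that represent the same oriented edge of the
triangulation. -/
def SameEdge : OrientedEdge n → OrientedEdge n → Prop :=
  Relation.EqvGen 𝒯.GluedEdges

/-- The internal relations: for every tetrahedron `T`, with vertices `i, j, k, l` in positive
order, `z_{ij} z_{ik} z_{il} = -1` and `z_{ik} = 1 / (1 - z_{ij})`. -/
def InternalRelations {n : ℕ} (z : OrientedEdge n → ℂ) : Prop :=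
  ∀ (T : Fin n) (i j k l : Fin 4) (hij : i ≠ j) (hik : i ≠ k) (hil : i ≠ l),
    (∃ σ : Equiv.Perm (Fin 4), Equiv.Perm.sign σ = 1 ∧ σ 0 = i ∧ σ 1 = j ∧ σ 2 = k ∧ σ 3 = l) →
      z (orientedEdge T i j hij) * z (orientedEdge T i k hik) * z (orientedEdge T i l hil) = -1 ∧
      z (orientedEdge T i k hik) * (1 - z (orientedEdge T i j hij)) = 1

/-- The face relations: the two coordinates of the two sides of a face are inverse. -/
def FaceRelations (z : OrientedEdge n → ℂ) : Prop :=
  ∀ (T : Fin n) (l : Fin 4),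
    faceCoord z T l * faceCoord z (𝒯.glue T l).1 ((𝒯.glue T l).2 l) = 1

open Classical in
/-- The edge relations: around every edge of the triangulation, and for both of its orientations,
the product of the edge coordinates is `1`. -/
def EdgeRelations (z : OrientedEdge n → ℂ) : Prop :=
  ∀ e : OrientedEdge n, ∏ e' : OrientedEdge n with 𝒯.SameEdge e e', z e' = 1

/-- The `PGL(3, ℂ)` deformation variety `Defor(M, 𝒯) ⊆ ℂ^{12 n}`. -/
def deformationVariety : Set (OrientedEdge n → ℂ) :=
  {z | InternalRelations z ∧ 𝒯.FaceRelations z ∧ 𝒯.EdgeRelations z}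

end IdealTriangulation

/-- The permutation `0 ↦ 1 ↦ 2 ↦ 3 ↦ 0`. -/
def perm1230 : Equiv.Perm (Fin 4) := ⟨![1, 2, 3, 0], ![3, 0, 1, 2], by decide, by decide⟩

/-- The permutation `0 ↦ 2 ↦ 1 ↦ 3 ↦ 0`. -/
def perm2310 : Equiv.Perm (Fin 4) := ⟨![2, 3, 1, 0], ![3, 2, 0, 1], by decide, by decide⟩

/-- The standard ideal triangulation of the figure eight knot complement by two tetrahedra.
Write `u`, `v` for the coordinates of the tetrahedra `0`, `1`, and number vertices from `1` to `4`
instead of `0` to `3`. The faces of the first tetrahedron are glued to the second by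
`(2,3,4) → (2,4,3)`, `(1,3,4) → (2,4,1)`, `(1,2,4) → (3,4,1)`, `(1,2,3) → (3,2,1)`.
The edge relations are then
* `u₁₃ u₁₄ u₂₃ v₂₁ v₂₄ v₃₁ = 1` and `u₃₁ u₄₁ u₃₂ v₁₂ v₄₂ v₁₃ = 1`,
* `u₂₁ u₂₄ u₃₄ v₂₃ v₄₁ v₄₃ = 1` and `u₁₂ u₄₂ u₄₃ v₃₂ v₁₄ v₃₄ = 1`,
and the face relations are
* `u₂₁ u₃₁ u₄₁ v₂₁ v₃₁ v₄₁ = 1`, `u₁₂ u₃₂ u₄₂ v₁₃ v₂₃ v₄₃ = 1`,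
* `u₁₃ u₂₃ u₄₃ v₁₂ v₃₂ v₄₂ = 1`, `u₁₄ u₂₄ u₃₄ v₁₄ v₂₄ v₃₄ = 1`. -/
def figureEight : IdealTriangulation 2 where
  glue := ![
    ![(1, Equiv.swap 2 3), (1, perm1230), (1, perm2310), (1, Equiv.swap 0 2)],
    ![(0, Equiv.swap 2 3), (0, perm2310⁻¹), (0, perm1230⁻¹), (0, Equiv.swap 0 2)]]
  glue_glue := by decide
  glue_ne := by decide
  sign_glue := by decide

/-- `D` is an irreducible affine variety in `ℂ^ι`: the set of common zeros of some polynomials,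
with prime vanishing ideal (in particular `D` is not empty). -/
def IsIrreducibleVariety {ι : Type} (D : Set (ι → ℂ)) : Prop :=
  (∃ I : Ideal (MvPolynomial ι ℂ), D = zeroLocus ℂ I) ∧ (vanishingIdeal ℂ D).IsPrime

/-- The ring of regular functions on an affine variety. -/
abbrev CoordinateRing {ι : Type} (D : Set (ι → ℂ)) : Type :=
  MvPolynomial ι ℂ ⧸ vanishingIdeal ℂ D

/-! At each vertex the internal relations leave one free coordinate x, the other two being 1/(1-x)
and 1-1/x (`internalRelations_iff`). So a point of the variety is given by eight numbers a, …, h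
other than 0 and 1, on the edges 01, 10, 23, 32 of the two tetrahedra, that satisfy polynomial face
and edge relations (`FigureEightEquations`). The edge relations allow everything to be expressed in
a, s = c/a, B = 1/b - 1, r = (1/d - 1)/B and E = e/(1-e), with a(1-g) = c(1-h) = t for t = rBE.
Three equations remain (`ReducedEquations`), and they are preserved by an involution, which in the
original coordinates is (a, …, h) ↦ (1-h, 1-f, 1-g, 1-e, 1-d, 1-b, 1-c, 1-a).

Decomposition: if s ≠ 1, one equation gives t as a rational function of a, s, r, another then gives
(1+B)(1+rE), and for r² ≠ 1 the last one makes (B, E) the solution of a linear system. The condition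
rBE = t becomes `branchNorm' * branchNorm = 0`, and the involution exchanges the two factors. Where
`branchNorm` vanishes, the simple `BranchEquations` hold. For r = ±1 the same dichotomy is found by
hand. If s = 1, then r = ±1; here r = 1 is the symmetric component c = a, d = b, f = e, h = g, and r
= -1 falls into the two branches (`FigureEightEquations.cases`).

Geometry: each of the three pieces is isomorphic to an open part of a surface in ℂ³ whose equation
is quadratic in one variable (`BranchChart`, `SymmetricChart`). The coefficients are coprime and the
discriminant has a simple zero, so the equation is prime. Smoothness is the Jacobian criterion, and
the dimension is that of a hypersurface. The surface is a double cover of the complement of a plane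
curve, up to points over that curve, and it is connected because it has a branch point over the
complement. Since the 24 coordinates generate the ring of the surface, the piece is closed in ℂ²⁴
with this ring as coordinate ring. A point built from a primitive twelfth root of unity lies on all
three components, so their union is connected. -/

/-! ### Closed embeddings of affine varieties and their coordinate rings -/

section AffineEmbedding

variable {ι : Type} {A : Type} [CommRing A] [Algebra ℂ A]

/-- The set of complex points of the affine variety with coordinate functions `c`. -/
def complexPoints (c : ι → A) : Set (ι → ℂ) :=
  {z | ∃ ψ : A →ₐ[ℂ] ℂ, ∀ i, z i = ψ (c i)}

/-- Since the functions `c` generate `A`, a homomorphism `A → ℂ` is the same thing as an evaluation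
of polynomials that kills the relations among them. -/
theorem complexPoints_eq_zeroLocus (c : ι → A) (hc : Function.Surjective (aeval (R := ℂ) c)) :
    complexPoints c = zeroLocus ℂ (RingHom.ker (aeval (R := ℂ) c)) := by
  ext z
  constructor
  · rintro ⟨ψ, hψ⟩ p hp
    obtain rfl : z = fun i => ψ (c i) := funext hψ
    have h := (MvPolynomial.comp_aeval_apply (R := ℂ) (f := c) (φ := ψ) p)
    rw [← h, (RingHom.mem_ker.mp hp), map_zero]
  · intro hz
    have hle : RingHom.ker (aeval (R := ℂ) c) ≤ RingHom.ker (aeval (R := ℂ) z) := fun p hp =>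
      RingHom.mem_ker.mpr (hz p hp)
    refine ⟨(Ideal.Quotient.liftₐ _ (aeval (R := ℂ) z) fun p hp =>
      RingHom.mem_ker.mp (hle hp)).comp
      (Ideal.quotientKerAlgEquivOfSurjective hc).symm.toAlgHom, fun i => ?_⟩
    have : (Ideal.quotientKerAlgEquivOfSurjective hc).symm (c i)
        = Ideal.Quotient.mk _ (X i) := by
      rw [AlgEquiv.symm_apply_eq]
      simp
    simp [this]

variable [Finite ι] [IsDomain A] (c : ι → A) (hc : Function.Surjective (aeval (R := ℂ) c))
include hc

/-- The ideal of relations is prime because `A` is a domain, so the Nullstellensatz recovers it from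
its zeros. -/
theorem vanishingIdeal_complexPoints :
    vanishingIdeal ℂ (complexPoints c) = RingHom.ker (aeval (R := ℂ) c) := by
  have : (RingHom.ker (aeval (R := ℂ) c)).IsPrime := RingHom.ker_isPrime _
  rw [complexPoints_eq_zeroLocus c hc, IsPrime.vanishingIdeal_zeroLocus]

theorem isIrreducibleVariety_complexPoints : IsIrreducibleVariety (complexPoints c) := by
  refine ⟨⟨_, complexPoints_eq_zeroLocus c hc⟩, ?_⟩
  rw [vanishingIdeal_complexPoints c hc]
  exact RingHom.ker_isPrime _

/-- The coordinate ring of the variety of complex points of `A` is `A`. -/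
noncomputable def coordinateRingComplexPoints : CoordinateRing (complexPoints c) ≃ₐ[ℂ] A :=
  (Ideal.quotientEquivAlgOfEq ℂ (vanishingIdeal_complexPoints c hc)).trans
    (Ideal.quotientKerAlgEquivOfSurjective hc)

end AffineEmbedding

/-! ### Taylor expansion along square-zero directions -/

section SquareZero

/-- First order Taylor expansion along a square-zero direction. -/
theorem MvPolynomial.aeval_add_mul_of_sq_eq_zero {k B σ : Type*} [CommRing k] [CommRing B]
    [Algebra k B] [Fintype σ] (x γ : σ → B) {ε : B} (hε : ε * ε = 0) (F : MvPolynomial σ k) :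
    aeval (fun i => x i + ε * γ i) F =
      aeval x F + ε * ∑ i, γ i * aeval x (pderiv i F) := by
  classical
  induction F using MvPolynomial.induction_on with
  | C a => simp
  | add p q hp hq =>
    simp only [map_add, hp, hq, mul_add, Finset.sum_add_distrib]; ring
  | mul_X p i hp =>
    have h : ∑ j, γ j * aeval x (pderiv j (p * X i)) =
        (∑ j, γ j * aeval x (pderiv j p)) * x i + aeval x p * γ i := by
      have : ∀ j, γ j * aeval x (pderiv j (p * X i)) =
          γ j * aeval x (pderiv j p) * x i + (if j = i then aeval x p * γ i else 0) := by
        intro j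
        rw [pderiv_mul, pderiv_X, map_add, map_mul, map_mul, aeval_X]
        by_cases hj : j = i
        · subst hj; simp; ring
        · simp [hj, Ne.symm hj]; ring
      rw [Finset.sum_congr rfl fun j _ => this j, Finset.sum_add_distrib, Finset.sum_mul]
      simp
    rw [h, map_mul, map_mul, hp, aeval_X, aeval_X]
    linear_combination (∑ j, γ j * aeval x (pderiv j p)) * γ i * hε

end SquareZero

/-! ### Open parts of hypersurfaces: smoothness and integrality -/

section Hypersurface

variable {k σ : Type} [Field k] (F G : MvPolynomial σ k)

/-- The ring of regular functions on the complement of `G = 0` in the hypersurface `F = 0`. -/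
abbrev HypersurfaceRing : Type :=
  Localization.Away (Ideal.Quotient.mk (Ideal.span {F}) G)

/-- Restriction of polynomial functions to a hypersurface. -/
noncomputable def HypersurfaceRing.mk : MvPolynomial σ k →ₐ[k] HypersurfaceRing F G :=
  (IsScalarTower.toAlgHom k (MvPolynomial σ k ⧸ Ideal.span {F}) (HypersurfaceRing F G)).comp
    (Ideal.Quotient.mkₐ k (Ideal.span {F}))

namespace HypersurfaceRing

theorem mk_self : mk F G F = 0 := by
  have : (Ideal.Quotient.mk (Ideal.span {F})) F = 0 :=
    Ideal.Quotient.eq_zero_iff_mem.mpr (Ideal.subset_span rfl)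
  simp [mk, this]

theorem isUnit_mk : IsUnit (mk F G G) :=
  IsLocalization.Away.algebraMap_isUnit (S := HypersurfaceRing F G)
    (Ideal.Quotient.mk (Ideal.span {F}) G)

variable {F G} {B : Type*} [CommRing B] [Algebra k B]

/-- The homomorphism given by a point of the hypersurface. -/
noncomputable def lift (φ : MvPolynomial σ k →ₐ[k] B) (hF : φ F = 0) (hG : IsUnit (φ G)) :
    HypersurfaceRing F G →ₐ[k] B :=
  IsLocalization.liftAlgHom (M := Submonoid.powers (Ideal.Quotient.mk (Ideal.span {F}) G))
    (f := Ideal.Quotient.liftₐ (Ideal.span {F}) φ (by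
      intro p hp
      obtain ⟨q, rfl⟩ := Ideal.mem_span_singleton.mp hp
      simp [hF])) (by
      rintro ⟨_, n, rfl⟩
      rw [map_pow]
      exact hG.pow n)

theorem lift_mk (φ : MvPolynomial σ k →ₐ[k] B) (hF : φ F = 0) (hG : IsUnit (φ G))
    (p : MvPolynomial σ k) : lift φ hF hG (mk F G p) = φ p := by
  simp only [lift, mk, AlgHom.comp_apply, IsScalarTower.coe_toAlgHom',
    IsLocalization.liftAlgHom_apply,
    IsLocalization.lift_eq]
  rfl

theorem algHom_ext {φ ψ : HypersurfaceRing F G →ₐ[k] B}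
    (h : ∀ i, φ (mk F G (X i)) = ψ (mk F G (X i))) : φ = ψ := by
  have h1 : φ.comp (mk F G) = ψ.comp (mk F G) := MvPolynomial.algHom_ext h
  refine IsLocalization.algHom_ext
    (Submonoid.powers (Ideal.Quotient.mk (Ideal.span {F}) G)) ?_
  apply Ideal.Quotient.algHom_ext
  exact h1

/-- Jacobian criterion for hypersurfaces. -/
theorem formallySmooth [Fintype σ]
    (h : Ideal.span (Set.range fun i => mk F G (pderiv i F)) = ⊤) :
    Algebra.FormallySmooth k (HypersurfaceRing F G) := by
  apply Algebra.FormallySmooth.of_comp_surjective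
  intro B _ _ I hI ψ
  obtain ⟨c, hc⟩ := (Submodule.mem_span_range_iff_exists_fun _).mp
    ((Ideal.eq_top_iff_one _).mp h)
  have hsurj := Ideal.Quotient.mk_surjective (I := I)
  have hsq : ∀ u ∈ I, ∀ v ∈ I, u * v = 0 := fun u hu v hv => by
    have := Ideal.mul_mem_mul hu hv
    rwa [← pow_two, hI, Ideal.mem_bot] at this
  choose x hx using fun i => hsurj (ψ (mk F G (X i)))
  choose γ hγ using fun i => hsurj (ψ (c i))
  have hcomp : ∀ (y : σ → B), (∀ i, Ideal.Quotient.mk I (y i) = ψ (mk F G (X i))) → ∀ p,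
      Ideal.Quotient.mk I (aeval y p) = ψ (mk F G p) := by
    intro y hy p
    have : (Ideal.Quotient.mkₐ k I).comp (aeval y) = ψ.comp (mk F G) :=
      MvPolynomial.algHom_ext fun i => by simp [hy]
    exact DFunLike.congr_fun this p
  -- One Newton step: `γ` lifts the coefficients of a relation ∑ cᵢ ∂ᵢF = 1, so moving the lift `x`
  -- by `ε * γ` changes `F` by `ε` times an element of 1 + I. As I² = 0, this cancels `aeval x F`
  -- exactly.
  set ε := -aeval x F with hε
  have hεI : ε ∈ I := by
    rw [hε, neg_mem_iff, ← Ideal.Quotient.eq_zero_iff_mem, hcomp x hx, mk_self, map_zero]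
  have hy : ∀ i, Ideal.Quotient.mk I (x i + ε * γ i) = ψ (mk F G (X i)) := by
    intro i
    rw [map_add, map_mul, Ideal.Quotient.eq_zero_iff_mem.mpr hεI, hx]; simp
  have hF : aeval (fun i => x i + ε * γ i) F = 0 := by
    rw [MvPolynomial.aeval_add_mul_of_sq_eq_zero x γ (hsq ε hεI ε hεI)]
    have h1 : 1 - ∑ i, γ i * aeval x (pderiv i F) ∈ I := by
      rw [← Ideal.Quotient.eq_zero_iff_mem, map_sub, map_one, map_sum]
      simp only [map_mul, hγ, hcomp x hx]
      rw [← map_one ψ, ← hc, map_sum]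
      simp
    have h2 := hsq _ hεI _ h1
    have h3 : aeval x F = -ε := by simp [hε]
    rw [h3]
    linear_combination -h2
  have hG : IsUnit (aeval (fun i => x i + ε * γ i) G) := by
    have h1 : IsUnit (Ideal.Quotient.mk I (aeval (fun i => x i + ε * γ i) G)) := by
      rw [hcomp _ hy]; exact (isUnit_mk F G).map ψ
    obtain ⟨w, hw⟩ := hsurj ↑(h1.unit⁻¹)
    have h2 : aeval (fun i => x i + ε * γ i) G * w - 1 ∈ I := by
      rw [← Ideal.Quotient.eq_zero_iff_mem, map_sub, map_mul, hw, IsUnit.mul_val_inv, map_one,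
        sub_self]
    have h3 := hsq _ h2 _ h2
    -- `w` is an inverse modulo `I`; since (Gw - 1)² = 0, the corrected w(2 - Gw) is a true inverse.
    refine IsUnit.of_mul_eq_one (w * (2 - aeval (fun i => x i + ε * γ i) G * w)) ?_
    linear_combination -h3
  refine ⟨lift (aeval fun i => x i + ε * γ i) hF hG, ?_⟩
  apply algHom_ext
  intro i
  simp only [AlgHom.comp_apply, lift_mk, aeval_X]
  exact hy i

/-- Pointwise form of the Jacobian criterion for hypersurfaces. -/
theorem smooth [Fintype σ]
    (h : ∀ (K : Type) [Field K] [Algebra k K] (x : σ → K), aeval x F = 0 →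
      (∀ i, aeval x (pderiv i F) = 0) → aeval x G = 0) :
    Algebra.Smooth k (HypersurfaceRing F G) where
  formallySmooth := by
    apply formallySmooth
    by_contra hne
    -- A maximal ideal containing all partial derivatives gives a singular point over its residue
    -- field at which `G` is invertible. This field is an arbitrary extension of `k`, whence the
    -- quantifier over `K`.
    obtain ⟨m, hm, hle⟩ := Ideal.exists_le_maximal _ hne
    let _ := Ideal.Quotient.field m
    let φ : MvPolynomial σ k →ₐ[k] (HypersurfaceRing F G ⧸ m) :=
      (Ideal.Quotient.mkₐ k m).comp (mk F G)
    have hφ : ∀ p, aeval (fun i => φ (X i)) p = φ p := fun p => by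
      conv_rhs => rw [← aeval_X_left_apply p]
      rw [comp_aeval_apply]
    have h1 := h (HypersurfaceRing F G ⧸ m) (fun i => φ (X i))
      (by rw [hφ]; simp [φ, mk_self]) (fun i => by
        rw [hφ]
        exact Ideal.Quotient.eq_zero_iff_mem.mpr (hle (Ideal.subset_span ⟨i, rfl⟩)))
    rw [hφ] at h1
    exact ((isUnit_mk F G).map (Ideal.Quotient.mkₐ k m)).ne_zero h1
  finitePresentation := by
    have h1 : Algebra.FinitePresentation k (MvPolynomial σ k ⧸ Ideal.span {F}) :=
      Algebra.FinitePresentation.quotient ⟨{F}, by simp⟩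
    have h2 : Algebra.FinitePresentation (MvPolynomial σ k ⧸ Ideal.span {F})
        (HypersurfaceRing F G) :=
      IsLocalization.Away.finitePresentation (Ideal.Quotient.mk (Ideal.span {F}) G)
    exact Algebra.FinitePresentation.trans k (MvPolynomial σ k ⧸ Ideal.span {F}) _

variable (x₀ : σ → k) (hF0 : aeval x₀ F = 0) (hG0 : aeval x₀ G ≠ 0)
include hF0 hG0

theorem not_dvd : ¬ F ∣ G := by
  rintro ⟨q, rfl⟩
  rw [map_mul, hF0, zero_mul] at hG0
  exact hG0 rfl

theorem isDomain (hF : Prime F) : IsDomain (HypersurfaceRing F G) := by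
  have : (Ideal.span {F}).IsPrime := (Ideal.span_singleton_prime hF.ne_zero).mpr hF
  refine IsLocalization.isDomain_localization (M := Submonoid.powers
    (Ideal.Quotient.mk (Ideal.span {F}) G)) ?_
  apply powers_le_nonZeroDivisors_of_noZeroDivisors
  rw [Ne, Ideal.Quotient.eq_zero_iff_mem, Ideal.mem_span_singleton]
  exact not_dvd x₀ hF0 hG0

end HypersurfaceRing

end Hypersurface

/-! ### Dimension of an open part of a hypersurface -/

section Dimension

variable {k : Type} [Field k]

/-- The maximal ideal of a point of affine `n`-space has height at least `n`. -/
theorem MvPolynomial.le_height_ker_aeval {n : ℕ} (x : Fin n → k) :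
    (n : ℕ∞) ≤ (RingHom.ker (aeval (R := k) x)).height := by
  -- `e m` substitutes the point into the first `m` variables only; the kernels form a strictly
  -- increasing chain of primes, ending with the ideal of the point.
  let e : ℕ → MvPolynomial (Fin n) k →ₐ[k] MvPolynomial (Fin n) k := fun m =>
    aeval fun i => if (i : ℕ) < m then C (x i) else X i
  have hprime : ∀ m, (RingHom.ker (e m)).IsPrime := fun m => RingHom.ker_isPrime _
  have hlt : ∀ m < n, RingHom.ker (e m) < RingHom.ker (e (m + 1)) := by
    intro m hm
    have hcomp : (e (m + 1)).comp (e m) = e (m + 1) := by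
      apply MvPolynomial.algHom_ext
      intro i
      simp only [AlgHom.comp_apply, e, aeval_X]
      split_ifs with h1 <;> simp [algHom_C] <;> omega
    refine lt_of_le_of_ne (fun p hp => ?_) (fun heq => ?_)
    · rw [RingHom.mem_ker] at hp ⊢
      rw [← hcomp, AlgHom.comp_apply, hp, map_zero]
    · have h1 : X ⟨m, hm⟩ - C (x ⟨m, hm⟩) ∈ RingHom.ker (e (m + 1)) := by
        simp [RingHom.mem_ker, e, algHom_C]
      rw [← heq, RingHom.mem_ker] at h1
      have h2 : (X ⟨m, hm⟩ : MvPolynomial (Fin n) k) = C (x ⟨m, hm⟩) := by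
        simpa [e, algHom_C, sub_eq_zero] using h1
      have h3 := congrArg (pderiv (⟨m, hm⟩ : Fin n)) h2
      rw [pderiv_X_self, pderiv_C] at h3
      exact one_ne_zero h3
  have hle : ∀ m ≤ n, (m : ℕ∞) ≤ (RingHom.ker (e m)).height := by
    intro m
    induction m with
    | zero => simp
    | succ m ih =>
      intro hm
      have h1 := ih (by omega)
      have := hprime m
      have := hprime (m + 1)
      have h2 : (RingHom.ker (e m)).height + 1 ≤ (RingHom.ker (e (m + 1))).height :=
        Order.add_one_le_of_lt (Ideal.height_strict_mono_of_isPrime (hlt m (by omega)))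
      push_cast
      exact (by gcongr : (m : ℕ∞) + 1 ≤ (RingHom.ker (e m)).height + 1).trans h2
  have hn : RingHom.ker (e n) = RingHom.ker (aeval (R := k) x) := by
    have : e n = (Algebra.ofId k (MvPolynomial (Fin n) k)).comp (aeval x) := by
      apply MvPolynomial.algHom_ext
      intro i
      simp [e, Algebra.ofId_apply]
    ext p
    rw [RingHom.mem_ker, RingHom.mem_ker, this, AlgHom.comp_apply, Algebra.ofId_apply,
      MvPolynomial.algebraMap_eq, map_eq_zero_iff _ (C_injective _ _)]
  exact hn ▸ hle n le_rfl

/-- Upper bound: dividing by the nonzero divisor `F` lowers the dimension n + 1, and localization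
does not raise it. Lower bound: the ideal of the point `x` has height at least n + 1, loses at most
one modulo `F`, and survives the localization because `G` does not vanish at `x`. -/
theorem HypersurfaceRing.ringKrullDim_eq {n : ℕ} {F G : MvPolynomial (Fin (n + 1)) k}
    (hF : Prime F) (x : Fin (n + 1) → k) (hF0 : aeval x F = 0) (hG0 : aeval x G ≠ 0) :
    ringKrullDim (HypersurfaceRing F G) = n := by
  apply le_antisymm
  · have h1 : ringKrullDim (HypersurfaceRing F G) ≤
        ringKrullDim (MvPolynomial (Fin (n + 1)) k ⧸ Ideal.span {F}) := by
      refine Order.krullDim_le_of_strictMono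
        (PrimeSpectrum.comap (algebraMap _ (HypersurfaceRing F G))) ?_
      refine Monotone.strictMono_of_injective (fun a b h => Ideal.comap_mono h) ?_
      exact PrimeSpectrum.localization_comap_injective _
        (Submonoid.powers (Ideal.Quotient.mk (Ideal.span {F}) G))
    have h2 := ringKrullDim_quotient_succ_le_of_nonZeroDivisor
      (mem_nonZeroDivisors_of_ne_zero hF.ne_zero)
    rw [MvPolynomial.ringKrullDim_of_isNoetherianRing, ringKrullDim_eq_zero_of_field,
      Nat.card_eq_fintype_card, Fintype.card_fin] at h2
    have h3 : ringKrullDim (HypersurfaceRing F G) + 1 ≤ (n : WithBot ℕ∞) + 1 := by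
      refine le_trans (by gcongr) (h2.trans ?_)
      simp
    exact ENat.WithBot.add_le_add_one_right_iff.mp h3
  · have := RingHom.ker_isPrime (aeval (R := k) x)
    set m := RingHom.ker (aeval (R := k) x)
    have hFm : F ∈ m := RingHom.mem_ker.mpr hF0
    have h1 := Ideal.height_le_height_add_one_of_mem hFm
    have h2 := (MvPolynomial.le_height_ker_aeval x).trans h1
    have hle : Ideal.span {F} ≤ m := by simpa [Ideal.span_le] using hFm
    have hp : (m.map (Ideal.Quotient.mk (Ideal.span {F}))).IsPrime :=
      Ideal.isPrime_map_quotientMk_of_isPrime hle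
    have hdisj : Disjoint ((Submonoid.powers (Ideal.Quotient.mk (Ideal.span {F}) G) :
        Submonoid _) : Set (MvPolynomial (Fin (n + 1)) k ⧸ Ideal.span {F}))
        (m.map (Ideal.Quotient.mk (Ideal.span {F}))) := by
      rw [Set.disjoint_left]
      rintro _ ⟨j, rfl⟩ hj
      have h3 : Ideal.Quotient.mk (Ideal.span {F}) G ∈ m.map (Ideal.Quotient.mk (Ideal.span {F})) :=
        hp.mem_of_pow_mem j hj
      rw [← Ideal.mem_comap, Ideal.comap_map_of_surjective _ Ideal.Quotient.mk_surjective,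
        ← RingHom.ker_eq_comap_bot, Ideal.mk_ker, sup_eq_left.mpr hle] at h3
      exact hG0 (RingHom.mem_ker.mp h3)
    have h4 := IsLocalization.height_map_of_disjoint (S := HypersurfaceRing F G)
      (Submonoid.powers (Ideal.Quotient.mk (Ideal.span {F}) G)) _ hdisj
    have h5 : (n : ℕ∞) ≤ (m.map (Ideal.Quotient.mk (Ideal.span {F}))).height := by
      push_cast at h2
      exact (ENat.add_le_add_iff_right (by simp)).mp h2
    rw [← h4] at h5
    have hpr := IsLocalization.isPrime_of_isPrime_disjoint
      (Submonoid.powers (Ideal.Quotient.mk (Ideal.span {F}) G)) (HypersurfaceRing F G) _ hp hdisj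
    have h6 := Ideal.height_le_ringKrullDim_of_ne_top hpr.ne_top
    exact le_trans (by exact_mod_cast h5) h6

end Dimension

/-! ### Connectedness of hypersurface complements and of their double covers -/

section Connectedness

variable {n : ℕ}

/-- The restriction of a polynomial to the line through `x` and `y`. -/
noncomputable def MvPolynomial.alongLine (h : MvPolynomial (Fin n) ℂ) (x y : Fin n → ℂ) :
    Polynomial ℂ :=
  aeval (fun i => Polynomial.C (x i) + Polynomial.X * Polynomial.C (y i - x i)) h

theorem MvPolynomial.eval_alongLine (h : MvPolynomial (Fin n) ℂ) (x y : Fin n → ℂ) (t : ℂ) :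
    (h.alongLine x y).eval t = aeval (fun i => x i + t * (y i - x i)) h := by
  rw [alongLine, ← Polynomial.coe_aeval_eq_eval, ← AlgHom.restrictScalars_apply ℂ,
    comp_aeval_apply]
  congr 2
  ext i
  simp

theorem MvPolynomial.alongLine_ne_zero {h : MvPolynomial (Fin n) ℂ} {x y : Fin n → ℂ}
    (hy : aeval y h ≠ 0) : h.alongLine x y ≠ 0 := by
  intro h0
  have := h.eval_alongLine x y 1
  rw [h0] at this
  simp at this
  exact hy (by simp [this])

/-- On the complex line through two points of the set, `h` has finitely many zeros, and ℂ minus a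
finite set is connected. -/
theorem MvPolynomial.isPreconnected_setOf_ne_zero (h : MvPolynomial (Fin n) ℂ) :
    IsPreconnected {x : Fin n → ℂ | aeval x h ≠ 0} := by
  refine isPreconnected_of_forall_pair fun x hx y hy => ?_
  let γ : ℂ → (Fin n → ℂ) := fun t i => x i + t * (y i - x i)
  have hγ : Continuous γ := by fun_prop
  have hfin : ((h.alongLine x y).roots.toFinset : Set ℂ).Countable :=
    (Finset.finite_toSet _).countable
  have hconn := (hfin.isPathConnected_compl_of_one_lt_rank (by simp)).isConnected.isPreconnected
  have hmem : ∀ t, t ∈ ((h.alongLine x y).roots.toFinset : Set ℂ)ᶜ ↔ aeval (γ t) h ≠ 0 := by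
    intro t
    rw [← h.eval_alongLine x y t]
    simp [Polynomial.IsRoot, alongLine_ne_zero hy]
  refine ⟨γ '' ((h.alongLine x y).roots.toFinset : Set ℂ)ᶜ, ?_, ?_, ?_,
    hconn.image _ hγ.continuousOn⟩
  · rintro _ ⟨t, ht, rfl⟩
    exact (hmem t).mp ht
  · exact ⟨0, (hmem 0).mpr (by simpa [γ] using hx), by simp [γ]⟩
  · have h1 : γ 1 = y := by ext i; simp [γ]
    exact ⟨1, (hmem 1).mpr (h1 ▸ hy), h1⟩

theorem MvPolynomial.dense_setOf_ne_zero {h : MvPolynomial (Fin n) ℂ} {y : Fin n → ℂ}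
    (hy : aeval y h ≠ 0) : Dense {x : Fin n → ℂ | aeval x h ≠ 0} := by
  intro x
  let γ : ℂ → (Fin n → ℂ) := fun t i => x i + t * (y i - x i)
  have hγ : Continuous γ := by fun_prop
  have hfin : ((h.alongLine x y).roots.toFinset : Set ℂ).Finite := Finset.finite_toSet _
  have hd : Dense ((h.alongLine x y).roots.toFinset : Set ℂ)ᶜ := hfin.countable.dense_compl ℝ
  have h0 : γ 0 = x := by ext i; simp [γ]
  rw [← h0]
  refine closure_mono ?_ (image_closure_subset_closure_image hγ ⟨0, hd 0, rfl⟩)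
  rintro _ ⟨t, ht, rfl⟩
  have := h.eval_alongLine x y t
  rw [Set.mem_ofPred_eq, ← this]
  simpa [Polynomial.IsRoot, alongLine_ne_zero hy] using ht

/-- Square roots depend continuously on the argument. -/
theorem exists_sqrt_near {a b w : ℂ} (hw : w * w = a) :
    ∃ w', w' * w' = b ∧ ‖w' - w‖ ^ 2 ≤ ‖b - a‖ := by
  obtain ⟨u, hu⟩ := IsAlgClosed.exists_pow_nat_eq b (n := 2) (by norm_num)
  have h1 : ‖u - w‖ * ‖-u - w‖ = ‖b - a‖ := by
    rw [← norm_mul, ← norm_neg]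
    congr 1
    linear_combination hu - hw
  rcases le_total ‖u - w‖ ‖-u - w‖ with h | h
  · exact ⟨u, by linear_combination hu, by rw [← h1, pow_two]; gcongr⟩
  · exact ⟨-u, by linear_combination hu, by rw [← h1, pow_two]; gcongr⟩

/-- The product of the distances from `w'` to `w` and to `-w` is ‖b - a‖, so the square of the
smaller one is at most that. -/
theorem sqrt_near_or {a b w w' : ℂ} (hw : w * w = a) (hw' : w' * w' = b) :
    ‖w' - w‖ ^ 2 ≤ ‖b - a‖ ∨ ‖w' - -w‖ ^ 2 ≤ ‖b - a‖ := by
  have h1 : ‖w' - w‖ * ‖w' - -w‖ = ‖b - a‖ := by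
    rw [← norm_mul]
    congr 1
    linear_combination hw' - hw
  rcases le_total ‖w' - w‖ ‖w' - -w‖ with h | h
  · left; rw [← h1, pow_two]; gcongr
  · right; rw [← h1, pow_two]; gcongr

section DoubleCover

variable {X : Type*} [TopologicalSpace X] {δ : X → ℂ} (hδ : Continuous δ)
include hδ

theorem eventually_exists_sqrt {x : X} {w : ℂ} (hw : w * w = δ x) {O : Set (X × ℂ)}
    (hO : O ∈ nhds (x, w)) : ∀ᶠ y in nhds x, ∃ w', w' * w' = δ y ∧ (y, w') ∈ O := by
  rw [nhds_prod_eq, Filter.mem_prod_iff] at hO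
  obtain ⟨U, hU, V, hV, hUV⟩ := hO
  obtain ⟨ε, hε, hball⟩ := Metric.mem_nhds_iff.mp hV
  have h1 : ∀ᶠ y in nhds x, ‖δ y - δ x‖ < ε ^ 2 := by
    have := (Metric.tendsto_nhds.mp (hδ.continuousAt (x := x))) (ε ^ 2) (by positivity)
    simpa [dist_eq_norm] using this
  filter_upwards [h1, hU] with y hy hyU
  obtain ⟨w', hw', hn⟩ := exists_sqrt_near (b := δ y) hw
  refine ⟨w', hw', hUV ⟨hyU, hball ?_⟩⟩
  rw [Metric.mem_ball, dist_eq_norm]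
  exact lt_of_pow_lt_pow_left₀ 2 hε.le (hn.trans_lt hy)

theorem eventually_forall_sqrt {x : X} {w : ℂ} (hw : w * w = δ x) {O : Set (X × ℂ)}
    (hO : O ∈ nhds (x, w)) (hO' : O ∈ nhds (x, -w)) :
    ∀ᶠ y in nhds x, ∀ w', w' * w' = δ y → (y, w') ∈ O := by
  rw [nhds_prod_eq, Filter.mem_prod_iff] at hO hO'
  obtain ⟨U, hU, V, hV, hUV⟩ := hO
  obtain ⟨U', hU', V', hV', hUV'⟩ := hO'
  obtain ⟨ε, hε, hball⟩ := Metric.mem_nhds_iff.mp hV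
  obtain ⟨ε', hε', hball'⟩ := Metric.mem_nhds_iff.mp hV'
  have h1 : ∀ η > 0, ∀ᶠ y in nhds x, ‖δ y - δ x‖ < η ^ 2 := by
    intro η hη
    have := (Metric.tendsto_nhds.mp (hδ.continuousAt (x := x))) (η ^ 2) (by positivity)
    simpa [dist_eq_norm] using this
  filter_upwards [h1 ε hε, h1 ε' hε', hU, hU'] with y hy hy' hyU hyU' w' hw'
  rcases sqrt_near_or hw hw' with hn | hn
  · refine hUV ⟨hyU, hball ?_⟩
    rw [Metric.mem_ball, dist_eq_norm]
    exact lt_of_pow_lt_pow_left₀ 2 hε.le (hn.trans_lt hy)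
  · refine hUV' ⟨hyU', hball' ?_⟩
    rw [Metric.mem_ball, dist_eq_norm]
    exact lt_of_pow_lt_pow_left₀ 2 hε'.le (hn.trans_lt hy')

/-- A part of the double cover `w² = δ` that contains the fibres over a dense connected set, with a branch
point in that set, is connected. -/
theorem isConnected_doubleCover {Ω : Set (X × ℂ)} (W : Set X)
    (hWc : IsPreconnected W) (hWd : Dense W)
    (hW : ∀ x ∈ W, ∀ w, w * w = δ x → (x, w) ∈ Ω)
    {x₀ : X} (hx₀ : x₀ ∈ W) (hδ₀ : δ x₀ = 0) :
    IsConnected {z : X × ℂ | z.2 * z.2 = δ z.1 ∧ z ∈ Ω} := by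
  set S := {z : X × ℂ | z.2 * z.2 = δ z.1 ∧ z ∈ Ω} with hS
  have hbase : (x₀, (0 : ℂ)) ∈ S := ⟨by simp [hδ₀], hW x₀ hx₀ 0 (by simp [hδ₀])⟩
  refine ⟨⟨_, hbase⟩, ?_⟩
  -- it suffices that an open set containing the branch point and all of its fibre meets everything
  rw [isPreconnected_iff_subset_of_disjoint]
  have key : ∀ U V : Set (X × ℂ), IsOpen U → IsOpen V → S ⊆ U ∪ V → S ∩ (U ∩ V) = ∅ →
      (x₀, (0 : ℂ)) ∈ U → S ⊆ U := by
    intro U V hU hV hSUV hdis h0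
    have hdis' : ∀ z ∈ S, z ∈ U → z ∉ V := fun z hz hzU hzV => by
      have : z ∈ S ∩ (U ∩ V) := ⟨hz, hzU, hzV⟩
      rw [hdis] at this; exact this
    -- Over `T` the nearby fibres lie entirely in `U`; over `T'` they meet `V`. Both sets are open,
    -- they are disjoint by density of `W`, and they cover `W`. The fibre of `x₀` is a single point
    -- of `U`, so `x₀` is in `T`, and connectedness gives W ⊆ T.
    let T : Set X := {x | ∀ᶠ y in nhds x, ∀ w, w * w = δ y → (y, w) ∈ U}
    let T' : Set X := {x | ∀ᶠ y in nhds x, ∃ w, w * w = δ y ∧ (y, w) ∈ V}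
    have hT : IsOpen T := isOpen_iff_eventually.mpr fun x hx => hx.eventually_nhds
    have hT' : IsOpen T' := isOpen_iff_eventually.mpr fun x hx => hx.eventually_nhds
    have hWT : W ⊆ T := by
      refine hWc.subset_left_of_subset_union (v := T') hT hT' ?_ ?_ ⟨x₀, hx₀, ?_⟩
      · rw [Set.disjoint_left]
        intro x hx hx'
        obtain ⟨y, ⟨h1, w, hw, hwV⟩, hyW⟩ :=
          mem_closure_iff_nhds.mp (hWd x) _ (hx.and hx')
        exact hdis' _ ⟨hw, hW y hyW w hw⟩ (h1 w hw) hwV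
      · intro x hx
        by_cases h : ∀ w, w * w = δ x → (x, w) ∈ U
        · left
          obtain ⟨w, hw⟩ := IsAlgClosed.exists_pow_nat_eq (δ x) (n := 2) (by norm_num)
          have hw1 : w * w = δ x := by rw [← hw]; ring
          exact eventually_forall_sqrt hδ hw1 (hU.mem_nhds (h w hw1))
            (hU.mem_nhds (h (-w) (by rw [← hw1]; ring)))
        · right
          push Not at h
          obtain ⟨w, hw, hwU⟩ := h
          exact eventually_exists_sqrt hδ hw (hV.mem_nhds
            ((hSUV ⟨hw, hW x hx w hw⟩).resolve_left hwU))
      · exact eventually_forall_sqrt hδ (w := 0) (by simp [hδ₀]) (hU.mem_nhds h0)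
          (hU.mem_nhds (by simpa using h0))
    -- A point of the cover in `V` would have points of `V` in all nearby fibres, in particular in
    -- one over `W`, whose fibres lie in `U`.
    intro z hz
    by_contra hzU
    have hzV := (hSUV hz).resolve_left hzU
    obtain ⟨y, ⟨w, hw, hwV⟩, hyW⟩ := mem_closure_iff_nhds.mp (hWd z.1) _
      (eventually_exists_sqrt hδ hz.1 (hV.mem_nhds hzV))
    exact hdis' _ ⟨hw, hW y hyW w hw⟩ ((hWT hyW).self_of_nhds w hw) hwV
  intro U V hU hV hSUV hdis
  rcases hSUV hbase with h | h
  · exact Or.inl (key U V hU hV hSUV hdis h)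
  · exact Or.inr (key V U hV hU (by rwa [Set.union_comm]) (by rwa [Set.inter_comm V U]) h)

end DoubleCover

/-- A part of the hypersurface `α v² + β v + γ = 0` in affine `(n + 1)`-space, on which `α` does not
vanish and which contains the fibres over the complement of `h = 0`, is connected if it has a branch
point in that complement. -/
theorem isConnected_quadraticCover {α β γ : (Fin n → ℂ) → ℂ} (hα : Continuous α)
    (hβ : Continuous β) (hγ : Continuous γ) (h : MvPolynomial (Fin n) ℂ)
    {Ω : Set (ℂ × (Fin n → ℂ))} (hΩα : ∀ z ∈ Ω, α z.2 ≠ 0)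
    (hh : ∀ x, aeval x h ≠ 0 → ∀ v, α x * v ^ 2 + β x * v + γ x = 0 → (v, x) ∈ Ω)
    (hhα : ∀ x, aeval x h ≠ 0 → α x ≠ 0)
    {x₀ : Fin n → ℂ} (hx₀ : aeval x₀ h ≠ 0) (hδ₀ : β x₀ ^ 2 - 4 * α x₀ * γ x₀ = 0) :
    IsConnected {z : ℂ × (Fin n → ℂ) | α z.2 * z.1 ^ 2 + β z.2 * z.1 + γ z.2 = 0 ∧ z ∈ Ω} := by
  -- Completing the square: w = 2αv + β satisfies w² = β² - 4αγ, and `f` recovers v from w.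
  let f : (Fin n → ℂ) × ℂ → ℂ × (Fin n → ℂ) := fun z => ((z.2 - β z.1) / (2 * α z.1), z.1)
  let Ω' : Set ((Fin n → ℂ) × ℂ) := {z | α z.1 ≠ 0} ∩ f ⁻¹' Ω
  have hf : ContinuousOn f {z | α z.1 ≠ 0} := by
    refine ContinuousOn.prodMk (ContinuousOn.div (by fun_prop) (by fun_prop) ?_) (by fun_prop)
    intro z hz
    exact mul_ne_zero two_ne_zero hz
  have hconn := isConnected_doubleCover (δ := fun x => β x ^ 2 - 4 * α x * γ x) (by fun_prop)
    (Ω := Ω') {x | aeval x h ≠ 0} h.isPreconnected_setOf_ne_zero (dense_setOf_ne_zero hx₀)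
    (fun x hx w hw => by
      have hαx := hhα x hx
      refine ⟨hαx, hh x hx _ ?_⟩
      field_simp
      linear_combination hw)
    hx₀ hδ₀
  convert hconn.image f (hf.mono fun z hz => hz.2.1) using 1
  ext ⟨v, x⟩
  constructor
  · rintro ⟨hq, hv⟩
    have hαx := hΩα _ hv
    dsimp only at hq hαx
    have hfz : f (x, 2 * α x * v + β x) = (v, x) := by
      simp only [f, Prod.mk.injEq, and_true]
      field_simp
      ring
    refine ⟨(x, 2 * α x * v + β x), ⟨?_, hαx, ?_⟩, hfz⟩
    · dsimp only
      linear_combination 4 * α x * hq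
    · rw [Set.mem_preimage, hfz]; exact hv
  · rintro ⟨⟨y, w⟩, ⟨hw, hαx, hv⟩, heq⟩
    simp only [f, Prod.mk.injEq] at heq
    obtain ⟨rfl, rfl⟩ := heq
    refine ⟨?_, hv⟩
    dsimp only at hw hαx ⊢
    have hα' : α y ≠ 0 := hαx
    field_simp
    linear_combination hw

end Connectedness

/-! ### Irreducibility of quadratic equations -/

section Irreducibility

/-- A factor of degree zero divides all coefficients, hence is a unit. A product of linear factors
(aX + b)(cX + d) has the square discriminant (ad - bc)². -/
theorem Polynomial.irreducible_quadratic {R : Type*} [CommRing R] [IsDomain R] {α β γ : R}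
    (hα : α ≠ 0) (hgcd : ∀ d, d ∣ α → d ∣ β → d ∣ γ → IsUnit d)
    (hdisc : ∀ s, s ^ 2 ≠ β ^ 2 - 4 * α * γ) :
    Irreducible (C α * X ^ 2 + C β * X + C γ : Polynomial R) := by
  have hdeg : (C α * X ^ 2 + C β * X + C γ : Polynomial R).natDegree = 2 :=
    natDegree_quadratic hα
  have hunit : ∀ f g : Polynomial R, C α * X ^ 2 + C β * X + C γ = f * g → f.natDegree = 0 →
      IsUnit f := by
    intro f g hfg hf
    rw [eq_C_of_natDegree_eq_zero hf] at hfg ⊢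
    have key : ∀ i, f.coeff 0 ∣ (C α * X ^ 2 + C β * X + C γ : Polynomial R).coeff i :=
      fun i => ⟨g.coeff i, by rw [hfg, coeff_C_mul]⟩
    refine (hgcd _ ?_ ?_ ?_).map C
    · simpa [coeff_X, coeff_C] using key 2
    · simpa [coeff_X, coeff_C] using key 1
    · simpa [coeff_X, coeff_C] using key 0
  refine ⟨fun h => ?_, fun f g hfg => ?_⟩
  · rw [natDegree_eq_zero_of_isUnit h] at hdeg
    omega
  · have hne : f * g ≠ 0 := by
      rw [← hfg]
      rintro h
      rw [h] at hdeg
      simp at hdeg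
    have hsum : f.natDegree + g.natDegree = 2 := by
      rw [← natDegree_mul (left_ne_zero_of_mul hne) (right_ne_zero_of_mul hne), ← hfg, hdeg]
    rcases Nat.eq_zero_or_pos f.natDegree with hf | hf
    · exact Or.inl (hunit f g hfg hf)
    rcases Nat.eq_zero_or_pos g.natDegree with hg | hg
    · exact Or.inr (hunit g f (by rw [hfg, mul_comm]) hg)
    exfalso
    obtain ⟨a, b, rfl⟩ := exists_eq_X_add_C_of_natDegree_le_one (show f.natDegree ≤ 1 by omega)
    obtain ⟨c, d, rfl⟩ := exists_eq_X_add_C_of_natDegree_le_one (show g.natDegree ≤ 1 by omega)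
    have hprod : (C a * X + C b) * (C c * X + C d) =
        C (a * c) * X ^ 2 + C (a * d + b * c) * X + C (b * d) := by
      simp only [C_mul, C_add]
      ring
    rw [hprod] at hfg
    have hcoeff : ∀ {u v w : R}, C α * X ^ 2 + C β * X + C γ = C u * X ^ 2 + C v * X + C w →
        α = u ∧ β = v ∧ γ = w := by
      intro u v w h
      refine ⟨?_, ?_, ?_⟩
      · simpa [coeff_X, coeff_C] using congrArg (fun p => coeff p 2) h
      · simpa [coeff_X, coeff_C] using congrArg (fun p => coeff p 1) h
      · simpa [coeff_X, coeff_C] using congrArg (fun p => coeff p 0) h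
    obtain ⟨h2, h1, h0⟩ := hcoeff hfg
    refine hdisc (a * d - b * c) ?_
    rw [h2, h1, h0]
    ring

namespace MvPolynomial

/-- The zeros of a square are multiple, so one simple zero suffices to exclude squares. -/
theorem sq_ne_of_aeval_pderiv_ne_zero {k σ : Type*} [Field k] {p : MvPolynomial σ k} {x : σ → k}
    (i : σ) (hp : aeval x p = 0) (hp' : aeval x (pderiv i p) ≠ 0) (s : MvPolynomial σ k) :
    s ^ 2 ≠ p := by
  rintro rfl
  apply hp'
  have : aeval x s = 0 := by simpa using hp
  rw [Derivation.leibniz_pow]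
  simp only [Nat.add_one_sub_one, pow_one, nsmul_eq_mul, smul_eq_mul, map_mul, this, zero_mul,
    mul_zero]

/-- The quadratic polynomial `α X² + β X + γ` in the first variable. -/
noncomputable def quadratic {k : Type*} [CommRing k] {n : ℕ} (α β γ : MvPolynomial (Fin n) k) :
    MvPolynomial (Fin (n + 1)) k :=
  rename Fin.succ α * X 0 ^ 2 + rename Fin.succ β * X 0 + rename Fin.succ γ

theorem aeval_quadratic {k B : Type*} [CommRing k] [CommRing B] [Algebra k B] {n : ℕ}
    (α β γ : MvPolynomial (Fin n) k) (x : Fin (n + 1) → B) :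
    aeval x (quadratic α β γ) = aeval (fun i => x (Fin.succ i)) α * x 0 ^ 2 +
      aeval (fun i => x (Fin.succ i)) β * x 0 + aeval (fun i => x (Fin.succ i)) γ := by
  simp [quadratic, aeval_rename, Function.comp_def]

theorem finSuccEquiv_rename_succ {k : Type*} [CommRing k] {n : ℕ} (p : MvPolynomial (Fin n) k) :
    finSuccEquiv k n (rename Fin.succ p) = Polynomial.C p := by
  rw [finSuccEquiv_apply]
  induction p using MvPolynomial.induction_on with
  | C a => simp
  | add p q hp hq => simp only [map_add, hp, hq]
  | mul_X p i hp => simp only [map_mul, hp, rename_X, eval₂Hom_X', Fin.cases_succ]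

theorem prime_quadratic {k : Type*} [Field k] {n : ℕ} {α β γ : MvPolynomial (Fin n) k}
    (hα : α ≠ 0) (hgcd : ∀ d, d ∣ α → d ∣ β → d ∣ γ → IsUnit d)
    (hdisc : ∀ s, s ^ 2 ≠ β ^ 2 - 4 * α * γ) : Prime (quadratic α β γ) := by
  refine Irreducible.prime ?_
  rw [← MulEquiv.irreducible_iff (finSuccEquiv k n).toMulEquiv]
  convert Polynomial.irreducible_quadratic hα hgcd hdisc using 1
  simp [quadratic, finSuccEquiv_rename_succ, finSuccEquiv_X_zero]

theorem degreeOf_eq_zero_of_dvd {k σ : Type*} [Field k] {i : σ} {p q : MvPolynomial σ k}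
    (h : p ∣ q) (hq : q ≠ 0) (hi : degreeOf i q = 0) : degreeOf i p = 0 := by
  obtain ⟨r, rfl⟩ := h
  rw [degreeOf_mul_eq (left_ne_zero_of_mul hq) (right_ne_zero_of_mul hq)] at hi
  omega

theorem isUnit_of_degreeOf_eq_zero {k σ : Type*} [Field k] {p : MvPolynomial σ k} (hp : p ≠ 0)
    (h : ∀ i, degreeOf i p = 0) : IsUnit p := by
  have hvars : p.vars = ∅ := by
    classical
    ext i
    simp only [Finset.notMem_empty, iff_false]
    rw [vars_def, Multiset.mem_toFinset]
    intro hi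
    have := Multiset.count_pos.mpr hi
    rw [← degreeOf_def, h i] at this
    omega
  rw [vars_eq_empty_iff_eq_C.mp hvars] at hp ⊢
  exact (IsUnit.mk0 _ fun h => hp (by rw [h, C_0])).map C

/-- A common divisor of a polynomial in the first variable and one in the second variable. -/
theorem isUnit_of_dvd_aeval_X {k : Type*} [Field k] {p q : Polynomial k} (hp : p ≠ 0) (hq : q ≠ 0)
    {d : MvPolynomial (Fin 2) k} (h0 : d ∣ Polynomial.aeval (X 0) p)
    (h1 : d ∣ Polynomial.aeval (X 1) q) : IsUnit d := by
  have hne : ∀ (i : Fin 2) (p : Polynomial k), p ≠ 0 →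
      Polynomial.aeval (X i : MvPolynomial (Fin 2) k) p ≠ 0 := by
    intro i p hp h
    apply hp
    have := congrArg (aeval (fun _ => Polynomial.X : Fin 2 → Polynomial k)) h
    rwa [← Polynomial.aeval_algHom_apply, aeval_X, map_zero, Polynomial.aeval_X_left_apply] at this
  have hdeg : ∀ (i j : Fin 2) (p : Polynomial k), i ≠ j →
      degreeOf j (Polynomial.aeval (X i : MvPolynomial (Fin 2) k) p) = 0 := by
    intro i j p hij
    rw [Polynomial.aeval_eq_sum_range]
    refine Nat.le_zero.mp ((degreeOf_sum_le _ _ _).trans ?_)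
    refine Finset.sup_le fun l _ => ?_
    rw [smul_eq_C_mul]
    refine (degreeOf_C_mul_le _ _ _).trans ?_
    refine (degreeOf_pow_le _ _ _).trans ?_
    simp [degreeOf_X_of_ne hij.symm]
  -- Degrees are additive in products, so a divisor of a polynomial in one variable does not involve
  -- the other variable.
  refine isUnit_of_degreeOf_eq_zero (fun h => hne 0 p hp (by simpa [h] using h0)) fun i => ?_
  fin_cases i
  · exact degreeOf_eq_zero_of_dvd h1 (hne _ _ hq) (hdeg _ _ _ (by decide))
  · exact degreeOf_eq_zero_of_dvd h0 (hne _ _ hp) (hdeg _ _ _ (by decide))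

end MvPolynomial

end Irreducibility

/-! ### From the triangulation to polynomial equations in eight variables -/

section Combinatorics

namespace IdealTriangulation

/-- The vertex `l` such that `(i, j, l, m)` is an even permutation of the vertices for some `m`. -/
def thirdVertex (i j : Fin 4) : Fin 4 :=
  ![![0, 2, 3, 1], ![3, 1, 0, 2], ![1, 3, 2, 0], ![2, 0, 1, 3]] i j

/-- The next oriented edge in the cycle of edges that are identified with a given one. -/
def nextEdge {n : ℕ} (𝒯 : IdealTriangulation n) (e : OrientedEdge n) : OrientedEdge n :=
  ⟨((𝒯.glue e.1.1 (thirdVertex e.1.2.1 e.1.2.2)).1,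
    (𝒯.glue e.1.1 (thirdVertex e.1.2.1 e.1.2.2)).2 e.1.2.1,
    (𝒯.glue e.1.1 (thirdVertex e.1.2.1 e.1.2.2)).2 e.1.2.2),
    fun h => e.2 ((𝒯.glue e.1.1 (thirdVertex e.1.2.1 e.1.2.2)).2.injective h)⟩

theorem gluedEdges_nextEdge {n : ℕ} (𝒯 : IdealTriangulation n) (e : OrientedEdge n) :
    𝒯.GluedEdges e (𝒯.nextEdge e) := by
  have key : ∀ i j : Fin 4, i ≠ j → thirdVertex i j ≠ i ∧ thirdVertex i j ≠ j := by decide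
  obtain ⟨h1, h2⟩ := key _ _ e.2
  exact ⟨_, h1, h2, rfl⟩

theorem sameEdge_iterate_nextEdge {n : ℕ} (𝒯 : IdealTriangulation n) (e : OrientedEdge n)
    (k : ℕ) : 𝒯.SameEdge e (𝒯.nextEdge^[k] e) := by
  induction k with
  | zero => exact Relation.EqvGen.refl _
  | succ k ih =>
    rw [Function.iterate_succ_apply']
    exact Relation.EqvGen.trans _ _ _ ih (Relation.EqvGen.rel _ _ (𝒯.gluedEdges_nextEdge _))

end IdealTriangulation

open IdealTriangulation

/-- The four oriented edges of the triangulation of the figure eight knot complement. -/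
def figureEightEdge (e : OrientedEdge 2) : Fin 4 :=
  ![![![0, 3, 0, 0], ![2, 0, 0, 2], ![1, 1, 0, 2], ![1, 3, 3, 0]],
    ![![0, 1, 1, 3], ![0, 0, 2, 0], ![0, 3, 0, 3], ![2, 1, 2, 0]]] e.1.1 e.1.2.1 e.1.2.2

theorem figureEightEdge_eq_of_glued : ∀ e e' : OrientedEdge 2, figureEight.GluedEdges e e' →
    figureEightEdge e = figureEightEdge e' := by
  rintro e e' ⟨l, h1, h2, h3⟩
  have key : ∀ (e : OrientedEdge 2) (l : Fin 4) (hl1 : l ≠ e.1.2.1) (hl2 : l ≠ e.1.2.2),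
      figureEightEdge e = figureEightEdge ⟨((figureEight.glue e.1.1 l).1,
        (figureEight.glue e.1.1 l).2 e.1.2.1, (figureEight.glue e.1.1 l).2 e.1.2.2),
        fun h => e.2 ((figureEight.glue e.1.1 l).2.injective h)⟩ := by decide +kernel
  rw [key e l h1 h2]
  congr 1
  exact Subtype.ext h3.symm

/-- The generated equivalence relation is made computable: `figureEightEdge` is invariant under
every gluing, and conversely turning around an edge with `nextEdge` reaches its whole class, which
has six members. -/
theorem figureEight_sameEdge_iff (e e' : OrientedEdge 2) :
    figureEight.SameEdge e e' ↔ figureEightEdge e = figureEightEdge e' := by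
  constructor
  · intro h
    induction h with
    | rel x y h => exact figureEightEdge_eq_of_glued x y h
    | refl x => rfl
    | symm x y _ h => exact h.symm
    | trans x y z _ _ h1 h2 => exact h1.trans h2
  · intro h
    have key : ∀ e e' : OrientedEdge 2, figureEightEdge e = figureEightEdge e' →
        ∃ k : Fin 6, figureEight.nextEdge^[k] e = e' := by decide +kernel
    obtain ⟨k, rfl⟩ := key e e' h
    exact sameEdge_iterate_nextEdge _ _ _

theorem faceCoord_eq {n : ℕ} (z : OrientedEdge n → ℂ) (T : Fin n) :
    faceCoord z T 0 = -(z (orientedEdge T 1 0 (by decide)) * z (orientedEdge T 2 0 (by decide)) *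
      z (orientedEdge T 3 0 (by decide))) ∧
    faceCoord z T 1 = -(z (orientedEdge T 0 1 (by decide)) * z (orientedEdge T 2 1 (by decide)) *
      z (orientedEdge T 3 1 (by decide))) ∧
    faceCoord z T 2 = -(z (orientedEdge T 0 2 (by decide)) * z (orientedEdge T 1 2 (by decide)) *
      z (orientedEdge T 3 2 (by decide))) ∧
    faceCoord z T 3 = -(z (orientedEdge T 0 3 (by decide)) * z (orientedEdge T 1 3 (by decide)) *
      z (orientedEdge T 2 3 (by decide))) := by
  have h0 : (Finset.univ : Finset {i : Fin 4 // i ≠ 0}) =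
    {⟨1, by decide⟩, ⟨2, by decide⟩, ⟨3, by decide⟩} := by decide
  have h1 : (Finset.univ : Finset {i : Fin 4 // i ≠ 1}) =
    {⟨0, by decide⟩, ⟨2, by decide⟩, ⟨3, by decide⟩} := by decide
  have h2 : (Finset.univ : Finset {i : Fin 4 // i ≠ 2}) =
    {⟨0, by decide⟩, ⟨1, by decide⟩, ⟨3, by decide⟩} := by decide
  have h3 : (Finset.univ : Finset {i : Fin 4 // i ≠ 3}) =
    {⟨0, by decide⟩, ⟨1, by decide⟩, ⟨2, by decide⟩} := by decide
  refine ⟨?_, ?_, ?_, ?_⟩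
  · rw [faceCoord, h0]; simp [mul_assoc]
  · rw [faceCoord, h1]; simp [mul_assoc]
  · rw [faceCoord, h2]; simp [mul_assoc]
  · rw [faceCoord, h3]; simp [mul_assoc]

theorem figureEight_faceRelations_iff (z : OrientedEdge 2 → ℂ) :
    figureEight.FaceRelations z ↔
      faceCoord z 0 0 * faceCoord z 1 0 = 1 ∧ faceCoord z 0 1 * faceCoord z 1 2 = 1 ∧
      faceCoord z 0 2 * faceCoord z 1 1 = 1 ∧ faceCoord z 0 3 * faceCoord z 1 3 = 1 := by
  have key : (figureEight.glue 0 0).1 = 1 ∧ (figureEight.glue 0 0).2 0 = 0 ∧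
    (figureEight.glue 0 1).1 = 1 ∧ (figureEight.glue 0 1).2 1 = 2 ∧
    (figureEight.glue 0 2).1 = 1 ∧ (figureEight.glue 0 2).2 2 = 1 ∧
    (figureEight.glue 0 3).1 = 1 ∧ (figureEight.glue 0 3).2 3 = 3 ∧
    (figureEight.glue 1 0).1 = 0 ∧ (figureEight.glue 1 0).2 0 = 0 ∧
    (figureEight.glue 1 1).1 = 0 ∧ (figureEight.glue 1 1).2 1 = 2 ∧
    (figureEight.glue 1 2).1 = 0 ∧ (figureEight.glue 1 2).2 2 = 1 ∧
    (figureEight.glue 1 3).1 = 0 ∧ (figureEight.glue 1 3).2 3 = 3 := by decide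
  obtain ⟨a1, a2, a3, a4, a5, a6, a7, a8, b1, b2, b3, b4, b5, b6, b7, b8⟩ := key
  simp only [IdealTriangulation.FaceRelations, Fin.forall_fin_succ,
    Fin.succ_zero_eq_one, Fin.succ_one_eq_two, IsEmpty.forall_iff, and_true]
  have e3 : Fin.succ (2 : Fin 3) = 3 := rfl
  simp only [e3, a1, a2, a3, a4, a5, a6, a7, a8, b1, b2, b3, b4, b5, b6, b7, b8]
  constructor
  · rintro ⟨⟨h0, h1, h2, h3⟩, -⟩
    exact ⟨h0, h1, h2, h3⟩
  · rintro ⟨h0, h1, h2, h3⟩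
    refine ⟨⟨h0, h1, h2, h3⟩, ?_, ?_, ?_, ?_⟩
    all_goals rw [mul_comm]; assumption

theorem figureEight_edgeRelations_iff (z : OrientedEdge 2 → ℂ) :
    figureEight.EdgeRelations z ↔
      (z (orientedEdge 0 0 2 (by decide)) * z (orientedEdge 0 0 3 (by decide)) *
        z (orientedEdge 0 1 2 (by decide)) * z (orientedEdge 1 1 0 (by decide)) *
        z (orientedEdge 1 1 3 (by decide)) * z (orientedEdge 1 2 0 (by decide)) = 1 ∧
      z (orientedEdge 0 2 0 (by decide)) * z (orientedEdge 0 3 0 (by decide)) *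
        z (orientedEdge 0 2 1 (by decide)) * z (orientedEdge 1 0 1 (by decide)) *
        z (orientedEdge 1 3 1 (by decide)) * z (orientedEdge 1 0 2 (by decide)) = 1 ∧
      z (orientedEdge 0 1 0 (by decide)) * z (orientedEdge 0 1 3 (by decide)) *
        z (orientedEdge 0 2 3 (by decide)) * z (orientedEdge 1 1 2 (by decide)) *
        z (orientedEdge 1 3 0 (by decide)) * z (orientedEdge 1 3 2 (by decide)) = 1 ∧
      z (orientedEdge 0 0 1 (by decide)) * z (orientedEdge 0 3 1 (by decide)) *
        z (orientedEdge 0 3 2 (by decide)) * z (orientedEdge 1 2 1 (by decide)) *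
        z (orientedEdge 1 0 3 (by decide)) * z (orientedEdge 1 2 3 (by decide)) = 1) := by
  have h : figureEight.EdgeRelations z ↔
      ∀ k : Fin 4, ∏ e' : OrientedEdge 2 with k = figureEightEdge e', z e' = 1 := by
    classical
    have hs : ∀ k, ∃ e, figureEightEdge e = k := by decide +kernel
    constructor
    · intro h k
      obtain ⟨e, rfl⟩ := hs k
      rw [← h e]
      exact Finset.prod_congr (Finset.filter_congr fun e' _ =>
        (figureEight_sameEdge_iff e e').symm) fun _ _ => rfl
    · intro h e
      rw [← h (figureEightEdge e)]
      exact Finset.prod_congr (Finset.filter_congr fun e' _ =>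
        (figureEight_sameEdge_iff e e')) fun _ _ => rfl
  have h0 : (Finset.univ.filter fun e' : OrientedEdge 2 => (0 : Fin 4) = figureEightEdge e') =
    {orientedEdge 0 0 2 (by decide), orientedEdge 0 0 3 (by decide), orientedEdge 0 1 2 (by decide),
      orientedEdge 1 1 0 (by decide), orientedEdge 1 1 3 (by decide),
      orientedEdge 1 2 0 (by decide)} := by decide +kernel
  have h1 : (Finset.univ.filter fun e' : OrientedEdge 2 => (1 : Fin 4) = figureEightEdge e') =
    {orientedEdge 0 2 0 (by decide), orientedEdge 0 3 0 (by decide), orientedEdge 0 2 1 (by decide),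
      orientedEdge 1 0 1 (by decide), orientedEdge 1 3 1 (by decide),
      orientedEdge 1 0 2 (by decide)} := by decide +kernel
  have h2 : (Finset.univ.filter fun e' : OrientedEdge 2 => (2 : Fin 4) = figureEightEdge e') =
    {orientedEdge 0 1 0 (by decide), orientedEdge 0 1 3 (by decide), orientedEdge 0 2 3 (by decide),
      orientedEdge 1 1 2 (by decide), orientedEdge 1 3 0 (by decide),
      orientedEdge 1 3 2 (by decide)} := by decide +kernel
  have h3 : (Finset.univ.filter fun e' : OrientedEdge 2 => (3 : Fin 4) = figureEightEdge e') =
    {orientedEdge 0 0 1 (by decide), orientedEdge 0 3 1 (by decide), orientedEdge 0 3 2 (by decide),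
      orientedEdge 1 2 1 (by decide), orientedEdge 1 0 3 (by decide),
      orientedEdge 1 2 3 (by decide)} := by decide +kernel
  have e3 : Fin.succ (2 : Fin 3) = 3 := rfl
  rw [h]
  simp only [Fin.forall_fin_succ, Fin.succ_zero_eq_one, Fin.succ_one_eq_two, IsEmpty.forall_iff,
    and_true, e3, h0, h1, h2, h3]
  simp [orientedEdge, mul_assoc]

/-- The function on oriented edges with the values `x T i`, `y T i`, `w T i` on the edges of `T`
from `i` to `j`, where `j = i ^^^ 1`, `j = i ^^^ 2`, `j = i ^^^ 3`. -/
def shapeCoord {A : Type*} (x y w : Fin 2 → Fin 4 → A) (e : OrientedEdge 2) : A :=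
  if e.1.2.2 = ![1, 0, 3, 2] e.1.2.1 then x e.1.1 e.1.2.1
  else if e.1.2.2 = ![2, 3, 0, 1] e.1.2.1 then y e.1.1 e.1.2.1
  else w e.1.1 e.1.2.1

theorem orientedEdge_eq (e : OrientedEdge 2) :
    (∃ h, e = orientedEdge e.1.1 e.1.2.1 (![1, 0, 3, 2] e.1.2.1) h) ∨
    (∃ h, e = orientedEdge e.1.1 e.1.2.1 (![2, 3, 0, 1] e.1.2.1) h) ∨
    (∃ h, e = orientedEdge e.1.1 e.1.2.1 (![3, 2, 1, 0] e.1.2.1) h) := by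
  revert e
  decide +kernel

section

variable {A : Type*} (x y w : Fin 2 → Fin 4 → A) (T : Fin 2) (i : Fin 4)

theorem shapeCoord_one (h) : shapeCoord x y w (orientedEdge T i (![1, 0, 3, 2] i) h) = x T i := by
  simp [shapeCoord, orientedEdge]

theorem shapeCoord_two (h) : shapeCoord x y w (orientedEdge T i (![2, 3, 0, 1] i) h) = y T i := by
  have key : ∀ i : Fin 4, (![2, 3, 0, 1] i : Fin 4) ≠ ![1, 0, 3, 2] i := by decide
  simp only [shapeCoord, orientedEdge, if_neg (key i), if_true]

theorem shapeCoord_three (h) : shapeCoord x y w (orientedEdge T i (![3, 2, 1, 0] i) h) = w T i := by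
  have key : ∀ i : Fin 4, (![3, 2, 1, 0] i : Fin 4) ≠ ![1, 0, 3, 2] i ∧
      (![3, 2, 1, 0] i : Fin 4) ≠ ![2, 3, 0, 1] i := by decide
  rw [shapeCoord, orientedEdge]
  exact (if_neg (key i).1).trans (if_neg (key i).2)

end

/-- The even permutations that start with `i` list the other vertices in one fixed cyclic order. As
x ↦ 1/(1-x) has order three, the relations for one starting point of the cycle imply those for the
others, and one parameter per vertex remains. -/
theorem internalRelations_iff (z : OrientedEdge 2 → ℂ) :
    InternalRelations z ↔ ∃ x : Fin 2 → Fin 4 → ℂ, (∀ T i, x T i ≠ 0 ∧ x T i ≠ 1) ∧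
      z = shapeCoord x (fun T i => 1 / (1 - x T i)) (fun T i => 1 - 1 / x T i) := by
  have even : ∀ i : Fin 4, ∃ σ : Equiv.Perm (Fin 4), Equiv.Perm.sign σ = 1 ∧ σ 0 = i ∧
      σ 1 = ![1, 0, 3, 2] i ∧ σ 2 = ![2, 3, 0, 1] i ∧ σ 3 = ![3, 2, 1, 0] i := by
    intro i
    fin_cases i
    · exact ⟨1, by decide⟩
    · exact ⟨Equiv.swap 0 1 * Equiv.swap 2 3, by decide⟩
    · exact ⟨Equiv.swap 0 2 * Equiv.swap 1 3, by decide⟩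
    · exact ⟨Equiv.swap 0 3 * Equiv.swap 1 2, by decide⟩
  have key : ∀ i : Fin 4, i ≠ ![1, 0, 3, 2] i ∧ i ≠ ![2, 3, 0, 1] i ∧ i ≠ ![3, 2, 1, 0] i := by
    decide
  have classify : ∀ i j k l : Fin 4, (∃ σ : Equiv.Perm (Fin 4), Equiv.Perm.sign σ = 1 ∧
      σ 0 = i ∧ σ 1 = j ∧ σ 2 = k ∧ σ 3 = l) →
      (j = ![1, 0, 3, 2] i ∧ k = ![2, 3, 0, 1] i ∧ l = ![3, 2, 1, 0] i) ∨
      (k = ![1, 0, 3, 2] i ∧ l = ![2, 3, 0, 1] i ∧ j = ![3, 2, 1, 0] i) ∨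
      (l = ![1, 0, 3, 2] i ∧ j = ![2, 3, 0, 1] i ∧ k = ![3, 2, 1, 0] i) := by
    have : ∀ σ : Equiv.Perm (Fin 4), Equiv.Perm.sign σ = 1 →
      (σ 1 = ![1, 0, 3, 2] (σ 0) ∧ σ 2 = ![2, 3, 0, 1] (σ 0) ∧ σ 3 = ![3, 2, 1, 0] (σ 0)) ∨
      (σ 2 = ![1, 0, 3, 2] (σ 0) ∧ σ 3 = ![2, 3, 0, 1] (σ 0) ∧ σ 1 = ![3, 2, 1, 0] (σ 0)) ∨
      (σ 3 = ![1, 0, 3, 2] (σ 0) ∧ σ 1 = ![2, 3, 0, 1] (σ 0) ∧ σ 2 = ![3, 2, 1, 0] (σ 0)) := by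
      decide +kernel
    rintro i j k l ⟨σ, h, rfl, rfl, rfl, rfl⟩
    exact this σ h
  constructor
  · intro hz
    refine ⟨fun T i => z (orientedEdge T i (![1, 0, 3, 2] i) (key i).1), ?_, ?_⟩
    · intro T i
      have h := hz T i _ _ _ (key i).1 (key i).2.1 (key i).2.2 (even i)
      constructor
      · intro h0
        simp only at h0
        rw [h0] at h
        simp at h
      · intro h1
        simp only at h1
        rw [h1] at h
        simp at h
    · funext e
      have h := hz e.1.1 e.1.2.1 _ _ _ (key _).1 (key _).2.1 (key _).2.2 (even _)
      set x := z (orientedEdge e.1.1 e.1.2.1 (![1, 0, 3, 2] e.1.2.1) (key _).1) with hx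
      have hx0 : x ≠ 0 := fun h0 => by simp [h0] at h
      have hx1 : 1 - x ≠ 0 := fun h0 => by simp [h0] at h
      have h2 := eq_one_div_of_mul_eq_one_left h.2
      rcases orientedEdge_eq e with ⟨h', he⟩ | ⟨h', he⟩ | ⟨h', he⟩
      · conv_rhs => rw [he]
        rw [shapeCoord_one, ← he]
      · conv_rhs => rw [he]
        rw [shapeCoord_two]
        exact (congrArg z he).trans h2
      · conv_rhs => rw [he]
        rw [shapeCoord_three]
        have h1 := h.1
        rw [h2] at h1
        refine (congrArg z he).trans ?_
        change _ = 1 - 1 / x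
        field_simp at h1 ⊢
        linear_combination h1
  · rintro ⟨x, hx, rfl⟩ T i j k l hij hik hil hσ
    obtain ⟨h0, h1⟩ := hx T i
    have h1' : 1 - x T i ≠ 0 := sub_ne_zero.mpr h1.symm
    rcases classify i j k l hσ with ⟨rfl, rfl, rfl⟩ | ⟨rfl, rfl, rfl⟩ | ⟨rfl, rfl, rfl⟩
    all_goals
      rw [shapeCoord_one, shapeCoord_two, shapeCoord_three]
      constructor <;> field_simp <;> ring

/-- The equations of the deformation variety of the figure eight knot complement in terms of the
coordinates of the oriented edges `01`, `10`, `23`, `32` of the two tetrahedra. -/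
structure FigureEightEquations (a b c d e f g h : ℂ) : Prop where
  a0 : a ≠ 0
  a1 : 1 - a ≠ 0
  b0 : b ≠ 0
  b1 : 1 - b ≠ 0
  c0 : c ≠ 0
  c1 : 1 - c ≠ 0
  d0 : d ≠ 0
  d1 : 1 - d ≠ 0
  e0 : e ≠ 0
  e1 : 1 - e ≠ 0
  f0 : f ≠ 0
  f1 : 1 - f ≠ 0
  g0 : g ≠ 0
  g1 : 1 - g ≠ 0
  h0 : h ≠ 0
  h1 : 1 - h ≠ 0
  edge₁ : (1 - b) * f = a * b * (1 - f) * (1 - g)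
  edge₂ : (1 - d) * e = c * d * (1 - e) * (1 - h)
  edge₃ : a * (1 - g) = c * (1 - h)
  face₁ : b * f * (1 - d) * (1 - h) = d * h * (1 - c) * (1 - g)
  face₂ : a * h * (1 - c) * (1 - f) = c * f * (1 - d) * (1 - e)
  face₃ : d * e * (1 - b) * (1 - g) = b * g * (1 - a) * (1 - h)
  face₄ : c * g * (1 - a) * (1 - e) = a * e * (1 - b) * (1 - f)

/-- The point with the given coordinates on the oriented edges `01`, `10`, `23`, `32` of the two
tetrahedra that satisfies the internal relations. -/
noncomputable def shapePoint (a b c d e f g h : ℂ) : OrientedEdge 2 → ℂ :=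
  shapeCoord ![![a, b, c, d], ![e, f, g, h]]
    ![![1 / (1 - a), 1 / (1 - b), 1 / (1 - c), 1 / (1 - d)],
      ![1 / (1 - e), 1 / (1 - f), 1 / (1 - g), 1 / (1 - h)]]
    ![![1 - 1 / a, 1 - 1 / b, 1 - 1 / c, 1 - 1 / d],
      ![1 - 1 / e, 1 - 1 / f, 1 - 1 / g, 1 - 1 / h]]

/-- The internal relations make the product of all 24 coordinates equal to 1, so three edge
relations imply the fourth. Comparing the third with the first yields the shorter `edge₃`. -/
theorem shapePoint_mem_iff {a b c d e f g h : ℂ} (a0 : a ≠ 0) (a1 : 1 - a ≠ 0) (b0 : b ≠ 0)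
    (b1 : 1 - b ≠ 0) (c0 : c ≠ 0) (c1 : 1 - c ≠ 0) (d0 : d ≠ 0) (d1 : 1 - d ≠ 0) (e0 : e ≠ 0)
    (e1 : 1 - e ≠ 0) (f0 : f ≠ 0) (f1 : 1 - f ≠ 0) (g0 : g ≠ 0) (g1 : 1 - g ≠ 0) (h0 : h ≠ 0)
    (h1 : 1 - h ≠ 0) :
    (figureEight.FaceRelations (shapePoint a b c d e f g h) ∧
      figureEight.EdgeRelations (shapePoint a b c d e f g h)) ↔
      FigureEightEquations a b c d e f g h := by
  rw [figureEight_faceRelations_iff, figureEight_edgeRelations_iff]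
  simp only [faceCoord_eq]
  simp only [shapePoint, shapeCoord, orientedEdge, Fin.isValue, Matrix.cons_val,
    Fin.reduceEq, if_true, if_false]
  constructor
  · rintro ⟨⟨F1, F2, F3, F4⟩, ⟨E1, E2, E3, E4⟩⟩
    field_simp at F1 F2 F3 F4 E1 E2 E3 E4
    have E1' : (1 - b) * f = a * b * (1 - f) * (1 - g) :=
      mul_left_cancel₀ a1 (by linear_combination E1)
    refine ⟨a0, a1, b0, b1, c0, c1, d0, d1, e0, e1, f0, f1, g0, g1, h0, h1, E1',
      mul_left_cancel₀ c1 (by linear_combination E2),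
      mul_left_cancel₀ (mul_ne_zero b0 f1) (by linear_combination -E3 - E1'),
      by linear_combination F1, by linear_combination F2, by linear_combination F3,
      by linear_combination F4⟩
  · rintro ⟨-, -, -, -, -, -, -, -, -, -, -, -, -, -, -, -, E1, E2, E3, F1, F2, F3, F4⟩
    refine ⟨⟨?_, ?_, ?_, ?_⟩, ⟨?_, ?_, ?_, ?_⟩⟩
    · field_simp
      linear_combination F1
    · field_simp
      linear_combination F2
    · field_simp
      linear_combination F3
    · field_simp
      linear_combination F4
    · field_simp
      linear_combination (1 - a) * E1
    · field_simp
      linear_combination (1 - c) * E2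
    · field_simp
      linear_combination -b * (1 - f) * E3 - E1
    · field_simp
      linear_combination d * (1 - e) * E3 - E2

theorem shapePoint_eq (a b c d e f g h : ℂ) : shapePoint a b c d e f g h =
    shapeCoord ![![a, b, c, d], ![e, f, g, h]]
      (fun T i => 1 / (1 - (![![a, b, c, d], ![e, f, g, h]] : Fin 2 → Fin 4 → ℂ) T i))
      (fun T i => 1 - 1 / (![![a, b, c, d], ![e, f, g, h]] : Fin 2 → Fin 4 → ℂ) T i) := by
  rw [shapePoint]
  congr 1
  · funext T i
    fin_cases T <;> fin_cases i <;> rfl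
  · funext T i
    fin_cases T <;> fin_cases i <;> rfl

theorem mem_deformationVariety_iff (z : OrientedEdge 2 → ℂ) :
    z ∈ figureEight.deformationVariety ↔ ∃ a b c d e f g h : ℂ,
      FigureEightEquations a b c d e f g h ∧ z = shapePoint a b c d e f g h := by
  have ne : ∀ {t : ℂ}, t ≠ 1 → 1 - t ≠ 0 := fun h => sub_ne_zero.mpr h.symm
  constructor
  · rintro ⟨hint, hrel⟩
    obtain ⟨x, hx, rfl⟩ := (internalRelations_iff z).mp hint
    have hx' : x = ![![x 0 0, x 0 1, x 0 2, x 0 3], ![x 1 0, x 1 1, x 1 2, x 1 3]] := by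
      funext T i
      fin_cases T <;> fin_cases i <;> rfl
    have hz : shapeCoord x (fun T i => 1 / (1 - x T i)) (fun T i => 1 - 1 / x T i) =
        shapePoint (x 0 0) (x 0 1) (x 0 2) (x 0 3) (x 1 0) (x 1 1) (x 1 2) (x 1 3) := by
      rw [shapePoint_eq, ← hx']
    rw [hz] at hrel ⊢
    exact ⟨_, _, _, _, _, _, _, _, (shapePoint_mem_iff (hx 0 0).1 (ne (hx 0 0).2) (hx 0 1).1
      (ne (hx 0 1).2) (hx 0 2).1 (ne (hx 0 2).2) (hx 0 3).1 (ne (hx 0 3).2) (hx 1 0).1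
      (ne (hx 1 0).2) (hx 1 1).1 (ne (hx 1 1).2) (hx 1 2).1 (ne (hx 1 2).2) (hx 1 3).1
      (ne (hx 1 3).2)).mp hrel, rfl⟩
  · rintro ⟨a, b, c, d, e, f, g, h, H, rfl⟩
    refine ⟨?_, (shapePoint_mem_iff H.a0 H.a1 H.b0 H.b1 H.c0 H.c1 H.d0 H.d1 H.e0 H.e1 H.f0 H.f1
      H.g0 H.g1 H.h0 H.h1).mpr H⟩
    rw [internalRelations_iff, shapePoint_eq]
    refine ⟨_, fun T i => ?_, rfl⟩
    have ne' : ∀ {t : ℂ}, 1 - t ≠ 0 → t ≠ 1 := fun h => (sub_ne_zero.mp h).symm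
    fin_cases T <;> fin_cases i
    exacts [⟨H.a0, ne' H.a1⟩, ⟨H.b0, ne' H.b1⟩, ⟨H.c0, ne' H.c1⟩, ⟨H.d0, ne' H.d1⟩,
      ⟨H.e0, ne' H.e1⟩, ⟨H.f0, ne' H.f1⟩, ⟨H.g0, ne' H.g1⟩, ⟨H.h0, ne' H.h1⟩]

theorem shapePoint_injective {a b c d e f g h a' b' c' d' e' f' g' h' : ℂ}
    (H : shapePoint a b c d e f g h = shapePoint a' b' c' d' e' f' g' h') :
    a = a' ∧ b = b' ∧ c = c' ∧ d = d' ∧ e = e' ∧ f = f' ∧ g = g' ∧ h = h' := by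
  have h1 := congrFun H (orientedEdge 0 0 1 (by decide))
  have h2 := congrFun H (orientedEdge 0 1 0 (by decide))
  have h3 := congrFun H (orientedEdge 0 2 3 (by decide))
  have h4 := congrFun H (orientedEdge 0 3 2 (by decide))
  have h5 := congrFun H (orientedEdge 1 0 1 (by decide))
  have h6 := congrFun H (orientedEdge 1 1 0 (by decide))
  have h7 := congrFun H (orientedEdge 1 2 3 (by decide))
  have h8 := congrFun H (orientedEdge 1 3 2 (by decide))
  simp only [shapePoint, shapeCoord, orientedEdge, Fin.isValue, Matrix.cons_val,
    if_true] at h1 h2 h3 h4 h5 h6 h7 h8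
  exact ⟨h1, h2, h3, h4, h5, h6, h7, h8⟩

end Combinatorics

/-! ### Splitting the equations into three families -/

section Decomposition

/-- The equations of the deformation variety in terms of `a = z₀₁`, `s = z₂₃ / z₀₁`,
`B = z₁₀⁻¹ - 1`, `r B = z₃₂⁻¹ - 1` in the first tetrahedron and of `E = e / (1 - e)` for the
coordinate `e = z₀₁` of the second tetrahedron. -/
structure ReducedEquations (a s r B E : ℂ) : Prop where
  a0 : a ≠ 0
  a1 : 1 - a ≠ 0
  s0 : s ≠ 0
  sa1 : 1 - s * a ≠ 0
  r0 : r ≠ 0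
  B0 : B ≠ 0
  B1 : 1 + B ≠ 0
  rB1 : 1 + r * B ≠ 0
  E0 : E ≠ 0
  E1 : 1 + E ≠ 0
  rE1 : 1 + r * E ≠ 0
  at0 : a - r * B * E ≠ 0
  sat0 : s * a - r * B * E ≠ 0
  eq₁ : (1 + r * B) * (1 + E) = s ^ 2 * ((1 + B) * (1 + r * E))
  eq₂ : (s * a - r * B * E) * (1 - s * a) = r ^ 2 * s * (a - r * B * E) * (1 - a)
  eq₃ : (a - r * B * E) * (1 - a) * s * ((1 + B) * (1 + r * E)) = a * (B * E)

/-- The additional equations of one of the two components that are exchanged by the involution. -/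
structure ReducedBranch (a s r B E : ℂ) : Prop where
  eq₁ : (1 + E) * (a - r * B * E) * (s * a - r * B * E) = s * (1 + B)
  eq₂ : B * (1 + B) = (a - r * B * E) * (1 + B - a)

/-- Up to a monomial, the norm of the equation of one branch to the field of rational functions in
`a`, `s`, `r`. -/
def branchNorm (a s r : ℂ) : ℂ :=
    a ^ 4 * s ^ 4 * r ^ 3 - a ^ 4 * s ^ 4 * r ^ 2 - 2 * a ^ 4 * s ^ 3 * r ^ 3 + 2 * a ^ 4 * s ^ 3
    * r ^ 2 + a ^ 4 * s ^ 2 * r ^ 3 - a ^ 4 * s ^ 2 * r ^ 2 - 2 * a ^ 3 * s ^ 4 * r ^ 3 + a ^ 3 *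
    s ^ 4 * r ^ 2 + a ^ 3 * s ^ 4 * r + a ^ 3 * s ^ 3 * r ^ 4 + a ^ 3 * s ^ 3 * r ^ 3 - 2 * a ^ 3
    * s ^ 3 * r ^ 2 + 2 * a ^ 3 * s ^ 2 * r ^ 3 - a ^ 3 * s ^ 2 * r ^ 2 - a ^ 3 * s ^ 2 * r - a ^
    3 * s * r ^ 4 - a ^ 3 * s * r ^ 3 + 2 * a ^ 3 * s * r ^ 2 + a ^ 2 * s ^ 4 * r ^ 3 - 2 * a ^ 2
    * s ^ 3 * r ^ 4 + 2 * a ^ 2 * s ^ 3 * r ^ 3 - 2 * a ^ 2 * s ^ 3 * r + a ^ 2 * s ^ 2 * r ^ 5 -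
    a ^ 2 * s ^ 2 * r ^ 4 - 5 * a ^ 2 * s ^ 2 * r ^ 3 + 5 * a ^ 2 * s ^ 2 * r ^ 2 + a ^ 2 * s ^ 2
    * r - a ^ 2 * s ^ 2 + 2 * a ^ 2 * s * r ^ 4 - 2 * a ^ 2 * s * r ^ 2 + 2 * a ^ 2 * s * r - a ^
    2 * r ^ 2 + a * s ^ 3 * r ^ 4 - a * s ^ 3 * r ^ 3 - 2 * a * s ^ 2 * r ^ 5 + 2 * a * s ^ 2 * r
    ^ 4 + 2 * a * s ^ 2 * r ^ 3 - 3 * a * s ^ 2 * r ^ 2 + a * s ^ 2 * r - a * s * r ^ 4 + 3 * a *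
    s * r ^ 3 - 2 * a * s * r ^ 2 - 2 * a * s * r + 2 * a * s + a * r ^ 2 - a * r + s ^ 2 * r ^ 5
    - s ^ 2 * r ^ 4 - 2 * s * r ^ 3 + 2 * s * r ^ 2 + r - 1

/-- The image of `branchNorm` under the involution, up to a monomial. -/
def branchNorm' (a s r : ℂ) : ℂ :=
    a ^ 4 * s ^ 4 * r - a ^ 4 * s ^ 4 - 2 * a ^ 4 * s ^ 3 * r ^ 3 + 2 * a ^ 4 * s ^ 3 * r ^ 2 + a
    ^ 4 * s ^ 2 * r ^ 5 - a ^ 4 * s ^ 2 * r ^ 4 + a ^ 3 * s ^ 4 * r ^ 2 - a ^ 3 * s ^ 4 * r - a ^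
    3 * s ^ 3 * r ^ 4 + 3 * a ^ 3 * s ^ 3 * r ^ 3 - 2 * a ^ 3 * s ^ 3 * r ^ 2 - 2 * a ^ 3 * s ^ 3
    * r + 2 * a ^ 3 * s ^ 3 - 2 * a ^ 3 * s ^ 2 * r ^ 5 + 2 * a ^ 3 * s ^ 2 * r ^ 4 + 2 * a ^ 3 *
    s ^ 2 * r ^ 3 - 3 * a ^ 3 * s ^ 2 * r ^ 2 + a ^ 3 * s ^ 2 * r + a ^ 3 * s * r ^ 4 - a ^ 3 * s
    * r ^ 3 - a ^ 2 * s ^ 4 * r ^ 2 + 2 * a ^ 2 * s ^ 3 * r ^ 4 - 2 * a ^ 2 * s ^ 3 * r ^ 2 + 2 *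
    a ^ 2 * s ^ 3 * r + a ^ 2 * s ^ 2 * r ^ 5 - a ^ 2 * s ^ 2 * r ^ 4 - 5 * a ^ 2 * s ^ 2 * r ^ 3
    + 5 * a ^ 2 * s ^ 2 * r ^ 2 + a ^ 2 * s ^ 2 * r - a ^ 2 * s ^ 2 - 2 * a ^ 2 * s * r ^ 4 + 2 *
    a ^ 2 * s * r ^ 3 - 2 * a ^ 2 * s * r + a ^ 2 * r ^ 3 - a * s ^ 3 * r ^ 4 - a * s ^ 3 * r ^ 3
    + 2 * a * s ^ 3 * r ^ 2 + 2 * a * s ^ 2 * r ^ 3 - a * s ^ 2 * r ^ 2 - a * s ^ 2 * r + a * s *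
    r ^ 4 + a * s * r ^ 3 - 2 * a * s * r ^ 2 - 2 * a * r ^ 3 + a * r ^ 2 + a * r + s ^ 2 * r ^ 3
    - s ^ 2 * r ^ 2 - 2 * s * r ^ 3 + 2 * s * r ^ 2 + r ^ 3 - r ^ 2

namespace ReducedEquations

variable {a s r B E : ℂ}

/-- The reduced equations are invariant under the involution. -/
theorem involution (H : ReducedEquations a s r B E) :
    ReducedEquations (r * B * E / (s * a)) s (1 / r) (r * E) (r * B) := by
  obtain ⟨a0, a1, s0, sa1, r0, B0, B1, rB1, E0, E1, rE1, at0, sat0, eq₁, eq₂, eq₃⟩ := H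
  have ht : 1 / r * (r * E) * (r * B) = r * B * E := by
    field_simp
  have hE : 1 / r * (r * E) = E := by field_simp
  have hB : 1 / r * (r * B) = B := by field_simp
  have hsa : s * (r * B * E / (s * a)) = r * B * E / a := by field_simp
  refine ⟨by simp [r0, B0, E0, s0, a0], ?_, s0, ?_, by simp [r0], by simp [r0, E0], rE1, ?_,
    by simp [r0, B0], rB1, ?_, ?_, ?_, ?_, ?_, ?_⟩
  · rw [one_sub_div (by simp [s0, a0])]
    exact div_ne_zero sat0 (by simp [s0, a0])
  · rw [hsa, one_sub_div a0]
    exact div_ne_zero at0 a0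
  · rwa [hE]
  · rwa [hB]
  · rw [ht]
    intro h
    field_simp at h
    exact sa1 (by simpa [r0, B0, E0] using h)
  · rw [ht, hsa]
    intro h
    field_simp at h
    exact a1 (by simpa [r0, B0, E0] using h)
  · rw [hE, hB]
    linear_combination eq₁
  · rw [ht, hsa]
    field_simp
    linear_combination -eq₂
  · rw [ht, hB]
    field_simp
    linear_combination (1 + r * E) * (1 + B) * eq₂ + r ^ 2 * eq₃

variable (H : ReducedEquations a s r B E)
include H

/-- The second equation is linear in t = rBE. Below, R and L denote the two bracketed polynomials,
so that tR = saL. -/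
theorem mul_t_eq : r * B * E * (1 - r ^ 2 * s + a * s * (r ^ 2 - 1)) =
    s * a * (1 - r ^ 2 + a * (r ^ 2 - s)) := by
  linear_combination -H.eq₂

/-- By tR = saL the two polynomials vanish together, but R - sL = (1-s)(1-sa) is not zero. -/
theorem L_ne_zero_and_R_ne_zero (hs : s ≠ 1) :
    1 - r ^ 2 + a * (r ^ 2 - s) ≠ 0 ∧ 1 - r ^ 2 * s + a * s * (r ^ 2 - 1) ≠ 0 := by
  have h := H.mul_t_eq
  have hRL : (1 - r ^ 2 * s + a * s * (r ^ 2 - 1)) - s * (1 - r ^ 2 + a * (r ^ 2 - s)) =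
    (1 - s) * (1 - s * a) := by ring
  have hne : (1 - s) * (1 - s * a) ≠ 0 := mul_ne_zero (sub_ne_zero.mpr hs.symm) H.sa1
  constructor
  · intro hL
    rw [hL, mul_zero] at h
    have hR : 1 - r ^ 2 * s + a * s * (r ^ 2 - 1) = 0 := by
      simpa [H.r0, H.B0, H.E0] using h
    rw [hL, hR] at hRL
    exact hne (by rw [← hRL]; ring)
  · intro hR
    rw [hR, mul_zero] at h
    have hL : 1 - r ^ 2 + a * (r ^ 2 - s) = 0 := by
      simpa [H.s0, H.a0] using h.symm
    rw [hL, hR] at hRL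
    exact hne (by rw [← hRL]; ring)

/-- The value of t gives a - t = a(1-s)(1-sa)/R; substituting both in the third equation determines
the product (1+B)(1+rE). -/
theorem P_eq : r * (1 - s) * (1 - s * a) * (1 - a) * ((1 + B) * (1 + r * E)) =
    a * (1 - r ^ 2 + a * (r ^ 2 - s)) := by
  refine mul_left_cancel₀ (mul_ne_zero H.a0 H.s0) ?_
  linear_combination (r * (1 - r ^ 2 * s + a * s * (r ^ 2 - 1))) * H.eq₃ +
    (a + r * (1 - a) * s * ((1 + B) * (1 + r * E))) * H.mul_t_eq

/-- The products (1+B)(1+rE) and (1+rB)(1+E) are 1 + t plus linear forms in B and E. The first is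
known and the second is s² times it; `E_eq` and `B_eq` are Cramer's rule for this system, with
determinant ±(r² - 1). For r² = 1 they become compatibility conditions. -/
theorem E_eq {L R w N : ℂ} (hL : L = 1 - r ^ 2 + a * (r ^ 2 - s))
    (hR : R = 1 - r ^ 2 * s + a * s * (r ^ 2 - 1)) (hw : w = r * (1 - s) * (1 - s * a) * (1 - a))
    (hN : N = R + s * a * L) :
    (r ^ 2 - 1) * w * R * E = (r - s ^ 2) * a * L * R - (r - 1) * N * w := by
  have hP := H.P_eq
  have ht := H.mul_t_eq
  rw [← hL, ← hR] at ht
  rw [← hL, ← hw] at hP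
  rw [hN]
  linear_combination (r - s ^ 2) * R * hP - w * R * H.eq₁ - (r - 1) * w * ht

theorem B_eq {L R w N : ℂ} (hL : L = 1 - r ^ 2 + a * (r ^ 2 - s))
    (hR : R = 1 - r ^ 2 * s + a * s * (r ^ 2 - 1)) (hw : w = r * (1 - s) * (1 - s * a) * (1 - a))
    (hN : N = R + s * a * L) :
    (r ^ 2 - 1) * w * R * B = (r * s ^ 2 - 1) * a * L * R - (r - 1) * N * w := by
  have hP := H.P_eq
  have ht := H.mul_t_eq
  rw [← hL, ← hR] at ht
  rw [← hL, ← hw] at hP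
  rw [hN]
  linear_combination (r * s ^ 2 - 1) * R * hP + r * w * R * H.eq₁ - (r - 1) * w * ht

/-- The values of B and E from Cramer's rule must have the product t/r. After clearing denominators
this is a polynomial equation in a, s, r, and `key` is its factorization. -/
theorem branchNorm'_mul_branchNorm : branchNorm' a s r * branchNorm a s r = 0 := by
  have hE := H.E_eq rfl rfl rfl rfl
  have hB := H.B_eq rfl rfl rfl rfl
  have ht := H.mul_t_eq
  have key : branchNorm' a s r * branchNorm a s r =
      ((r - s ^ 2) * a * (1 - r ^ 2 + a * (r ^ 2 - s)) * (1 - r ^ 2 * s + a * s * (r ^ 2 - 1)) -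
        (r - 1) * (1 - r ^ 2 * s + a * s * (r ^ 2 - 1) + s * a * (1 - r ^ 2 + a * (r ^ 2 - s))) *
          (r * (1 - s) * (1 - s * a) * (1 - a))) *
      ((r * s ^ 2 - 1) * a * (1 - r ^ 2 + a * (r ^ 2 - s)) *
        (1 - r ^ 2 * s + a * s * (r ^ 2 - 1)) -
        (r - 1) * (1 - r ^ 2 * s + a * s * (r ^ 2 - 1) + s * a * (1 - r ^ 2 + a * (r ^ 2 - s))) *
          (r * (1 - s) * (1 - s * a) * (1 - a))) -
      (r ^ 2 - 1) ^ 2 * (1 - r ^ 2 * s + a * s * (r ^ 2 - 1)) *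
        ((1 - s) * (1 - s * a) * (1 - a)) ^ 2 * r *
        (s * a * (1 - r ^ 2 + a * (r ^ 2 - s))) := by
    rw [branchNorm, branchNorm']
    ring
  rw [key, ← hE, ← hB, ← ht]
  ring

/-- With B = Y/D, E = X/D and t = saL/R, the branch equations become polynomial in a, s, r after
clearing denominators. The long brackets in `h₂` and `h₃` are cofactors of `branchNorm` in these
polynomials. -/
theorem reducedBranch_of_branchNorm (hs : s ≠ 1) (hr : r ^ 2 ≠ 1) (hF : branchNorm a s r = 0) :
    ReducedBranch a s r B E := by
  obtain ⟨hL0, hR0⟩ := H.L_ne_zero_and_R_ne_zero hs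
  obtain ⟨a0, a1, s0, sa1, r0, B0, B1, rB1, E0, E1, rE1, at0, sat0, -, -, -⟩ := id H
  obtain ⟨L, hL⟩ : ∃ L, L = 1 - r ^ 2 + a * (r ^ 2 - s) := ⟨_, rfl⟩
  obtain ⟨R, hR⟩ : ∃ R, R = 1 - r ^ 2 * s + a * s * (r ^ 2 - 1) := ⟨_, rfl⟩
  obtain ⟨w, hw⟩ : ∃ w, w = r * (1 - s) * (1 - s * a) * (1 - a) := ⟨_, rfl⟩
  obtain ⟨X, hX⟩ : ∃ X, X = (r - s ^ 2) * a * L * R - (r - 1) * (R + s * a * L) * w := ⟨_, rfl⟩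
  obtain ⟨Y, hY⟩ : ∃ Y, Y = (r * s ^ 2 - 1) * a * L * R - (r - 1) * (R + s * a * L) * w :=
    ⟨_, rfl⟩
  obtain ⟨D, hD⟩ : ∃ D, D = (r ^ 2 - 1) * w * R := ⟨_, rfl⟩
  have hE := H.E_eq hL hR hw rfl
  have hB := H.B_eq hL hR hw rfl
  have ht := H.mul_t_eq
  have hP := H.P_eq
  rw [← hX, ← hD] at hE
  rw [← hY, ← hD] at hB
  rw [← hR, ← hL] at ht
  rw [← hw, ← hL] at hP
  rw [← hL] at hL0
  rw [← hR] at hR0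
  have hw0 : w ≠ 0 := by
    rw [hw]
    exact mul_ne_zero (mul_ne_zero (mul_ne_zero r0 (sub_ne_zero.mpr hs.symm)) sa1) a1
  have hD0 : D ≠ 0 := by
    rw [hD]
    exact mul_ne_zero (mul_ne_zero (sub_ne_zero.mpr hr) hw0) hR0
  have h₂ : a ^ 2 * r * w * (1 - s) * (D + X) = R ^ 2 * (D + Y) := by
    rw [← sub_eq_zero]
    have : a ^ 2 * r * w * (1 - s) * (D + X) - R ^ 2 * (D + Y) = branchNorm a s r * (
      -a ^ 4 * s ^ 3 * r + a ^ 4 * s ^ 2 * r ^ 3 + a ^ 4 * s ^ 2 * r - a ^ 4 * s * r ^ 3 + a ^ 3 * s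
      ^ 3 * r - a ^ 3 * s ^ 2 * r ^ 4 - 2 * a ^ 3 * s ^ 2 * r ^ 3 + 2 * a ^ 3 * s ^ 2 * r ^ 2 + a ^
      3 * s ^ 2 * r - a ^ 3 * s ^ 2 + a ^ 3 * s * r ^ 3 - 2 * a ^ 3 * s * r + a ^ 3 * r ^ 3 + a ^ 2
      * s ^ 2 * r ^ 4 + a ^ 2 * s ^ 2 * r ^ 3 - a ^ 2 * s ^ 2 * r ^ 2 - 2 * a ^ 2 * s ^ 2 * r + a ^
      2 * s * r ^ 4 + a ^ 2 * s * r ^ 3 - 3 * a ^ 2 * s * r ^ 2 + a ^ 2 * s * r + 2 * a ^ 2 * s - 2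
      * a ^ 2 * r ^ 3 + a ^ 2 * r + a * s ^ 2 * r ^ 4 - a * s ^ 2 * r ^ 2 - 2 * a * s * r ^ 4 - a *
      s * r ^ 3 + 2 * a * s * r ^ 2 + a * s * r + a * r ^ 3 + a * r ^ 2 - a * r - a - s ^ 2 * r ^ 4
      + s * r ^ 4 + s * r ^ 2 - r ^ 2) := by
      rw [hX, hY, hD, hw, hL, hR, branchNorm]
      ring
    rw [this, hF, zero_mul]
  have h₃ : s * L * ((Y + D) * R - a * (1 - s) * (1 - s * a) * D) = R * w * X := by
    rw [← sub_eq_zero]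
    have : s * L * ((Y + D) * R - a * (1 - s) * (1 - s * a) * D) - R * w * X =
        branchNorm a s r * R * (
      -a ^ 2 * s ^ 2 + a ^ 2 * s * r ^ 2 + a * s - a * r ^ 2 - s * r ^ 2 + r ^ 2) := by
      rw [hX, hY, hD, hw, hL, hR, branchNorm]
      ring
    rw [this, hF, zero_mul, zero_mul]
  have hτ : R * (a - r * B * E) = a * (1 - s) * (1 - s * a) := by
    have : R - s * L = (1 - s) * (1 - s * a) := by
      rw [hR, hL]
      ring
    linear_combination -ht + a * this
  have hτ' : R * (s * a - r * B * E) = s * a * (r ^ 2 * (1 - s) * (1 - a)) := by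
    have : R - L = r ^ 2 * (1 - s) * (1 - a) := by
      rw [hR, hL]
      ring
    linear_combination -ht + s * a * this
  refine ⟨?_, ?_⟩
  · refine mul_left_cancel₀ (mul_ne_zero (pow_ne_zero 2 hR0) hD0) ?_
    have hττ : R ^ 2 * ((a - r * B * E) * (s * a - r * B * E)) = s * a ^ 2 * r * w * (1 - s) := by
      rw [hw]
      linear_combination R * (s * a - r * B * E) * hτ + a * (1 - s) * (1 - s * a) * hτ'
    linear_combination D * (1 + E) * hττ + s * a ^ 2 * r * w * (1 - s) * hE + s * h₂ -
      s * R ^ 2 * hB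
  -- Multiplication by `r * E` turns every product of `B` and `E` into t, which leaves an equation
  -- linear in `B` and `E`.
  · have hne : r * E * R * (D * R) ≠ 0 := by simp [r0, E0, hR0, hD0]
    refine mul_left_cancel₀ hne ?_
    linear_combination D * R * (1 + B - (a - r * B * E)) * ht - D * R * r * E * (1 - a) * hτ +
      a * h₃ + a * s * L * R * hB - a * s * L * D * hτ - a * R * w * hE + D * R * a * E * hw

/-- The involution sends a to t/(sa) = L/R and r to 1/r; `key` is the resulting substitution in
`branchNorm`. -/
theorem branchNorm_involution (hs : s ≠ 1) (hF : branchNorm' a s r = 0) :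
    branchNorm (r * B * E / (s * a)) s (1 / r) = 0 := by
  obtain ⟨hL0, hR0⟩ := H.L_ne_zero_and_R_ne_zero hs
  have ht := H.mul_t_eq
  have hr0 := H.r0
  have ha : r * B * E / (s * a) =
      (1 - r ^ 2 + a * (r ^ 2 - s)) / (1 - r ^ 2 * s + a * s * (r ^ 2 - 1)) := by
    rw [div_eq_div_iff (mul_ne_zero H.s0 H.a0) hR0, ht]
    ring
  rw [ha]
  set L := 1 - r ^ 2 + a * (r ^ 2 - s) with hL
  set R := 1 - r ^ 2 * s + a * s * (r ^ 2 - 1) with hR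
  have key : branchNorm (L / R) s (1 / r) * (R ^ 4 * r ^ 5) =
      -(r * (1 - s)) ^ 4 * branchNorm' a s r := by
    rw [branchNorm, branchNorm']
    field_simp
    rw [hL, hR]
    ring
  rw [hF, mul_zero] at key
  simpa [hR0, hr0] using key

end ReducedEquations

namespace ReducedEquations

variable {a s r B E : ℂ}

/-- Cramer's rule degenerates at r = 1. There BE = -a² and one of `B`, `E` equals a² - 1; which one
decides the branch. -/
theorem reducedBranch_of_eq_one (H : ReducedEquations a s r B E) (hr : r = 1) (hs : s = -1)
    (hB : B = a ^ 2 - 1) : ReducedBranch a s r B E := by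
  subst hr hs
  have hBE : B * E = -a ^ 2 := by linear_combination (1 / 2) * H.mul_t_eq
  refine ⟨?_, ?_⟩
  · linear_combination ((B * E - a ^ 2) * (1 + E) + a ^ 2) * hBE + (1 - a ^ 2 * E) * hB
  · linear_combination (1 + B - a) * hBE + (B - a) * hB

/-- At r = -1 the compatibility condition is a vanishing sum of two squares; `j` is the square root
of -1 given by the ratio of their bases. `B` then has two possible values, one for each branch. -/
theorem reducedBranch_of_eq_neg_one (H : ReducedEquations a s r B E) (hr : r = -1) (hs : s ≠ 1)
    {j : ℂ} (hj : j ^ 2 = -1) (hj' : 1 + s * a ^ 2 - a = j * (1 + s * a ^ 2 - s * a))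
    (hB : B = -j * ((1 - a) * (1 - s * a))) : ReducedBranch a s r B E := by
  subst hr
  have hs' : 1 - s ≠ 0 := sub_ne_zero.mpr hs.symm
  have hBE : B * E = -s * a ^ 2 := by
    refine mul_left_cancel₀ hs' ?_
    linear_combination -H.mul_t_eq
  have hE : (1 - a) * (1 - s * a) * E = -j * s * a ^ 2 := by
    linear_combination j * hBE - j * E * hB + (1 - a) * (1 - s * a) * E * hj
  refine ⟨?_, ?_⟩
  · have h₁ : (a - -1 * B * E) * (s * a - -1 * B * E) = s * a ^ 2 * ((1 - a) * (1 - s * a)) := by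
      linear_combination (s * a + a + B * E - s * a ^ 2) * hBE
    have h₂ : a ^ 2 * ((1 - a) * (1 - s * a)) * (1 + E) = 1 + B := by
      linear_combination a ^ 2 * hE - hB + (a ^ 2 - j * a - 1) * hj' +
        (-a + s * a * (a - a ^ 2)) * hj
    linear_combination (1 + E) * h₁ + s * h₂
  · have h₁ : a - -1 * B * E = a * (1 - s * a) := by linear_combination hBE
    rw [h₁, hB]
    linear_combination (1 - a) * (1 - s * a) * (-j * hj' - a * hj)

theorem reducedBranch_or (H : ReducedEquations a s r B E) (hs : s ≠ 1) :
    ReducedBranch a s r B E ∨ ReducedBranch (r * B * E / (s * a)) s (1 / r) (r * E) (r * B) := by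
  have hX := H.E_eq rfl rfl rfl rfl
  have ht := H.mul_t_eq
  have hP := H.P_eq
  by_cases hr : r ^ 2 = 1
  · have hr' : r = 1 ∨ r = -1 := by simpa using hr
    rcases hr' with rfl | rfl
    · have hs' : s = -1 := by
        obtain ⟨hL, hR⟩ := H.L_ne_zero_and_R_ne_zero hs
        -- The left side of `E_eq` vanishes at r = 1, so its right side must vanish too.
        have h : (1 - s) * (1 + s) *
          (a * ((1 - 1 ^ 2 + a * (1 ^ 2 - s)) * (1 - 1 ^ 2 * s + a * s * (1 ^ 2 - 1)))) = 0 := by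
          linear_combination -hX
        rcases mul_eq_zero.mp h with h | h
        · rcases mul_eq_zero.mp h with h | h
          · exact absurd (sub_eq_zero.mp h).symm hs
          · linear_combination h
        · simp only [mul_eq_zero, H.a0, hL, hR, or_self] at h
      subst hs'
      have hBE : B * E = -a ^ 2 := by linear_combination (1 / 2) * ht
      have h : (B - (a ^ 2 - 1)) * (E - (a ^ 2 - 1)) = 0 := by
        linear_combination a ^ 2 * hBE + (1 / 2) * hP
      rcases mul_eq_zero.mp h with h | h
      · exact Or.inl (H.reducedBranch_of_eq_one rfl rfl (sub_eq_zero.mp h))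
      · refine Or.inr (H.involution.reducedBranch_of_eq_one (by simp) rfl ?_)
        have h0 := H.a0
        have ha : 1 * B * E / (-1 * a) = a := by
          field_simp
          linear_combination -hBE
        rw [ha]
        linear_combination h
    · have hs' : 1 - s ≠ 0 := sub_ne_zero.mpr hs.symm
      have hBE : B * E = -s * a ^ 2 := by
        refine mul_left_cancel₀ hs' ?_
        linear_combination -ht
      have hPμ : (1 - a) * (1 - s * a) * ((1 + B) * (1 + -1 * E)) = -a ^ 2 := by
        refine mul_left_cancel₀ hs' ?_
        linear_combination -hP
      have hX' : (1 + s * a ^ 2 - s * a) ^ 2 + (1 + s * a ^ 2 - a) ^ 2 = 0 := by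
        refine mul_left_cancel₀ (pow_ne_zero 2 hs') ?_
        linear_combination hX
      have hne : 1 + s * a ^ 2 - s * a ≠ 0 := by
        intro h
        rw [h] at hX'
        have h' : 1 + s * a ^ 2 - a = 0 := by simpa using hX'
        have : (1 - s) * a = 0 := by linear_combination h - h'
        simp [hs', H.a0] at this
      obtain ⟨j, hj'⟩ : ∃ j, 1 + s * a ^ 2 - a = j * (1 + s * a ^ 2 - s * a) :=
        ⟨_, (div_mul_cancel₀ _ hne).symm⟩
      have hj : j ^ 2 = -1 := by
        refine mul_right_cancel₀ (pow_ne_zero 2 hne) ?_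
        linear_combination hX' - (1 + s * a ^ 2 - a + j * (1 + s * a ^ 2 - s * a)) * hj'
      have key : a ^ 2 + (1 + s * a ^ 2) * ((1 - a) * (1 - s * a)) =
          j * (((1 - a) * (1 - s * a)) ^ 2 - s * a ^ 2) := by
        linear_combination ((1 - j) * ((1 + s * a ^ 2 - a) + j * (1 + s * a ^ 2 - s * a)) -
          (1 + s * a ^ 2) - j * (1 + s * a ^ 2 - s * a) + j * (1 + s * a ^ 2)) * hj' +
          ((1 + s * a ^ 2) * (1 + s * a ^ 2 - s * a) - j * (1 + s * a ^ 2 - s * a) ^ 2) * hj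
      -- Eliminating `E` through BE = -sa² leaves a quadratic equation for `B`, which splits once
      -- `j` is available.
      have h : (B - -j * ((1 - a) * (1 - s * a))) * ((1 - a) * (1 - s * a) * B - j * s * a ^ 2) =
          0 := by
        linear_combination B * hPμ + (1 - a) * (1 - s * a) * (1 + B) * hBE - B * key -
          s * a ^ 2 * ((1 - a) * (1 - s * a)) * hj
      rcases mul_eq_zero.mp h with h | h
      · exact Or.inl (H.reducedBranch_of_eq_neg_one rfl hs hj hj' (sub_eq_zero.mp h))
      · have h0 := H.a0
        have h0' := H.s0
        have ha : -1 * B * E / (s * a) = a := by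
          field_simp
          linear_combination -hBE
        refine Or.inr (H.involution.reducedBranch_of_eq_neg_one (by norm_num) hs hj ?_ ?_)
        · rwa [ha]
        · rw [ha]
          have : j * s * a ^ 2 * E = -(s * a ^ 2) * ((1 - a) * (1 - s * a)) := by
            linear_combination (1 - a) * (1 - s * a) * hBE - E * h
          have hne' : j * (s * a ^ 2) ≠ 0 := by
            refine mul_ne_zero ?_ (by simp [h0, h0'])
            rintro rfl
            norm_num at hj
          refine mul_left_cancel₀ hne' ?_
          linear_combination -this + (s * a ^ 2) * ((1 - a) * (1 - s * a)) * hj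
  · rcases mul_eq_zero.mp H.branchNorm'_mul_branchNorm with h | h
    · refine Or.inr (H.involution.reducedBranch_of_branchNorm hs ?_ (H.branchNorm_involution hs h))
      simpa using hr
    · exact Or.inl (H.reducedBranch_of_branchNorm hs hr h)

/-- Here the first equation forces E = B and the third one factors; the involution exchanges the two
factors. -/
theorem branch_of_eq_one_of_eq_neg_one (H : ReducedEquations a s r B E) (hs : s = 1)
    (hr : r = -1) :
    ReducedBranch a s r B E ∨ ReducedBranch (r * B * E / (s * a)) s (1 / r) (r * E) (r * B) := by
  subst hs hr
  have hEB : E = B := by linear_combination (1 / 2) * H.eq₁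
  subst hEB
  have a0 := H.a0
  have h : (1 - E ^ 2 - a) * ((a - 1) * (1 - E ^ 2) + 1) = 0 := by linear_combination H.eq₃
  rcases mul_eq_zero.mp h with h | h
  · left
    refine ⟨?_, ?_⟩
    · linear_combination -(1 + E) * (a + E ^ 2 + 1) * h
    · linear_combination (E - a) * h
  · right
    have h1 : -1 * E * E / (1 * a) = 1 - E ^ 2 := by
      field_simp
      linear_combination -h
    have h2 : (1 : ℂ) / -1 = -1 := by norm_num
    rw [h1, h2]
    exact ⟨by ring, by ring⟩

theorem cases (H : ReducedEquations a s r B E) :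
    (s = 1 ∧ r = 1) ∨ ReducedBranch a s r B E ∨
      ReducedBranch (r * B * E / (s * a)) s (1 / r) (r * E) (r * B) := by
  by_cases hs : s = 1
  · have hr : r = 1 ∨ r = -1 := by
      have h : (r - 1) * (r + 1) * ((a - r * B * E) * (1 - a)) = 0 := by
        have := H.eq₂
        rw [hs] at this
        linear_combination -this
      simp only [mul_eq_zero, H.at0, H.a1, or_false] at h
      exact h.imp (fun h => sub_eq_zero.mp h) fun h => eq_neg_of_add_eq_zero_left h
    rcases hr with hr | hr
    · exact Or.inl ⟨hs, hr⟩
    · exact Or.inr (H.branch_of_eq_one_of_eq_neg_one hs hr)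
  · exact Or.inr (H.reducedBranch_or hs)

end ReducedEquations

/-- The reduced variables of a point of the deformation variety. -/
structure IsReduction (a b c d e f g h s r B E : ℂ) : Prop where
  eqs : ReducedEquations a s r B E
  hc : c = s * a
  hb : b = 1 / (1 + B)
  hd : d = 1 / (1 + r * B)
  he : e = E / (1 + E)
  hf : f = r * E / (1 + r * E)
  hg : g = (a - r * B * E) / a
  hh : h = (s * a - r * B * E) / (s * a)

/-- `edge₂` and `edge₃` say c(1-h) = a(1-g) = rBE, and then `edge₁` says f/(1-f) = rE. The reduced
equations are combinations of the face relations, after cancelling nonzero factors. -/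
theorem FigureEightEquations.exists_isReduction {a b c d e f g h : ℂ}
    (H : FigureEightEquations a b c d e f g h) :
    ∃ s r B E, IsReduction a b c d e f g h s r B E := by
  obtain ⟨a0, a1, b0, b1, c0, c1, d0, d1, e0, e1, f0, f1, g0, g1, h0, h1, E₁, E₂, E₃, F₁, F₂, F₃,
    F₄⟩ := H
  obtain ⟨B, hB⟩ : ∃ B, B = (1 - b) / b := ⟨_, rfl⟩
  have hB0 : B ≠ 0 := by rw [hB]; exact div_ne_zero b1 b0
  obtain ⟨r, hr⟩ : ∃ r, r = (1 - d) / d / B := ⟨_, rfl⟩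
  have hr0 : r ≠ 0 := by rw [hr]; exact div_ne_zero (div_ne_zero d1 d0) hB0
  obtain ⟨E, hE⟩ : ∃ E, E = e / (1 - e) := ⟨_, rfl⟩
  have hE0 : E ≠ 0 := by rw [hE]; exact div_ne_zero e0 e1
  obtain ⟨s, hs⟩ : ∃ s, s = c / a := ⟨_, rfl⟩
  have hs0 : s ≠ 0 := by rw [hs]; exact div_ne_zero c0 a0
  have hc : c = s * a := by rw [hs]; field_simp
  have hb : b * (1 + B) = 1 := by rw [hB]; field_simp; ring
  have hd : d * (1 + r * B) = 1 := by rw [hr]; field_simp; ring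
  have he : (1 - e) * (1 + E) = 1 := by rw [hE]; field_simp; ring
  have hB1 : 1 + B ≠ 0 := right_ne_zero_of_mul_eq_one hb
  have hrB1 : 1 + r * B ≠ 0 := right_ne_zero_of_mul_eq_one hd
  have hE1 : 1 + E ≠ 0 := right_ne_zero_of_mul_eq_one he
  have hb' : b = 1 / (1 + B) := eq_one_div_of_mul_eq_one_left hb
  have hd' : d = 1 / (1 + r * B) := eq_one_div_of_mul_eq_one_left hd
  have he' : e = E / (1 + E) := by
    rw [eq_div_iff hE1]
    linear_combination -he
  have ht' : s * a * (1 - h) = r * B * E := by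
    rw [hd', he', hc] at E₂
    field_simp at E₂
    linear_combination -E₂
  have ht : a * (1 - g) = r * B * E := by
    rw [E₃, hc, ht']
  have hf : (1 - f) * (1 + r * E) = 1 := by
    have : B * f = B * (r * E * (1 - f)) := by
      rw [hb'] at E₁
      field_simp at E₁
      linear_combination E₁ + (1 - f) * ht
    linear_combination -mul_left_cancel₀ hB0 this
  have hrE1 : 1 + r * E ≠ 0 := right_ne_zero_of_mul_eq_one hf
  have hf' : f = r * E / (1 + r * E) := by
    rw [eq_div_iff hrE1]
    linear_combination -hf
  have hg' : g = (a - r * B * E) / a := by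
    rw [eq_div_iff a0]
    linear_combination -ht
  have hh' : h = (s * a - r * B * E) / (s * a) := by
    rw [eq_div_iff (mul_ne_zero hs0 a0)]
    linear_combination -ht'
  have hat : a - r * B * E ≠ 0 := by
    rintro h
    rw [h, zero_div] at hg'
    exact g0 hg'
  have hsat : s * a - r * B * E ≠ 0 := by
    rintro h
    rw [h, zero_div] at hh'
    exact h0 hh'
  refine ⟨s, r, B, E, ⟨a0, a1, hs0, hc ▸ c1, hr0, hB0, hB1, hrB1, hE0, hE1, hrE1, hat, hsat, ?_,
    ?_, ?_⟩, hc, hb', hd', he', hf', hg', hh'⟩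
  all_goals
    clear hB hr hE hs hb hd he hf ht ht' E₁ E₂ E₃ b0 b1 c0 c1 d0 d1 e0 e1 f0 f1 g0 g1 h0 h1
    subst hc hb' hd' he' hf' hg' hh'
    have hrB1' : 1 + B * r ≠ 0 := by rwa [mul_comm]
    have hrE1' : 1 + E * r ≠ 0 := by rwa [mul_comm]
    field_simp at F₁ F₃ F₄
  · refine mul_right_cancel₀ (mul_ne_zero (mul_ne_zero (mul_ne_zero hr0 hB0) hE0)
      (mul_ne_zero hat a1)) ?_
    linear_combination -s * r * B * E * F₄ - F₃
  · refine mul_right_cancel₀ (mul_ne_zero (mul_ne_zero (mul_ne_zero hr0 hB0) hE0)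
      (mul_ne_zero hB1 hrE1)) ?_
    linear_combination -F₁ - r ^ 3 * B * E * F₄
  · linear_combination F₄

/-- The equations in the coordinates on the oriented edges `01`, `10`, `23`, `32` of the two
tetrahedra of a component of the deformation variety that is not invariant under the involution. -/
structure BranchEquations (a b d e f g h : ℂ) : Prop where
  eq₁ : 1 - b = g * a * b * (1 - a * b)
  eq₂ : 1 - e = a ^ 2 * b * g * h

/-- The equations in the coordinates on the oriented edges `01`, `10`, `23`, `32` of the two
tetrahedra of the component of the deformation variety that is invariant under the involution. -/
structure SymmetricEquations (a b c d e f g h : ℂ) : Prop where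
  hac : c = a
  hbd : d = b
  hef : f = e
  hgh : h = g
  eq₁ : e * (1 - b) = g * (1 - a)
  eq₂ : g * (1 - a) = a * b * (1 - e) * (1 - g)

namespace IsReduction

variable {a b c d e f g h s r B E : ℂ}

theorem branchEquations (H : IsReduction a b c d e f g h s r B E)
    (hB : ReducedBranch a s r B E) : BranchEquations a b d e f g h := by
  obtain ⟨⟨a0, a1, s0, sa1, r0, B0, B1, rB1, E0, E1, rE1, at0, sat0, eq₁, eq₂, eq₃⟩, hc, hb, hd, he,
    hf, hg, hh⟩ := H
  obtain ⟨h₁, h₂⟩ := hB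
  subst hc hb hd he hf hg hh
  refine ⟨?_, ?_⟩
  · field_simp
    linear_combination h₂
  · field_simp
    linear_combination -h₁

theorem symmetricEquations (H : IsReduction a b c d e f g h s r B E) (hs : s = 1) (hr : r = 1) :
    SymmetricEquations a b c d e f g h := by
  obtain ⟨⟨a0, a1, s0, sa1, r0, B0, B1, rB1, E0, E1, rE1, at0, sat0, eq₁, eq₂, eq₃⟩, hc, hb, hd, he,
    hf, hg, hh⟩ := H
  subst hs hr
  subst hc hb hd he hf hg hh
  refine ⟨by ring, by ring, by ring, by ring, ?_, ?_⟩
  · field_simp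
    linear_combination -eq₃
  · field_simp
    linear_combination eq₃

theorem involution (H : IsReduction a b c d e f g h s r B E) :
    IsReduction (1 - h) (1 - f) (1 - g) (1 - e) (1 - d) (1 - b) (1 - c) (1 - a)
      s (1 / r) (r * E) (r * B) := by
  obtain ⟨eqs, hc, hb, hd, he, hf, hg, hh⟩ := H
  have hH : 1 - h = r * B * E / (s * a) := by
    have s0 := eqs.s0
    have a0 := eqs.a0
    rw [hh]
    field_simp
    ring
  have r0 := eqs.r0
  have B1 := eqs.B1
  have E1 := eqs.E1
  have rB1 := eqs.rB1
  have rE1 := eqs.rE1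
  have s0 := eqs.s0
  have a0 := eqs.a0
  have B0 := eqs.B0
  have E0 := eqs.E0
  have hE : 1 / r * (r * E) = E := by field_simp
  have hB : 1 / r * (r * B) = B := by field_simp
  refine ⟨?_, ?_, ?_, ?_, ?_, ?_, ?_, ?_⟩
  · rw [hH]
    exact eqs.involution
  · rw [hH, hg]
    field_simp
    ring
  · rw [hf]
    field_simp
    ring
  · rw [he, hE]
    field_simp
    ring
  · rw [hd, one_sub_div rB1]
    ring
  · rw [hb, hB, one_sub_div B1]
    ring
  · rw [hE, hH, hc]
    field_simp
  · rw [hE, hH]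
    field_simp

theorem cases (H : IsReduction a b c d e f g h s r B E) :
    SymmetricEquations a b c d e f g h ∨ BranchEquations a b d e f g h ∨
      BranchEquations (1 - h) (1 - f) (1 - e) (1 - d) (1 - b) (1 - c) (1 - a) := by
  rcases H.eqs.cases with ⟨hs, hr⟩ | h | h'
  · exact Or.inl (H.symmetricEquations hs hr)
  · exact Or.inr (Or.inl (H.branchEquations h))
  · refine Or.inr (Or.inr (H.involution.branchEquations ?_))
    have hH : 1 - h = r * B * E / (s * a) := by
      have s0 := H.eqs.s0
      have a0 := H.eqs.a0
      rw [H.hh]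
      field_simp
      ring
    rwa [hH]

end IsReduction

theorem FigureEightEquations.cases {a b c d e f g h : ℂ}
    (H : FigureEightEquations a b c d e f g h) :
    SymmetricEquations a b c d e f g h ∨ BranchEquations a b d e f g h ∨
      BranchEquations (1 - h) (1 - f) (1 - e) (1 - d) (1 - b) (1 - c) (1 - a) := by
  obtain ⟨s, r, B, E, h⟩ := H.exists_isReduction
  exact h.cases

/-- The involution of the deformation variety. -/
theorem FigureEightEquations.involution {a b c d e f g h : ℂ}
    (H : FigureEightEquations a b c d e f g h) :
    FigureEightEquations (1 - h) (1 - f) (1 - g) (1 - e) (1 - d) (1 - b) (1 - c) (1 - a) := by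
  obtain ⟨a0, a1, b0, b1, c0, c1, d0, d1, e0, e1, f0, f1, g0, g1, h0, h1, E₁, E₂, E₃, F₁, F₂, F₃,
    F₄⟩ := H
  refine ⟨h1, by simpa, f1, by simpa, g1, by simpa, e1, by simpa, d1, by simpa, b1, by simpa,
    c1, by simpa, a1, by simpa, ?_, ?_, ?_, ?_, ?_, ?_, ?_⟩
  all_goals simp only [sub_sub_cancel]
  · linear_combination E₁ + b * (1 - f) * E₃
  · linear_combination E₂ - d * (1 - e) * E₃
  · linear_combination -E₃
  · linear_combination -F₄
  · linear_combination -F₃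
  · linear_combination -F₂
  · linear_combination -F₁

end Decomposition

/-! ### Coordinate rings of families of shapes -/

section ShapeFamily

/-- Elements of a subalgebra that are units of it. -/
def Subalgebra.unitsSet {R A : Type*} [CommRing R] [CommRing A] [Algebra R A]
    (S : Subalgebra R A) : Set A :=
  {u | u ∈ S ∧ ∃ w ∈ S, u * w = 1}

namespace Subalgebra

variable {R A : Type*} [CommRing R] [CommRing A] [Algebra R A] {S : Subalgebra R A} {u w : A}

theorem one_mem_unitsSet : (1 : A) ∈ S.unitsSet := ⟨S.one_mem, 1, S.one_mem, mul_one 1⟩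

theorem mul_mem_unitsSet (hu : u ∈ S.unitsSet) (hw : w ∈ S.unitsSet) : u * w ∈ S.unitsSet := by
  obtain ⟨h1, u', h2, h3⟩ := hu
  obtain ⟨h4, w', h5, h6⟩ := hw
  exact ⟨S.mul_mem h1 h4, u' * w', S.mul_mem h2 h5, by linear_combination w * w' * h3 + h6⟩

theorem neg_mem_unitsSet (hu : -u ∈ S.unitsSet) : u ∈ S.unitsSet := by
  obtain ⟨h1, u', h2, h3⟩ := hu
  exact ⟨by simpa using S.neg_mem h1, -u', S.neg_mem h2, by linear_combination h3⟩

theorem mem_unitsSet_of_mul (hu : u ∈ S.unitsSet) (huw : u * w ∈ S.unitsSet) :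
    w ∈ S.unitsSet := by
  obtain ⟨h1, u', h2, h3⟩ := hu
  obtain ⟨h4, t, h5, h6⟩ := huw
  refine ⟨?_, u * t, S.mul_mem h1 h5, by linear_combination h6⟩
  have : w = u' * (u * w) := by linear_combination -w * h3
  rw [this]
  exact S.mul_mem h2 h4

end Subalgebra

theorem HypersurfaceRing.mk_eq_aeval {k σ : Type} [Field k] {F G : MvPolynomial σ k}
    (p : MvPolynomial σ k) : mk F G p = aeval (fun i => mk F G (X i)) p := by
  conv_lhs => rw [← aeval_X_left_apply p]
  rw [comp_aeval_apply]

theorem HypersurfaceRing.subalgebra_eq_top {k σ : Type} [Field k] {F G : MvPolynomial σ k}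
    (S : Subalgebra k (HypersurfaceRing F G)) (hX : ∀ i, mk F G (X i) ∈ S)
    (hG : mk F G G ∈ S.unitsSet) : S = ⊤ := by
  have hmk : ∀ p, mk F G p ∈ S := by
    intro p
    induction p using MvPolynomial.induction_on with
    | C a => exact algebraMap_mem S a |> fun h => by rwa [← (mk F G).commutes] at h
    | add p q hp hq => rw [map_add]; exact S.add_mem hp hq
    | mul_X p i hp => rw [map_mul]; exact S.mul_mem hp (hX i)
  rw [eq_top_iff]
  rintro x -
  obtain ⟨y, ⟨_, n, rfl⟩, h⟩ := IsLocalization.exists_mk'_eq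
    (Submonoid.powers (Ideal.Quotient.mk (Ideal.span {F}) G)) x
  obtain ⟨p, rfl⟩ := Ideal.Quotient.mk_surjective y
  obtain ⟨-, w, hw, hGw⟩ := hG
  have hx : x * mk F G G ^ n = mk F G p := by
    rw [← h]
    have := IsLocalization.mk'_spec (HypersurfaceRing F G) (Ideal.Quotient.mk (Ideal.span {F}) p)
      (⟨_, n, rfl⟩ : Submonoid.powers (Ideal.Quotient.mk (Ideal.span {F}) G))
    simpa [mk] using this
  have : x = mk F G p * w ^ n := by
    rw [← hx, mul_assoc, ← mul_pow, hGw, one_pow, mul_one]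
  rw [this]
  exact S.mul_mem (hmk p) (S.pow_mem hw n)

variable {A : Type} [CommRing A]

/-- The functions on oriented edges that are determined by the functions `x` on the edges
`01`, `10`, `23`, `32` of the two tetrahedra and the internal relations. -/
noncomputable def shapeFamily (x : Fin 2 → Fin 4 → A) : OrientedEdge 2 → A :=
  shapeCoord x (fun T i => Ring.inverse (1 - x T i)) (fun T i => 1 - Ring.inverse (x T i))

variable [Algebra ℂ A]

/-- `Ring.inverse` is preserved by homomorphisms on units, so evaluating the family at ψ gives the
shape point with the evaluated parameters. -/
theorem mem_complexPoints_shapeFamily {a b c d e f g h : A}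
    (hx : ∀ T i, IsUnit ((![![a, b, c, d], ![e, f, g, h]] : Fin 2 → Fin 4 → A) T i) ∧
      IsUnit (1 - (![![a, b, c, d], ![e, f, g, h]] : Fin 2 → Fin 4 → A) T i))
    (z : OrientedEdge 2 → ℂ) :
    z ∈ complexPoints (shapeFamily ![![a, b, c, d], ![e, f, g, h]]) ↔
      ∃ ψ : A →ₐ[ℂ] ℂ, z = shapePoint (ψ a) (ψ b) (ψ c) (ψ d) (ψ e) (ψ f) (ψ g) (ψ h) := by
  have hinv : ∀ (ψ : A →ₐ[ℂ] ℂ) (u : A), IsUnit u → ψ (Ring.inverse u) = 1 / ψ u := by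
    intro ψ u hu
    rw [eq_div_iff (hu.map ψ).ne_zero, ← map_mul, Ring.inverse_mul_cancel _ hu, map_one]
  have key : ∀ ψ : A →ₐ[ℂ] ℂ, (fun i => ψ (shapeFamily ![![a, b, c, d], ![e, f, g, h]] i)) =
      shapePoint (ψ a) (ψ b) (ψ c) (ψ d) (ψ e) (ψ f) (ψ g) (ψ h) := by
    intro ψ
    have h1 : ∀ T i, (![![ψ a, ψ b, ψ c, ψ d], ![ψ e, ψ f, ψ g, ψ h]] : Fin 2 → Fin 4 → ℂ) T i =
        ψ ((![![a, b, c, d], ![e, f, g, h]] : Fin 2 → Fin 4 → A) T i) := by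
      intro T i
      fin_cases T <;> fin_cases i <;> rfl
    rw [shapePoint_eq]
    funext i
    simp only [shapeFamily, shapeCoord, h1]
    split_ifs
    · rfl
    · rw [hinv _ _ (hx _ _).2, map_sub, map_one]
    · rw [map_sub, map_one, hinv _ _ (hx _ _).1]
  constructor
  · rintro ⟨ψ, hψ⟩
    exact ⟨ψ, (funext hψ).trans (key ψ)⟩
  · rintro ⟨ψ, rfl⟩
    exact ⟨ψ, fun i => (congrFun (key ψ) i).symm⟩

/-- The two other coordinates at a vertex supply the inverses: 1/(1-x) is one of them, and 1/x is 1
minus the other. -/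
theorem mem_unitsSet_range_shapeFamily {x : Fin 2 → Fin 4 → A}
    (hx : ∀ T i, IsUnit (x T i) ∧ IsUnit (1 - x T i)) (T : Fin 2) (i : Fin 4) :
    x T i ∈ (aeval (R := ℂ) (shapeFamily x)).range.unitsSet ∧
      1 - x T i ∈ (aeval (R := ℂ) (shapeFamily x)).range.unitsSet := by
  have hmem : ∀ e, shapeFamily x e ∈ (aeval (R := ℂ) (shapeFamily x)).range :=
    fun e => ⟨X e, by simp⟩
  have key : ∀ i : Fin 4, i ≠ ![1, 0, 3, 2] i ∧ i ≠ ![2, 3, 0, 1] i ∧ i ≠ ![3, 2, 1, 0] i := by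
    decide
  have h1 := hmem (orientedEdge T i _ (key i).1)
  have h2 := hmem (orientedEdge T i _ (key i).2.1)
  have h3 := hmem (orientedEdge T i _ (key i).2.2)
  rw [shapeFamily, shapeCoord_one] at h1
  rw [shapeFamily, shapeCoord_two] at h2
  rw [shapeFamily, shapeCoord_three] at h3
  refine ⟨⟨h1, _, ?_, Ring.mul_inverse_cancel _ (hx T i).1⟩,
    ⟨Subalgebra.sub_mem _ (Subalgebra.one_mem _) h1, _, h2,
      Ring.mul_inverse_cancel _ (hx T i).2⟩⟩
  have := Subalgebra.sub_mem _ (Subalgebra.one_mem _) h3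
  rwa [sub_sub_cancel] at this

/-- A component of the deformation variety that is given by a hypersurface in `ℂ³`. -/
theorem HypersurfaceRing.complexPoints_shapeFamily {F G : MvPolynomial (Fin 3) ℂ} (hF : Prime F)
    {x₀ : Fin 3 → ℂ} (hF0 : aeval x₀ F = 0) (hG0 : aeval x₀ G ≠ 0)
    (hsmooth : ∀ (K : Type) [Field K] [Algebra ℂ K] (x : Fin 3 → K), aeval x F = 0 →
      (∀ i, aeval x (pderiv i F) = 0) → aeval x G = 0)
    {x : Fin 2 → Fin 4 → HypersurfaceRing F G} {S : Subalgebra ℂ (HypersurfaceRing F G)}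
    (hS : S = (aeval (R := ℂ) (shapeFamily x)).range) (hX : ∀ i, mk F G (X i) ∈ S)
    (hG : mk F G G ∈ S.unitsSet) :
    IsIrreducibleVariety (complexPoints (shapeFamily x)) ∧
      ringKrullDim (CoordinateRing (complexPoints (shapeFamily x))) = 2 ∧
      Algebra.Smooth ℂ (CoordinateRing (complexPoints (shapeFamily x))) := by
  have := isDomain x₀ hF0 hG0 hF
  have hc : Function.Surjective (aeval (R := ℂ) (shapeFamily x)) := by
    rw [← AlgHom.range_eq_top, ← hS]
    exact subalgebra_eq_top S hX hG
  have e := coordinateRingComplexPoints (shapeFamily x) hc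
  have hsm := smooth hsmooth
  refine ⟨isIrreducibleVariety_complexPoints _ hc, ?_, Algebra.Smooth.of_equiv e.symm⟩
  rw [ringKrullDim_eq_of_ringEquiv e.toRingEquiv]
  exact ringKrullDim_eq (n := 2) hF x₀ hF0 hG0

end ShapeFamily

/-! ### The chart of a branch component -/

section BranchChart

/-- Parametrization of a component of the deformation variety by points `(v, p, r)` of a surface:
`a`, …, `h` are the coordinates on the oriented edges `01`, `10`, `23`, `32` of the two
tetrahedra. -/
structure BranchChart {R : Type*} [CommRing R] (v p r a b c d e f g h : R) : Prop where
  surface : (p + r - p * r) * (1 - r) * v ^ 2 -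
    ((p + r - p * r) * (1 - r) - (1 - p * r) * ((1 - p) * r)) * v + p * (1 - p * r) = 0
  p0 : IsUnit p
  p1 : IsUnit (1 - p)
  r0 : IsUnit r
  r1 : IsUnit (1 - r)
  A0 : IsUnit (1 - p * r)
  C0 : IsUnit (p + r - p * r)
  v0 : IsUnit v
  v1 : IsUnit (1 - v)
  M0 : IsUnit ((1 - p) * r + v * (1 - r))
  ha : a * (1 - p * r) = 1
  hb : b * (1 - p) = 1 - p * r
  hc : c * ((1 - p * r) * (1 - v) * ((1 - p) * r)) =
    (p + r - p * r) * ((1 - p) * r + v * (1 - r))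
  hd : d * (p + r - p * r) = (1 - p) * r * (1 - v)
  he : e * ((1 - p) * r + v * (1 - r)) = (1 - p) * r
  hf : f * r = p + r - p * r
  hg : g = (1 - p) * (1 - r)
  hh : h * ((1 - p) * r + v * (1 - r)) = v * (1 - p * r)

namespace BranchChart

section

variable {R : Type*} [CommRing R] {v p r a b c d e f g h : R}
  (H : BranchChart v p r a b c d e f g h)
include H

theorem one_sub_a : (1 - a) * (1 - p * r) = -(p * r) := by
  linear_combination -H.ha

theorem one_sub_b : (1 - b) * (1 - p) = -(p * (1 - r)) := by
  linear_combination -H.hb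

theorem one_sub_c : (1 - c) * ((1 - p * r) * ((1 - p) * r)) =
    (1 - v) * ((p + r - p * r) * (1 - r)) := by
  refine H.v1.mul_left_cancel ?_
  linear_combination -H.hc - H.surface

theorem one_sub_d : (1 - d) * (1 - p * r) = v * (1 - v) * (1 - r) := by
  refine H.C0.mul_left_cancel ?_
  linear_combination -(1 - p * r) * H.hd + H.surface

theorem one_sub_e : (1 - e) * ((1 - p) * r + v * (1 - r)) = v * (1 - r) := by
  linear_combination -H.he

theorem one_sub_f : (1 - f) * r = -(p * (1 - r)) := by
  linear_combination -H.hf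

theorem one_sub_g : 1 - g = p + r - p * r := by
  linear_combination -H.hg

theorem one_sub_h : (1 - h) * ((1 - p) * r + v * (1 - r)) = (1 - v) * ((1 - p) * r) := by
  linear_combination -H.hh

/-- The surface equation as an equality of two monomials in the invertible functions, up to sign. -/
theorem v_mul : v * ((1 - p) * r + v * (1 - r)) * (p + r - p * r) =
    -((1 - p * r) * (1 - v) * p) := by
  linear_combination H.surface

/-- By the defining relations and the `one_sub` lemmas, all sixteen functions are, up to sign,
monomials in the nine units of the chart and their inverses. -/
theorem isUnit (T : Fin 2) (i : Fin 4) :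
    IsUnit ((![![a, b, c, d], ![e, f, g, h]] : Fin 2 → Fin 4 → R) T i) ∧
      IsUnit (1 - (![![a, b, c, d], ![e, f, g, h]] : Fin 2 → Fin 4 → R) T i) := by
  have key : ∀ {x u w : R}, x * u = w → IsUnit w → IsUnit x :=
    fun h hw => isUnit_of_mul_isUnit_left (h ▸ hw)
  have hq := H.p1.mul H.r0
  fin_cases T <;> fin_cases i
  · exact ⟨key H.ha isUnit_one, key H.one_sub_a (H.p0.mul H.r0).neg⟩
  · exact ⟨key H.hb H.A0, key H.one_sub_b (H.p0.mul H.r1).neg⟩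
  · exact ⟨key H.hc (H.C0.mul H.M0), key H.one_sub_c (H.v1.mul (H.C0.mul H.r1))⟩
  · exact ⟨key H.hd (hq.mul H.v1), key H.one_sub_d ((H.v0.mul H.v1).mul H.r1)⟩
  · exact ⟨key H.he hq, key H.one_sub_e (H.v0.mul H.r1)⟩
  · exact ⟨key H.hf H.C0, key H.one_sub_f (H.p0.mul H.r1).neg⟩
  · refine ⟨?_, ?_⟩
    · change IsUnit g
      rw [H.hg]
      exact H.p1.mul H.r1
    · change IsUnit (1 - g)
      rw [H.one_sub_g]
      exact H.C0
  · exact ⟨key H.hh (H.v0.mul H.A0), key H.one_sub_h (H.v1.mul hq)⟩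

theorem map {R' : Type*} [CommRing R'] (φ : R →+* R') :
    BranchChart (φ v) (φ p) (φ r) (φ a) (φ b) (φ c) (φ d) (φ e) (φ f) (φ g) (φ h) where
  surface := by simpa using congrArg φ H.surface
  p0 := H.p0.map φ
  p1 := by simpa using H.p1.map φ
  r0 := H.r0.map φ
  r1 := by simpa using H.r1.map φ
  A0 := by simpa using H.A0.map φ
  C0 := by simpa using H.C0.map φ
  v0 := H.v0.map φ
  v1 := by simpa using H.v1.map φ
  M0 := by simpa using H.M0.map φ
  ha := by simpa using congrArg φ H.ha
  hb := by simpa using congrArg φ H.hb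
  hc := by simpa using congrArg φ H.hc
  hd := by simpa using congrArg φ H.hd
  he := by simpa using congrArg φ H.he
  hf := by simpa using congrArg φ H.hf
  hg := by simpa using congrArg φ H.hg
  hh := by simpa using congrArg φ H.hh

theorem unique {a' b' c' d' e' f' g' h' : R} (H' : BranchChart v p r a' b' c' d' e' f' g' h') :
    a = a' ∧ b = b' ∧ c = c' ∧ d = d' ∧ e = e' ∧ f = f' ∧ g = g' ∧ h = h' :=
  ⟨H.A0.mul_right_cancel (H.ha.trans H'.ha.symm), H.p1.mul_right_cancel (H.hb.trans H'.hb.symm),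
    ((H.A0.mul H.v1).mul (H.p1.mul H.r0)).mul_right_cancel (H.hc.trans H'.hc.symm),
    H.C0.mul_right_cancel (H.hd.trans H'.hd.symm), H.M0.mul_right_cancel (H.he.trans H'.he.symm),
    H.r0.mul_right_cancel (H.hf.trans H'.hf.symm), H.hg.trans H'.hg.symm,
    H.M0.mul_right_cancel (H.hh.trans H'.hh.symm)⟩

end

theorem figureEightEquations {v p r a b c d e f g h : ℂ}
    (H : BranchChart v p r a b c d e f g h) : FigureEightEquations a b c d e f g h := by
  have hu := H.isUnit
  have p0 := H.p0.ne_zero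
  have p1 := H.p1.ne_zero
  have r0 := H.r0.ne_zero
  have r1 := H.r1.ne_zero
  have A0 := H.A0.ne_zero
  have C0 := H.C0.ne_zero
  have v0 := H.v0.ne_zero
  have v1 := H.v1.ne_zero
  have M0 := H.M0.ne_zero
  have ha := eq_div_of_mul_eq A0 H.ha
  have hb := eq_div_of_mul_eq p1 H.hb
  have hc := eq_div_of_mul_eq (mul_ne_zero (mul_ne_zero A0 v1) (mul_ne_zero p1 r0)) H.hc
  have hd := eq_div_of_mul_eq C0 H.hd
  have he := eq_div_of_mul_eq M0 H.he
  have hf := eq_div_of_mul_eq r0 H.hf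
  have hg := H.hg
  have hh := eq_div_of_mul_eq M0 H.hh
  have ha' := eq_div_of_mul_eq A0 H.one_sub_a
  have hb' := eq_div_of_mul_eq p1 H.one_sub_b
  have hc' := eq_div_of_mul_eq (mul_ne_zero A0 (mul_ne_zero p1 r0)) H.one_sub_c
  have hd' := eq_div_of_mul_eq A0 H.one_sub_d
  have he' := eq_div_of_mul_eq M0 H.one_sub_e
  have hf' := eq_div_of_mul_eq r0 H.one_sub_f
  have hg' := H.one_sub_g
  have hh' := eq_div_of_mul_eq M0 H.one_sub_h
  have hv := H.v_mul
  refine ⟨(hu 0 0).1.ne_zero, (hu 0 0).2.ne_zero, (hu 0 1).1.ne_zero, (hu 0 1).2.ne_zero,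
    (hu 0 2).1.ne_zero, (hu 0 2).2.ne_zero, (hu 0 3).1.ne_zero, (hu 0 3).2.ne_zero,
    (hu 1 0).1.ne_zero, (hu 1 0).2.ne_zero, (hu 1 1).1.ne_zero, (hu 1 1).2.ne_zero,
    (hu 1 2).1.ne_zero, (hu 1 2).2.ne_zero, (hu 1 3).1.ne_zero, (hu 1 3).2.ne_zero,
    ?_, ?_, ?_, ?_, ?_, ?_, ?_⟩
  all_goals
    simp only [ha', hb', hc', hd', he', hf', hg', hh']
    simp only [ha, hb, hc, hd, he, hf, hg, hh]
    clear ha hb hc hd he hf hg hh ha' hb' hc' hd' he' hf' hg' hh' hu H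
    -- With the sums replaced by independent letters, every equation is one between monomials. Five
    -- of the seven are identities, and the other two are `v_mul`.
    generalize (1 - p) * r + v * (1 - r) = M at *
    generalize p + r - p * r = C at *
    generalize 1 - p * r = A at *
    generalize 1 - p = q at *
    generalize 1 - r = s at *
    generalize 1 - v = y at *
    field_simp
  · linear_combination -hv
  · linear_combination -hv

theorem branchEquations {v p r a b c d e f g h : ℂ}
    (H : BranchChart v p r a b c d e f g h) : BranchEquations a b d e f g h := by
  have p1 := H.p1.ne_zero
  have r0 := H.r0.ne_zero
  have A0 := H.A0.ne_zero
  have C0 := H.C0.ne_zero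
  have M0 := H.M0.ne_zero
  have ha := eq_div_of_mul_eq A0 H.ha
  have hb := eq_div_of_mul_eq p1 H.hb
  have he := eq_div_of_mul_eq M0 H.he
  have hg := H.hg
  have hh := eq_div_of_mul_eq M0 H.hh
  have hb' := eq_div_of_mul_eq p1 H.one_sub_b
  have he' := eq_div_of_mul_eq M0 H.one_sub_e
  have hab : 1 - a * b = -p / (1 - p) := by
    rw [ha, hb]
    field_simp
    ring
  refine ⟨?_, ?_⟩
  · rw [hb', hab, ha, hb, hg]
    field_simp
  · have A0' : 1 - r * p ≠ 0 := by rwa [mul_comm]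
    rw [he', ha, hb, hg, hh]
    field_simp

end BranchChart

/-- The inverse of the chart; this `r` is not the ratio of the reduced equations. The definitions of
p and r together with the first branch equation give a, b, g, and `edge₁` gives f. The second one,
with the definition of v, gives e and h; `face₃` gives d and `edge₃` gives c. -/
theorem BranchEquations.branchChart {a b c d e f g h : ℂ} (H : BranchEquations a b d e f g h)
    (H' : FigureEightEquations a b c d e f g h) :
    BranchChart (1 - (1 - h) / e) (1 - 1 / (a * b)) (1 - a * b * g) a b c d e f g h := by
  obtain ⟨a0, a1, b0, b1, c0, c1, d0, d1, e0, e1, f0, f1, g0, g1, h0, h1, E₁, E₂, E₃, F₁, F₂, F₃,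
    F₄⟩ := H'
  obtain ⟨h₁, h₂⟩ := H
  have hab : 1 - a * b ≠ 0 := by
    intro h
    rw [h, mul_zero] at h₁
    exact b1 h₁
  obtain ⟨p, hp⟩ : ∃ p, p = 1 - 1 / (a * b) := ⟨_, rfl⟩
  obtain ⟨r, hr⟩ : ∃ r, r = 1 - a * b * g := ⟨_, rfl⟩
  obtain ⟨v, hv⟩ : ∃ v, v = 1 - (1 - h) / e := ⟨_, rfl⟩
  rw [← hp, ← hr, ← hv]
  have hq : (1 - p) * (a * b) = 1 := by
    rw [hp]
    field_simp
    ring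
  have hs : 1 - r = a * b * g := by rw [hr]; ring
  have hy : (1 - v) * e = 1 - h := by
    rw [hv]
    field_simp
    ring
  have hg : g = (1 - p) * (1 - r) := by
    rw [hs]
    linear_combination -g * hq
  have ha : a * (1 - p * r) = 1 := by
    refine mul_right_cancel₀ b0 ?_
    linear_combination r * hq + (1 - a * b) * hr + h₁
  have hb : b * (1 - p) = 1 - p * r := by
    refine mul_left_cancel₀ a0 ?_
    linear_combination hq - ha
  have hC : 1 - g = p + r - p * r := by
    rw [hg]
    ring
  have hf : f * r = p + r - p * r := by
    rw [← hC, hr]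
    refine mul_left_cancel₀ (mul_ne_zero a0 b0) ?_
    linear_combination E₁ - f * h₁
  have r0 : r ≠ 0 := by
    rintro rfl
    rw [← hC, mul_zero] at hf
    exact g1 hf.symm
  have p1 : 1 - p ≠ 0 := left_ne_zero_of_mul_eq_one hq
  have r1 : 1 - r ≠ 0 := by rw [hs]; exact mul_ne_zero (mul_ne_zero a0 b0) g0
  have A0 : 1 - p * r ≠ 0 := right_ne_zero_of_mul_eq_one ha
  have C0 : p + r - p * r ≠ 0 := by rwa [← hC]
  have p0 : p ≠ 0 := by
    rintro rfl
    exact hab (by linear_combination -hq)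
  have v1 : 1 - v ≠ 0 := by
    rw [hv, sub_sub_cancel]
    exact div_ne_zero h1 e0
  have he : e * ((1 - p) * r + v * (1 - r)) = (1 - p) * r := by
    refine mul_left_cancel₀ a0 ?_
    linear_combination -a * (1 - r) * hy - (1 - e) * ha + a * h * hs - h₂
  have M0 : (1 - p) * r + v * (1 - r) ≠ 0 := by
    intro h
    rw [h, mul_zero] at he
    exact mul_ne_zero p1 r0 he.symm
  have hh : h * ((1 - p) * r + v * (1 - r)) = v * (1 - p * r) := by
    refine mul_left_cancel₀ (mul_ne_zero a0 e0) ?_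
    linear_combination a * h * he + a * (1 - p * r) * hy - a * h * hs + (1 - e) * ha + h₂
  have v0 : v ≠ 0 := by
    rintro rfl
    rw [zero_mul (1 - p * r)] at hh
    exact mul_ne_zero h0 M0 hh
  have hd : d * (p + r - p * r) = (1 - p) * r * (1 - v) := by
    have key : (1 - b) * ((1 - p) * r) = b * g * (1 - a) := by
      linear_combination -r * hb - (1 - r) * (1 - a) * hb - b * (1 - a) * hg + (1 - r) * ha
    refine mul_left_cancel₀ (mul_ne_zero e0 b1) ?_
    linear_combination -d * e * (1 - b) * hC + F₃ - (1 - p) * r * (1 - b) * hy - (1 - h) * key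
  have hc : c * ((1 - p * r) * (1 - v) * ((1 - p) * r)) =
    (p + r - p * r) * ((1 - p) * r + v * (1 - r)) := by
    refine mul_left_cancel₀ (mul_ne_zero a0 e0) ?_
    linear_combination c * ((1 - p) * r) * (1 - v) * e * ha + c * ((1 - p) * r) * hy -
      (1 - p) * r * E₃ - a * (p + r - p * r) * he + a * ((1 - p) * r) * hC
  have hcd : c * d * (1 - p * r) = (1 - p) * r + v * (1 - r) := by
    refine mul_left_cancel₀ (mul_ne_zero C0 (mul_ne_zero v1 (mul_ne_zero p1 r0))) ?_
    linear_combination d * (p + r - p * r) * hc +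
      (p + r - p * r) * ((1 - p) * r + v * (1 - r)) * hd
  have hd' : (1 - p * r) * (1 - d) = v * (1 - r) * (1 - v) := by
    refine mul_left_cancel₀ e0 ?_
    linear_combination (1 - p * r) * E₂ + (1 - e) * (1 - h) * hcd - (1 - h) * he -
      v * (1 - r) * hy
  -- The surface equation expresses that the values found for `d` and `1 - d` add up to 1.
  exact ⟨by linear_combination (1 - p * r) * hd + (p + r - p * r) * hd', p0.isUnit, p1.isUnit,
    r0.isUnit, r1.isUnit, A0.isUnit, C0.isUnit, v0.isUnit, v1.isUnit, M0.isUnit, ha, hb, hc, hd,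
    he, hf, hg, hh⟩

end BranchChart

/-! ### The surface of branch charts is irreducible and smooth -/

section BranchSurface

/-- The leading coefficient of the equation of the surface of branch charts. -/
noncomputable def branchLead : MvPolynomial (Fin 2) ℂ := (X 0 + X 1 - X 0 * X 1) * (1 - X 1)

/-- The middle coefficient of the equation of the surface of branch charts. -/
noncomputable def branchMid : MvPolynomial (Fin 2) ℂ :=
  -((X 0 + X 1 - X 0 * X 1) * (1 - X 1) - (1 - X 0 * X 1) * ((1 - X 0) * X 1))

/-- The constant coefficient of the equation of the surface of branch charts. -/
noncomputable def branchConst : MvPolynomial (Fin 2) ℂ := X 0 * (1 - X 0 * X 1)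

/-- The equation of the surface of branch charts. -/
noncomputable def branchEquation : MvPolynomial (Fin 3) ℂ :=
  quadratic branchLead branchMid branchConst

/-- The product of the functions that are invertible on the surface of branch charts. -/
noncomputable def branchUnit : MvPolynomial (Fin 3) ℂ :=
  X 1 * (1 - X 1) * (X 2 * (1 - X 2)) * ((1 - X 1 * X 2) * (X 1 + X 2 - X 1 * X 2)) *
    (X 0 * (1 - X 0)) * ((1 - X 1) * X 2 + X 0 * (1 - X 2))

theorem aeval_branchEquation {B : Type*} [CommRing B] [Algebra ℂ B] (x : Fin 3 → B) :
    aeval x branchEquation = (x 1 + x 2 - x 1 * x 2) * (1 - x 2) * x 0 ^ 2 -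
      ((x 1 + x 2 - x 1 * x 2) * (1 - x 2) - (1 - x 1 * x 2) * ((1 - x 1) * x 2)) * x 0 +
      x 1 * (1 - x 1 * x 2) := by
  rw [branchEquation, aeval_quadratic]
  simp [branchLead, branchMid, branchConst]
  ring

theorem aeval_branchUnit {B : Type*} [CommRing B] [Algebra ℂ B] (x : Fin 3 → B) :
    aeval x branchUnit = x 1 * (1 - x 1) * (x 2 * (1 - x 2)) *
      ((1 - x 1 * x 2) * (x 1 + x 2 - x 1 * x 2)) * (x 0 * (1 - x 0)) *
      ((1 - x 1) * x 2 + x 0 * (1 - x 2)) := by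
  simp [branchUnit]

theorem exists_goldenRatio : ∃ φ : ℂ, φ ^ 2 = φ + 1 := by
  obtain ⟨w, hw⟩ := IsAlgClosed.exists_pow_nat_eq (5 : ℂ) two_pos
  exact ⟨(1 + w) / 2, by linear_combination (1 / 4) * hw⟩

/-- A common divisor of the coefficients divides, by elimination, a nonzero polynomial in each
variable alone, so it is constant. The discriminant is not a square because it has a simple zero at
(φ, φ), where φ² = φ + 1. -/
theorem prime_branchEquation : Prime branchEquation := by
  obtain ⟨φ, hφ⟩ := exists_goldenRatio
  have hφ0 : φ ≠ 0 := by
    rintro rfl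
    norm_num at hφ
  refine prime_quadratic ?_ ?_ ?_
  · intro h
    have := congrArg (aeval ![(1 : ℂ), 0]) h
    simp [branchLead] at this
  · intro d hα hβ hγ
    have hm : d ∣ (1 - X 0 * X 1) * ((1 - X 0) * X 1) := by
      have := dvd_add hα hβ
      rwa [branchLead, branchMid, ← sub_eq_add_neg, sub_sub_cancel] at this
    have hrA : d ∣ X 1 - X 0 * X 1 ^ 2 := by
      convert dvd_add hm (hγ.mul_left (X 1)) using 1
      rw [branchConst]
      ring
    have hpA : d ∣ X 0 - X 0 ^ 2 * X 1 := by
      convert hγ using 1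
      rw [branchConst]
      ring
    rw [branchLead] at hα
    have hsum := dvd_add hα hrA
    have h1 : d ∣ X 1 * ((X 0 + X 1 - X 0 * X 1) * (1 - X 1) + (X 1 - X 0 * X 1 ^ 2)) -
        2 * (X 1 - X 0 * X 1 ^ 2) := dvd_sub (hsum.mul_left _) (hrA.mul_left _)
    have h0 : d ∣ X 0 * ((X 0 + X 1 - X 0 * X 1) * (1 - X 1) + (X 1 - X 0 * X 1 ^ 2)) -
        2 * (X 0 - X 0 ^ 2 * X 1) - (X 1 - X 0 * X 1 ^ 2) :=
      dvd_sub (dvd_sub (hsum.mul_left _) (hpA.mul_left _)) hrA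
    refine isUnit_of_dvd_aeval_X (p := Polynomial.X ^ 4 - 2 * Polynomial.X ^ 3 +
        2 * Polynomial.X ^ 2 - Polynomial.X) (q := 2 * Polynomial.X ^ 3 - Polynomial.X ^ 4 -
        2 * Polynomial.X ^ 2 + Polynomial.X) ?_ ?_ ?_ ?_
    · intro h
      have := congrArg (Polynomial.eval 2) h
      norm_num at this
    · intro h
      have := congrArg (Polynomial.eval 2) h
      norm_num at this
    · have := dvd_sub ((dvd_add (h0.mul_left (X 0)) (hpA.mul_left 2)).mul_left (X 0)) hpA
      convert this using 1
      simp only [map_add, map_sub, map_mul, map_pow, map_ofNat, Polynomial.aeval_X]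
      ring
    · convert dvd_add (h1.mul_left (X 1)) hrA using 1
      simp only [map_add, map_sub, map_mul, map_pow, map_ofNat, Polynomial.aeval_X]
      ring
  · refine sq_ne_of_aeval_pderiv_ne_zero (x := ![φ, φ]) 0 ?_ ?_
    · simp [branchLead, branchMid, branchConst]
      linear_combination (φ ^ 6 - 3 * φ ^ 5 + 10 * φ ^ 4 - 15 * φ ^ 3 + 7 * φ ^ 2) * hφ
    · have : aeval ![φ, φ] (pderiv 0 (branchMid ^ 2 - 4 * branchLead * branchConst)) = 8 * φ := by
        have h4 : pderiv 0 (4 : MvPolynomial (Fin 2) ℂ) = 0 := by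
          exact_mod_cast (pderiv (0 : Fin 2)).map_natCast (R := ℂ) 4
        simp [branchLead, branchMid, branchConst, Derivation.leibniz_pow, h4]
        linear_combination (4 * φ ^ 5 - 8 * φ ^ 4 + 26 * φ ^ 3 - 32 * φ ^ 2 + 18 * φ) * hφ
      rw [this]
      simp [hφ0]

theorem aeval_pderiv_branchEquation {K : Type} [Field K] [Algebra ℂ K] (x : Fin 3 → K) :
    aeval x (pderiv 0 branchEquation) = 2 * (x 1 + x 2 - x 1 * x 2) * (1 - x 2) * x 0 -
      ((x 1 + x 2 - x 1 * x 2) * (1 - x 2) - (1 - x 1 * x 2) * ((1 - x 1) * x 2)) ∧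
    aeval x (pderiv 1 branchEquation) = (1 - x 2) ^ 2 * x 0 ^ 2 - ((1 - x 2) ^ 2 +
      x 2 * ((1 - x 1) * x 2) + (1 - x 1 * x 2) * x 2) * x 0 + (1 - 2 * x 1 * x 2) ∧
    aeval x (pderiv 2 branchEquation) = ((1 - x 1) * (1 - x 2) - (x 1 + x 2 - x 1 * x 2)) * x 0 ^ 2
      - (((1 - x 1) * (1 - x 2) - (x 1 + x 2 - x 1 * x 2)) + x 1 * ((1 - x 1) * x 2) -
        (1 - x 1 * x 2) * (1 - x 1)) * x 0 - x 1 ^ 2 := by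
  refine ⟨?_, ?_, ?_⟩
  all_goals
    simp [branchEquation, quadratic, branchLead, branchMid, branchConst,
      Derivation.leibniz_pow, pderiv_X]
    ring

/-- At a singular point in the open part, the derivatives in p and r give p(1-r) = 1. This removes
p, and eliminating v leaves two polynomial equations for r, `k₁` and `k₂`, without common root. -/
theorem branchSurface_smooth {K : Type} [Field K] [Algebra ℂ K] (x : Fin 3 → K)
    (hF : aeval x branchEquation = 0) (hd : ∀ i, aeval x (pderiv i branchEquation) = 0) :
    aeval x branchUnit = 0 := by
  have : CharZero K := charZero_of_injective_algebraMap (algebraMap ℂ K).injective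
  by_contra hG
  obtain ⟨e₀, e₁, e₂⟩ := aeval_pderiv_branchEquation x
  have h0 := hd 0
  have h1 := hd 1
  have h2 := hd 2
  rw [aeval_branchEquation] at hF
  rw [aeval_branchUnit] at hG
  rw [e₀] at h0
  rw [e₁] at h1
  rw [e₂] at h2
  clear e₀ e₁ e₂ hd
  generalize x 0 = v at *
  generalize x 1 = p at *
  generalize x 2 = r at *
  simp only [mul_eq_zero, not_or] at hG
  obtain ⟨⟨⟨⟨⟨p0, p1⟩, r0, r1⟩, A0, C0⟩, v0, v1⟩, M0⟩ := hG
  have hV : (1 - p * r) * ((1 - p) * r) =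
      (1 - 2 * v) * ((p + r - p * r) * (1 - r)) := by linear_combination h0
  have hP : (1 - p * r) ^ 2 = v * (1 - r) * (p + r - p * r) ^ 2 := by
    refine mul_left_cancel₀ (mul_ne_zero r0 v1) ?_
    linear_combination (1 - p * r) * (p + r - p * r) * h1 -
      (-r * (p + r - p * r) + (1 - p * r) * (1 - r)) * hF
  have hR : p * (1 - p * r) ^ 2 = v * (p + r - p * r) ^ 2 := by
    refine mul_left_cancel₀ (mul_ne_zero p1 v1) ?_
    linear_combination -(1 - p * r) * (p + r - p * r) * h2 +
      (-p * (p + r - p * r) + (1 - p * r) * (1 - p)) * hF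
  have hps : p * (1 - r) = 1 := by
    refine mul_right_cancel₀ (mul_ne_zero v0 (pow_ne_zero 2 C0)) ?_
    linear_combination hR - p * hP
  have hF' : (1 - v) * ((1 - p) * r * (p + r - p * r) + (1 - p * r)) = (p + r - p * r) ^ 2 := by
    refine mul_left_cancel₀ A0 ?_
    linear_combination -(p + r - p * r) * hF + (1 - v) * hP
  have hA : (1 - p * r) * (1 - r) = 1 - 2 * r := by linear_combination -r * hps
  have hq : (1 - p) * (1 - r) = -r := by linear_combination -hps
  have hC : p + r - p * r = 1 + r := by linear_combination hps
  rw [hC] at hV hP hF'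
  have hP' : (1 - 2 * r) ^ 2 = v * (1 - r) ^ 3 * (1 + r) ^ 2 := by
    linear_combination (1 - r) ^ 2 * hP - ((1 - p * r) * (1 - r) + (1 - 2 * r)) * hA
  have hV' : -((1 - 2 * r) * r ^ 2) = (1 - 2 * v) * (1 + r) * (1 - r) ^ 3 := by
    linear_combination (1 - r) ^ 2 * hV - (1 - p) * (1 - r) * r * hA - (1 - 2 * r) * r * hq
  have hF'' : (1 - v) * (1 - 2 * r - r ^ 2 - r ^ 3) = (1 + r) ^ 2 * (1 - r) := by
    linear_combination (1 - r) * hF' - (1 - v) * r * (1 + r) * hq - (1 - v) * hA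
  have k₁ : -1 + 7 * r - 9 * r ^ 2 + r ^ 3 - r ^ 4 - r ^ 5 = 0 := by
    linear_combination -(1 + r) * hV' - 2 * hP'
  have k₂ : (1 - 2 * r) * (1 - 2 * r - r ^ 2 - r ^ 3) ^ 2 - (1 - r ^ 2) ^ 4 = 0 := by
    linear_combination (1 - r) ^ 3 * (1 + r) ^ 2 * hF'' -
      (1 - 2 * r - r ^ 2 - r ^ 3) * (k₁ + hP')
  -- A Bézout identity for the coprime polynomials `k₁` and `k₂` with denominators cleared; the
  -- constant is nonzero since `K` contains ℂ.
  have : (2268 : K) = 0 := by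
    linear_combination (-2268 - 6078 * r + 12718 * r ^ 2 + 13762 * r ^ 3 + 9229 * r ^ 4 +
      1624 * r ^ 5 + 3127 * r ^ 6 + 1060 * r ^ 7) * k₁ +
      (-1633 - 9619 * r - 617 * r ^ 2 - 2067 * r ^ 3 - 1060 * r ^ 4) * k₂
  norm_num at this

end BranchSurface

/-! ### The two branch components are smooth irreducible surfaces -/

section BranchComponent

theorem branchChart_of_aeval {v p r : ℂ} (hF : aeval ![v, p, r] branchEquation = 0)
    (hG : aeval ![v, p, r] branchUnit ≠ 0) :
    BranchChart v p r (1 / (1 - p * r)) ((1 - p * r) / (1 - p))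
      ((p + r - p * r) * ((1 - p) * r + v * (1 - r)) / ((1 - p * r) * (1 - v) * ((1 - p) * r)))
      ((1 - p) * r * (1 - v) / (p + r - p * r)) ((1 - p) * r / ((1 - p) * r + v * (1 - r)))
      ((p + r - p * r) / r) ((1 - p) * (1 - r))
      (v * (1 - p * r) / ((1 - p) * r + v * (1 - r))) := by
  rw [aeval_branchEquation] at hF
  rw [aeval_branchUnit] at hG
  simp only [Matrix.cons_val, mul_ne_zero_iff] at hF hG
  obtain ⟨⟨⟨⟨⟨p0, p1⟩, r0, r1⟩, A0, C0⟩, v0, v1⟩, M0⟩ := hG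
  exact ⟨hF, p0.isUnit, p1.isUnit, r0.isUnit, r1.isUnit, A0.isUnit, C0.isUnit, v0.isUnit,
    v1.isUnit, M0.isUnit, div_mul_cancel₀ _ A0, div_mul_cancel₀ _ p1,
    div_mul_cancel₀ _ (mul_ne_zero (mul_ne_zero A0 v1) (mul_ne_zero p1 r0)),
    div_mul_cancel₀ _ C0, div_mul_cancel₀ _ M0, div_mul_cancel₀ _ r0, rfl, div_mul_cancel₀ _ M0⟩

theorem BranchChart.aeval_eq {v p r a b c d e f g h : ℂ} (H : BranchChart v p r a b c d e f g h) :
    aeval ![v, p, r] branchEquation = 0 ∧ aeval ![v, p, r] branchUnit ≠ 0 := by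
  rw [aeval_branchEquation, aeval_branchUnit]
  refine ⟨H.surface, ?_⟩
  exact mul_ne_zero (mul_ne_zero (mul_ne_zero (mul_ne_zero (mul_ne_zero H.p0.ne_zero H.p1.ne_zero)
    (mul_ne_zero H.r0.ne_zero H.r1.ne_zero)) (mul_ne_zero H.A0.ne_zero H.C0.ne_zero))
    (mul_ne_zero H.v0.ne_zero H.v1.ne_zero)) H.M0.ne_zero

/-- The ring of regular functions on the surface of branch charts. -/
abbrev BranchRing : Type := HypersurfaceRing branchEquation branchUnit

theorem exists_branchChart_branchRing : ∃ a b c d e f g h : BranchRing,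
    BranchChart (HypersurfaceRing.mk branchEquation branchUnit (X 0))
      (HypersurfaceRing.mk branchEquation branchUnit (X 1))
      (HypersurfaceRing.mk branchEquation branchUnit (X 2)) a b c d e f g h := by
  have hF := HypersurfaceRing.mk_self branchEquation branchUnit
  have hG := HypersurfaceRing.isUnit_mk branchEquation branchUnit
  rw [HypersurfaceRing.mk_eq_aeval, aeval_branchEquation] at hF
  rw [HypersurfaceRing.mk_eq_aeval, aeval_branchUnit] at hG
  generalize HypersurfaceRing.mk branchEquation branchUnit (X 0) = v at *
  generalize HypersurfaceRing.mk branchEquation branchUnit (X 1) = p at *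
  generalize HypersurfaceRing.mk branchEquation branchUnit (X 2) = r at *
  simp only [IsUnit.mul_iff] at hG
  obtain ⟨⟨⟨⟨⟨p0, p1⟩, r0, r1⟩, A0, C0⟩, v0, v1⟩, M0⟩ := hG
  have hdiv : ∀ {u : BranchRing} (w : BranchRing), IsUnit u → ∃ x, x * u = w := fun w hu =>
    ⟨w * Ring.inverse _, Ring.inverse_mul_cancel_right _ _ hu⟩
  obtain ⟨a, ha⟩ := hdiv 1 A0
  obtain ⟨b, hb⟩ := hdiv (1 - p * r) p1
  obtain ⟨c, hc⟩ := hdiv ((p + r - p * r) * ((1 - p) * r + v * (1 - r)))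
    ((A0.mul v1).mul (p1.mul r0))
  obtain ⟨d, hd⟩ := hdiv ((1 - p) * r * (1 - v)) C0
  obtain ⟨e, he⟩ := hdiv ((1 - p) * r) M0
  obtain ⟨f, hf⟩ := hdiv (p + r - p * r) r0
  obtain ⟨h, hh⟩ := hdiv (v * (1 - p * r)) M0
  exact ⟨a, b, c, d, e, f, _, h, hF, p0, p1, r0, r1, A0, C0, v0, v1, M0, ha, hb, hc, hd, he, hf,
    rfl, hh⟩

theorem BranchChart.exists_algHom {a b c d e f g h : BranchRing}
    (H : BranchChart (HypersurfaceRing.mk branchEquation branchUnit (X 0))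
      (HypersurfaceRing.mk branchEquation branchUnit (X 1))
      (HypersurfaceRing.mk branchEquation branchUnit (X 2)) a b c d e f g h)
    {a' b' c' d' e' f' g' h' v p r : ℂ} (H' : BranchChart v p r a' b' c' d' e' f' g' h') :
    ∃ ψ : BranchRing →ₐ[ℂ] ℂ, ψ a = a' ∧ ψ b = b' ∧ ψ c = c' ∧ ψ d = d' ∧ ψ e = e' ∧ ψ f = f' ∧
      ψ g = g' ∧ ψ h = h' := by
  obtain ⟨hF, hG⟩ := H'.aeval_eq
  refine ⟨HypersurfaceRing.lift (aeval ![v, p, r]) hF hG.isUnit, ?_⟩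
  refine BranchChart.unique ?_ H'
  have := H.map (HypersurfaceRing.lift (aeval ![v, p, r]) hF hG.isUnit).toRingHom
  simpa [HypersurfaceRing.lift_mk] using this

open Subalgebra in
-- The chart relations read backwards: they recover the units of the chart one after another from
-- the shape coordinates. Hence these coordinates generate the ring of the surface.
theorem BranchChart.mem_unitsSet {R A : Type*} [CommRing R] [CommRing A] [Algebra R A]
    {v p r a b c d e f g h : A} (H : BranchChart v p r a b c d e f g h) {S : Subalgebra R A}
    (hS : ∀ T i, (![![a, b, c, d], ![e, f, g, h]] : Fin 2 → Fin 4 → A) T i ∈ S.unitsSet ∧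
      1 - (![![a, b, c, d], ![e, f, g, h]] : Fin 2 → Fin 4 → A) T i ∈ S.unitsSet) :
    v ∈ S ∧ p ∈ S ∧ r ∈ S ∧ p * (1 - p) * (r * (1 - r)) *
      ((1 - p * r) * (p + r - p * r)) * (v * (1 - v)) *
      ((1 - p) * r + v * (1 - r)) ∈ S.unitsSet := by
  have key : ∀ {x u w : A}, x ∈ S.unitsSet → x * u = w → w ∈ S.unitsSet → u ∈ S.unitsSet :=
    fun hx h hw => mem_unitsSet_of_mul hx (h ▸ hw)
  have key' : ∀ {x u w : A}, x ∈ S.unitsSet → u ∈ S.unitsSet → x * u = w → w ∈ S.unitsSet :=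
    fun hx hu h => h ▸ mul_mem_unitsSet hx hu
  have A0 := key (hS 0 0).1 H.ha one_mem_unitsSet
  have pr0 := neg_mem_unitsSet (key' (hS 0 0).2 A0 H.one_sub_a)
  have p1 := key (hS 0 1).1 H.hb A0
  have ps0 := neg_mem_unitsSet (key' (hS 0 1).2 p1 H.one_sub_b)
  have C0 : p + r - p * r ∈ S.unitsSet := H.one_sub_g ▸ (hS 1 2).2
  have r0 := key (hS 1 1).1 H.hf C0
  have p0 := key r0 (mul_comm r p) pr0
  have r1 := mem_unitsSet_of_mul p0 ps0
  have qr0 := mul_mem_unitsSet p1 r0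
  have M0 := key (hS 1 0).1 H.he qr0
  have vs0 := key' (hS 1 0).2 M0 H.one_sub_e
  have v0 := key r1 (mul_comm _ v) vs0
  have yqr0 := key' (hS 1 3).2 M0 H.one_sub_h
  have v1 := key qr0 (mul_comm _ (1 - v)) yqr0
  exact ⟨v0.1, p0.1, r0.1, mul_mem_unitsSet (mul_mem_unitsSet (mul_mem_unitsSet (mul_mem_unitsSet
    (mul_mem_unitsSet p0 p1) (mul_mem_unitsSet r0 r1)) (mul_mem_unitsSet A0 C0))
    (mul_mem_unitsSet v0 v1)) M0⟩

/-- A component of the deformation variety. -/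
def branchComponent : Set (OrientedEdge 2 → ℂ) :=
  {z | ∃ v p r a b c d e f g h, BranchChart v p r a b c d e f g h ∧
    z = shapePoint a b c d e f g h}

/-- The image of `branchComponent` under the involution. -/
def branchComponent' : Set (OrientedEdge 2 → ℂ) :=
  {z | ∃ v p r a b c d e f g h, BranchChart v p r a b c d e f g h ∧
    z = shapePoint (1 - h) (1 - f) (1 - g) (1 - e) (1 - d) (1 - b) (1 - c) (1 - a)}

/-- This rational point shows that the open part of the surface is not empty, and it also separates
the components. -/
theorem branchChart_special : BranchChart (1 / 2 : ℂ) (-1) (-1 / 2) 2 (1 / 4) (-2) (1 / 4) 4 4 3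
    (-1) := by
  refine ⟨?_, ?_, ?_, ?_, ?_, ?_, ?_, ?_, ?_, ?_, ?_, ?_, ?_, ?_, ?_, ?_, ?_, ?_⟩
  all_goals first | (refine Ne.isUnit ?_; norm_num) | norm_num

/-- A smooth irreducible surface. -/
structure IsSmoothSurface {ι : Type} (D : Set (ι → ℂ)) : Prop where
  irreducible : IsIrreducibleVariety D
  dim : ringKrullDim (CoordinateRing D) = 2
  smooth : Algebra.Smooth ℂ (CoordinateRing D)

theorem isSmoothSurface_of_branchChart {a b c d e f g h : BranchRing}
    (H : BranchChart (HypersurfaceRing.mk branchEquation branchUnit (X 0))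
      (HypersurfaceRing.mk branchEquation branchUnit (X 1))
      (HypersurfaceRing.mk branchEquation branchUnit (X 2)) a b c d e f g h)
    (x : Fin 2 → Fin 4 → BranchRing)
    (hx : ∀ T i, (![![a, b, c, d], ![e, f, g, h]] : Fin 2 → Fin 4 → BranchRing) T i ∈
        (aeval (R := ℂ) (shapeFamily x)).range.unitsSet ∧
      1 - (![![a, b, c, d], ![e, f, g, h]] : Fin 2 → Fin 4 → BranchRing) T i ∈
        (aeval (R := ℂ) (shapeFamily x)).range.unitsSet) :
    IsSmoothSurface (complexPoints (shapeFamily x)) := by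
  obtain ⟨v0, p0, r0, hG⟩ := H.mem_unitsSet hx
  have h0 := branchChart_special.aeval_eq
  obtain ⟨h1, h2, h3⟩ := HypersurfaceRing.complexPoints_shapeFamily prime_branchEquation h0.1 h0.2
    (fun K _ _ x => branchSurface_smooth x) (x := x) rfl
    (fun i => by fin_cases i; exacts [v0, p0, r0]) (by
      rwa [HypersurfaceRing.mk_eq_aeval, aeval_branchUnit])
  exact ⟨h1, h2, h3⟩

theorem isSmoothSurface_branchComponent : IsSmoothSurface branchComponent := by
  obtain ⟨a, b, c, d, e, f, g, h, H⟩ := exists_branchChart_branchRing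
  have hD : branchComponent = complexPoints (shapeFamily ![![a, b, c, d], ![e, f, g, h]]) := by
    ext z
    rw [mem_complexPoints_shapeFamily H.isUnit]
    constructor
    · rintro ⟨v, p, r, a', b', c', d', e', f', g', h', H', rfl⟩
      obtain ⟨ψ, rfl, rfl, rfl, rfl, rfl, rfl, rfl, rfl⟩ := H.exists_algHom H'
      exact ⟨ψ, rfl⟩
    · rintro ⟨ψ, rfl⟩
      exact ⟨_, _, _, _, _, _, _, _, _, _, _, H.map ψ.toRingHom, rfl⟩
  rw [hD]
  exact isSmoothSurface_of_branchChart H _ fun T i => mem_unitsSet_range_shapeFamily H.isUnit T i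

/-- The involution permutes the shape coordinates up to t ↦ 1 - t, which preserves the pairs of
units t, 1 - t; so the same surface embeds a second time. -/
theorem isSmoothSurface_branchComponent' : IsSmoothSurface branchComponent' := by
  obtain ⟨a, b, c, d, e, f, g, h, H⟩ := exists_branchChart_branchRing
  have hx : ∀ T i, IsUnit ((![![1 - h, 1 - f, 1 - g, 1 - e], ![1 - d, 1 - b, 1 - c, 1 - a]] :
        Fin 2 → Fin 4 → BranchRing) T i) ∧
      IsUnit (1 - (![![1 - h, 1 - f, 1 - g, 1 - e], ![1 - d, 1 - b, 1 - c, 1 - a]] :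
        Fin 2 → Fin 4 → BranchRing) T i) := by
    have hu := H.isUnit
    have swap : ∀ {t : BranchRing}, IsUnit t ∧ IsUnit (1 - t) →
        IsUnit (1 - t) ∧ IsUnit (1 - (1 - t)) := fun ht => ⟨ht.2, by simpa using ht.1⟩
    intro T i
    fin_cases T <;> fin_cases i
    exacts [swap (hu 1 3), swap (hu 1 1), swap (hu 1 2), swap (hu 1 0), swap (hu 0 3),
      swap (hu 0 1), swap (hu 0 2), swap (hu 0 0)]
  have hD : branchComponent' = complexPoints (shapeFamily
      ![![1 - h, 1 - f, 1 - g, 1 - e], ![1 - d, 1 - b, 1 - c, 1 - a]]) := by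
    ext z
    rw [mem_complexPoints_shapeFamily hx]
    constructor
    · rintro ⟨v, p, r, a', b', c', d', e', f', g', h', H', rfl⟩
      obtain ⟨ψ, rfl, rfl, rfl, rfl, rfl, rfl, rfl, rfl⟩ := H.exists_algHom H'
      exact ⟨ψ, by simp only [map_sub, map_one]⟩
    · rintro ⟨ψ, rfl⟩
      refine ⟨_, _, _, _, _, _, _, _, _, _, _, H.map ψ.toRingHom, ?_⟩
      simp only [map_sub, map_one]
      rfl
  rw [hD]
  refine isSmoothSurface_of_branchChart H _ fun T i => ?_
  have hu := mem_unitsSet_range_shapeFamily hx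
  have swap : ∀ {S : Subalgebra ℂ BranchRing} {t : BranchRing},
      1 - t ∈ S.unitsSet ∧ 1 - (1 - t) ∈ S.unitsSet → t ∈ S.unitsSet ∧ 1 - t ∈ S.unitsSet :=
    fun ht => ⟨by simpa using ht.2, ht.1⟩
  fin_cases T <;> fin_cases i
  exacts [swap (hu 1 3), swap (hu 1 1), swap (hu 1 2), swap (hu 1 0), swap (hu 0 3),
    swap (hu 0 1), swap (hu 0 2), swap (hu 0 0)]

theorem continuousOn_shapePoint {Z : Type*} [TopologicalSpace Z] {s : Set Z}
    {a b c d e f g h : Z → ℂ}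
    (hx : ∀ T i, ContinuousOn (fun z => (![![a, b, c, d], ![e, f, g, h]] :
        Fin 2 → Fin 4 → Z → ℂ) T i z) s ∧
      ∀ z ∈ s, (![![a, b, c, d], ![e, f, g, h]] : Fin 2 → Fin 4 → Z → ℂ) T i z ≠ 0 ∧
        1 - (![![a, b, c, d], ![e, f, g, h]] : Fin 2 → Fin 4 → Z → ℂ) T i z ≠ 0) :
    ContinuousOn (fun z => shapePoint (a z) (b z) (c z) (d z) (e z) (f z) (g z) (h z)) s := by
  have hmat : ∀ z T i, (![![a z, b z, c z, d z], ![e z, f z, g z, h z]] : Fin 2 → Fin 4 → ℂ) T i =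
      (![![a, b, c, d], ![e, f, g, h]] : Fin 2 → Fin 4 → Z → ℂ) T i z := by
    intro z T i
    fin_cases T <;> fin_cases i <;> rfl
  refine continuousOn_pi.mpr fun i => ?_
  simp only [shapePoint_eq, shapeCoord, hmat]
  split_ifs
  · exact (hx _ _).1
  · exact continuousOn_const.div (continuousOn_const.sub (hx _ _).1) fun z hz =>
      ((hx _ _).2 z hz).2
  · exact continuousOn_const.sub (continuousOn_const.div (hx _ _).1 fun z hz =>
      ((hx _ _).2 z hz).1)

end BranchComponent

/-! ### The branch components are connected -/

section BranchConnected

theorem MvPolynomial.continuous_aeval {σ : Type*} (p : MvPolynomial σ ℂ) :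
    Continuous fun x : σ → ℂ => aeval x p := by
  convert MvPolynomial.continuous_eval p using 2 with x
  rw [← aeval_eq_eval]

/-- The surface of branch charts. -/
def branchSurface : Set (ℂ × (Fin 2 → ℂ)) :=
  {z | aeval z.2 branchLead * z.1 ^ 2 + aeval z.2 branchMid * z.1 + aeval z.2 branchConst = 0 ∧
    z ∈ {z | aeval ![z.1, z.2 0, z.2 1] branchUnit ≠ 0}}

/-- The simple zero (φ, φ) of the discriminant is a branch point of the double cover of the (p,
r)-plane. -/
theorem isConnected_branchSurface : IsConnected branchSurface := by
  obtain ⟨φ, hφ⟩ := exists_goldenRatio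
  have hφ0 : φ ≠ 0 := by
    rintro rfl
    norm_num at hφ
  have hφ1 : 1 - φ ≠ 0 := by
    intro h
    rw [← sub_eq_zero.mp h] at hφ
    norm_num at hφ
  refine isConnected_quadraticCover (α := fun x => aeval x branchLead)
    (β := fun x => aeval x branchMid) (γ := fun x => aeval x branchConst)
    (MvPolynomial.continuous_aeval _)
    (MvPolynomial.continuous_aeval _)
    (MvPolynomial.continuous_aeval _)
    (X 0 * (1 - X 0) * (X 1 * (1 - X 1)) * ((1 - X 0 * X 1) * (X 0 + X 1 - X 0 * X 1)))
    (Ω := {z | aeval ![z.1, z.2 0, z.2 1] branchUnit ≠ 0}) ?_ ?_ ?_ (x₀ := ![φ, φ]) ?_ ?_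
  · intro z hz
    rw [Set.mem_ofPred_eq, aeval_branchUnit] at hz
    simp only [Matrix.cons_val, mul_ne_zero_iff] at hz
    simp only [branchLead, map_add, map_sub, map_mul, aeval_X, map_one]
    exact mul_ne_zero hz.1.1.2.2 hz.1.1.1.2.2
  · intro x hx v hv
    rw [Set.mem_ofPred_eq, aeval_branchUnit]
    simp only [branchLead, branchMid, branchConst, map_add, map_sub, map_mul, aeval_X, map_one,
      map_neg] at hv hx
    simp only [Matrix.cons_val]
    generalize x 0 = p at *
    generalize x 1 = r at *
    have hx' := hx
    simp only [mul_ne_zero_iff] at hx'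
    obtain ⟨⟨⟨p0, p1⟩, r0, r1⟩, A0, C0⟩ := hx'
    -- No root v over the good locus is lost: at v = 0, at v = 1 and where the last factor vanishes,
    -- the quadratic takes the nonzero values pA, AC and A(1-v)p, with A = 1 - pr and C = p + r -
    -- pr.
    have v0 : v ≠ 0 := by
      rintro rfl
      exact mul_ne_zero p0 A0 (by linear_combination hv)
    have v1 : 1 - v ≠ 0 := by
      intro h
      rw [← sub_eq_zero.mp h] at hv
      exact mul_ne_zero A0 C0 (by linear_combination hv)
    have M0 : (1 - p) * r + v * (1 - r) ≠ 0 := by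
      intro h
      refine mul_ne_zero (mul_ne_zero A0 v1) p0 ?_
      linear_combination hv - v * (p + r - p * r) * h
    exact mul_ne_zero (mul_ne_zero hx (mul_ne_zero v0 v1)) M0
  · intro x hx
    simp only [branchLead, map_add, map_sub, map_mul, aeval_X, map_one, mul_ne_zero_iff] at hx ⊢
    exact ⟨hx.2.2, hx.1.2.2⟩
  · simp only [map_add, map_sub, map_mul, aeval_X, map_one, Matrix.cons_val]
    refine mul_ne_zero (mul_ne_zero (mul_ne_zero hφ0 hφ1) (mul_ne_zero hφ0 hφ1))
      (mul_ne_zero ?_ ?_)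
    · intro h
      exact hφ0 (by linear_combination -h - hφ)
    · intro h
      exact hφ1 (by linear_combination -h - hφ)
  · simp only [branchLead, branchMid, branchConst, map_add, map_sub, map_mul, aeval_X, map_one,
      map_neg, Matrix.cons_val]
    linear_combination (φ ^ 6 - 3 * φ ^ 5 + 10 * φ ^ 4 - 15 * φ ^ 3 + 7 * φ ^ 2) * hφ

/-- The coordinates on the oriented edges `01`, `10`, `23`, `32` of the two tetrahedra as functions
on the surface of branch charts. -/
noncomputable def branchCoord : Fin 2 → Fin 4 → ℂ × (Fin 2 → ℂ) → ℂ :=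
  ![![fun z => 1 / (1 - z.2 0 * z.2 1), fun z => (1 - z.2 0 * z.2 1) / (1 - z.2 0),
    fun z => (z.2 0 + z.2 1 - z.2 0 * z.2 1) * ((1 - z.2 0) * z.2 1 + z.1 * (1 - z.2 1)) /
      ((1 - z.2 0 * z.2 1) * (1 - z.1) * ((1 - z.2 0) * z.2 1)),
    fun z => (1 - z.2 0) * z.2 1 * (1 - z.1) / (z.2 0 + z.2 1 - z.2 0 * z.2 1)],
    ![fun z => (1 - z.2 0) * z.2 1 / ((1 - z.2 0) * z.2 1 + z.1 * (1 - z.2 1)),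
    fun z => (z.2 0 + z.2 1 - z.2 0 * z.2 1) / z.2 1,
    fun z => (1 - z.2 0) * (1 - z.2 1),
    fun z => z.1 * (1 - z.2 0 * z.2 1) / ((1 - z.2 0) * z.2 1 + z.1 * (1 - z.2 1))]]

theorem branchChart_of_mem {z : ℂ × (Fin 2 → ℂ)} (hz : z ∈ branchSurface) :
    BranchChart z.1 (z.2 0) (z.2 1) (branchCoord 0 0 z) (branchCoord 0 1 z) (branchCoord 0 2 z)
      (branchCoord 0 3 z) (branchCoord 1 0 z) (branchCoord 1 1 z) (branchCoord 1 2 z)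
      (branchCoord 1 3 z) :=
  branchChart_of_aeval (v := z.1) (p := z.2 0) (r := z.2 1) (by
    have := hz.1
    rw [aeval_branchEquation]
    simp only [branchLead, branchMid, branchConst, map_add, map_sub, map_mul, aeval_X, map_one,
      map_neg] at this
    simp only [Matrix.cons_val]
    linear_combination this) hz.2

theorem BranchChart.mem_branchSurface {v p r a b c d e f g h : ℂ}
    (H : BranchChart v p r a b c d e f g h) : (v, ![p, r]) ∈ branchSurface := by
  obtain ⟨h1, h2⟩ := H.aeval_eq
  refine ⟨?_, by simpa using h2⟩
  have := H.surface
  simp only [branchLead, branchMid, branchConst, map_add, map_sub, map_mul, aeval_X, map_one,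
    map_neg, Matrix.cons_val]
  linear_combination this

theorem continuousOn_branchCoord (T : Fin 2) (i : Fin 4) :
    ContinuousOn (branchCoord T i) branchSurface := by
  fin_cases T <;> fin_cases i
  · exact ContinuousOn.div (by fun_prop) (by fun_prop) fun z hz =>
      (branchChart_of_mem hz).A0.ne_zero
  · exact ContinuousOn.div (by fun_prop) (by fun_prop) fun z hz =>
      (branchChart_of_mem hz).p1.ne_zero
  · exact ContinuousOn.div (by fun_prop) (by fun_prop) fun z hz =>
      (((branchChart_of_mem hz).A0.mul (branchChart_of_mem hz).v1).mul
        ((branchChart_of_mem hz).p1.mul (branchChart_of_mem hz).r0)).ne_zero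
  · exact ContinuousOn.div (by fun_prop) (by fun_prop) fun z hz =>
      (branchChart_of_mem hz).C0.ne_zero
  · exact ContinuousOn.div (by fun_prop) (by fun_prop) fun z hz =>
      (branchChart_of_mem hz).M0.ne_zero
  · exact ContinuousOn.div (by fun_prop) (by fun_prop) fun z hz =>
      (branchChart_of_mem hz).r0.ne_zero
  · change ContinuousOn (fun z : ℂ × (Fin 2 → ℂ) => (1 - z.2 0) * (1 - z.2 1)) branchSurface
    fun_prop
  · exact ContinuousOn.div (by fun_prop) (by fun_prop) fun z hz =>
      (branchChart_of_mem hz).M0.ne_zero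

theorem branchCoord_ne_zero {z : ℂ × (Fin 2 → ℂ)} (hz : z ∈ branchSurface) (T : Fin 2)
    (i : Fin 4) : branchCoord T i z ≠ 0 ∧ 1 - branchCoord T i z ≠ 0 := by
  have h := (branchChart_of_mem hz).isUnit T i
  fin_cases T <;> fin_cases i <;> exact ⟨h.1.ne_zero, h.2.ne_zero⟩

theorem isConnected_branchComponent : IsConnected branchComponent := by
  have hD : branchComponent = (fun z => shapePoint (branchCoord 0 0 z) (branchCoord 0 1 z)
      (branchCoord 0 2 z) (branchCoord 0 3 z) (branchCoord 1 0 z) (branchCoord 1 1 z)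
      (branchCoord 1 2 z) (branchCoord 1 3 z)) '' branchSurface := by
    ext z
    constructor
    · rintro ⟨v, p, r, a', b', c', d', e', f', g', h', H', rfl⟩
      refine ⟨_, H'.mem_branchSurface, ?_⟩
      obtain ⟨h1, h2, h3, h4, h5, h6, h7, h8⟩ :=
        (branchChart_of_mem H'.mem_branchSurface).unique H'
      subst h1 h2 h3 h4 h5 h6 h7 h8
      rfl
    · rintro ⟨z, hz, rfl⟩
      exact ⟨_, _, _, _, _, _, _, _, _, _, _, branchChart_of_mem hz, rfl⟩
  rw [hD]
  refine isConnected_branchSurface.image _ (continuousOn_shapePoint fun T i => ?_)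
  have h1 := continuousOn_branchCoord T i
  have h2 := fun z hz => branchCoord_ne_zero (z := z) hz T i
  fin_cases T <;> fin_cases i <;> exact ⟨h1, h2⟩

theorem isConnected_branchComponent' : IsConnected branchComponent' := by
  have hD : branchComponent' = (fun z => shapePoint (1 - branchCoord 1 3 z)
      (1 - branchCoord 1 1 z) (1 - branchCoord 1 2 z) (1 - branchCoord 1 0 z)
      (1 - branchCoord 0 3 z) (1 - branchCoord 0 1 z) (1 - branchCoord 0 2 z)
      (1 - branchCoord 0 0 z)) '' branchSurface := by
    ext z
    constructor
    · rintro ⟨v, p, r, a', b', c', d', e', f', g', h', H', rfl⟩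
      refine ⟨_, H'.mem_branchSurface, ?_⟩
      obtain ⟨h1, h2, h3, h4, h5, h6, h7, h8⟩ :=
        (branchChart_of_mem H'.mem_branchSurface).unique H'
      subst h1 h2 h3 h4 h5 h6 h7 h8
      rfl
    · rintro ⟨z, hz, rfl⟩
      exact ⟨_, _, _, _, _, _, _, _, _, _, _, branchChart_of_mem hz, rfl⟩
  rw [hD]
  refine isConnected_branchSurface.image _ (continuousOn_shapePoint
    (a := fun z => 1 - branchCoord 1 3 z) (b := fun z => 1 - branchCoord 1 1 z)
    (c := fun z => 1 - branchCoord 1 2 z) (d := fun z => 1 - branchCoord 1 0 z)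
    (e := fun z => 1 - branchCoord 0 3 z) (f := fun z => 1 - branchCoord 0 1 z)
    (g := fun z => 1 - branchCoord 0 2 z) (h := fun z => 1 - branchCoord 0 0 z) fun T i => ?_)
  have key : ∀ T i, ContinuousOn (fun z => 1 - branchCoord T i z) branchSurface ∧
      ∀ z ∈ branchSurface, 1 - branchCoord T i z ≠ 0 ∧ 1 - (1 - branchCoord T i z) ≠ 0 :=
    fun T i => ⟨continuousOn_const.sub (continuousOn_branchCoord T i), fun z hz =>
      ⟨(branchCoord_ne_zero hz T i).2, by simpa using (branchCoord_ne_zero hz T i).1⟩⟩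
  fin_cases T <;> fin_cases i
  exacts [key 1 3, key 1 1, key 1 2, key 1 0, key 0 3, key 0 1, key 0 2, key 0 0]

end BranchConnected

/-! ### The chart of the symmetric component -/

section SymmetricChart

/-- Parametrization of the symmetric component of the deformation variety by points `(g, a, b)` of
a surface. -/
structure SymmetricChart {R : Type*} [CommRing R] (g a b e : R) : Prop where
  surface : g * (1 - a) * (1 - b) = a * b * (1 - g) * (1 - b - g * (1 - a))
  a0 : IsUnit a
  a1 : IsUnit (1 - a)
  b0 : IsUnit b
  b1 : IsUnit (1 - b)
  g0 : IsUnit g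
  g1 : IsUnit (1 - g)
  he : e * (1 - b) = g * (1 - a)

namespace SymmetricChart

section

variable {R : Type*} [CommRing R] {g a b e : R} (H : SymmetricChart g a b e)
include H

theorem one_sub_e : (1 - e) * (a * b * (1 - g)) = g * (1 - a) := by
  refine H.b1.mul_left_cancel ?_
  linear_combination -a * b * (1 - g) * H.he - H.surface

theorem isUnit (T : Fin 2) (i : Fin 4) :
    IsUnit ((![![a, b, a, b], ![e, e, g, g]] : Fin 2 → Fin 4 → R) T i) ∧
      IsUnit (1 - (![![a, b, a, b], ![e, e, g, g]] : Fin 2 → Fin 4 → R) T i) := by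
  have key : ∀ {x u w : R}, x * u = w → IsUnit w → IsUnit x :=
    fun h hw => isUnit_of_mul_isUnit_left (h ▸ hw)
  have he := And.intro (key H.he (H.g0.mul H.a1)) (key H.one_sub_e (H.g0.mul H.a1))
  fin_cases T <;> fin_cases i
  exacts [⟨H.a0, H.a1⟩, ⟨H.b0, H.b1⟩, ⟨H.a0, H.a1⟩, ⟨H.b0, H.b1⟩, he, he, ⟨H.g0, H.g1⟩,
    ⟨H.g0, H.g1⟩]

theorem map {R' : Type*} [CommRing R'] (φ : R →+* R') :
    SymmetricChart (φ g) (φ a) (φ b) (φ e) where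
  surface := by simpa using congrArg φ H.surface
  a0 := H.a0.map φ
  a1 := by simpa using H.a1.map φ
  b0 := H.b0.map φ
  b1 := by simpa using H.b1.map φ
  g0 := H.g0.map φ
  g1 := by simpa using H.g1.map φ
  he := by simpa using congrArg φ H.he

end

theorem figureEightEquations {g a b e : ℂ} (H : SymmetricChart g a b e) :
    FigureEightEquations a b a b e e g g := by
  have hu := H.isUnit
  have h1 := H.he
  have h2 := H.one_sub_e
  refine ⟨(hu 0 0).1.ne_zero, (hu 0 0).2.ne_zero, (hu 0 1).1.ne_zero, (hu 0 1).2.ne_zero,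
    (hu 0 2).1.ne_zero, (hu 0 2).2.ne_zero, (hu 0 3).1.ne_zero, (hu 0 3).2.ne_zero,
    (hu 1 0).1.ne_zero, (hu 1 0).2.ne_zero, (hu 1 1).1.ne_zero, (hu 1 1).2.ne_zero,
    (hu 1 2).1.ne_zero, (hu 1 2).2.ne_zero, (hu 1 3).1.ne_zero, (hu 1 3).2.ne_zero,
    ?_, ?_, ?_, ?_, ?_, ?_, ?_⟩
  · linear_combination h1 - h2
  · linear_combination h1 - h2
  · ring
  · linear_combination b * (1 - g) * h1
  · linear_combination -a * (1 - e) * h1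
  · linear_combination b * (1 - g) * h1
  · linear_combination -a * (1 - e) * h1

end SymmetricChart

/-- The surface arises by eliminating `e` from the two symmetric equations. -/
theorem SymmetricEquations.symmetricChart {a b c d e f g h : ℂ}
    (H : SymmetricEquations a b c d e f g h) (H' : FigureEightEquations a b c d e f g h) :
    SymmetricChart g a b e where
  surface := by linear_combination (1 - b) * H.eq₂ - a * b * (1 - g) * H.eq₁
  a0 := H'.a0.isUnit
  a1 := H'.a1.isUnit
  b0 := H'.b0.isUnit
  b1 := H'.b1.isUnit
  g0 := H'.g0.isUnit
  g1 := H'.g1.isUnit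
  he := H.eq₁

end SymmetricChart

/-! ### The surface of symmetric charts is irreducible and smooth -/

section SymmetricSurface

/-- The leading coefficient of the equation of the surface of symmetric charts. -/
noncomputable def symmetricLead : MvPolynomial (Fin 2) ℂ := -(X 0 * X 1 * (1 - X 0))

/-- The middle coefficient of the equation of the surface of symmetric charts. -/
noncomputable def symmetricMid : MvPolynomial (Fin 2) ℂ :=
  (1 - X 0) * (1 - X 1) + X 0 * X 1 * (1 - X 0) + X 0 * X 1 * (1 - X 1)

/-- The constant coefficient of the equation of the surface of symmetric charts. -/
noncomputable def symmetricConst : MvPolynomial (Fin 2) ℂ := -(X 0 * X 1 * (1 - X 1))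

/-- The equation of the surface of symmetric charts. -/
noncomputable def symmetricEquation : MvPolynomial (Fin 3) ℂ :=
  quadratic symmetricLead symmetricMid symmetricConst

/-- The product of the functions that are invertible on the surface of symmetric charts. -/
noncomputable def symmetricUnit : MvPolynomial (Fin 3) ℂ :=
  X 1 * (1 - X 1) * (X 2 * (1 - X 2)) * (X 0 * (1 - X 0))

theorem aeval_symmetricEquation {B : Type*} [CommRing B] [Algebra ℂ B] (x : Fin 3 → B) :
    aeval x symmetricEquation = x 0 * (1 - x 1) * (1 - x 2) -
      x 1 * x 2 * (1 - x 0) * (1 - x 2 - x 0 * (1 - x 1)) := by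
  rw [symmetricEquation, aeval_quadratic]
  simp [symmetricLead, symmetricMid, symmetricConst]
  ring

theorem aeval_symmetricUnit {B : Type*} [CommRing B] [Algebra ℂ B] (x : Fin 3 → B) :
    aeval x symmetricUnit = x 1 * (1 - x 1) * (x 2 * (1 - x 2)) * (x 0 * (1 - x 0)) := by
  simp [symmetricUnit]

/-- As for the branches, with a simple zero of the discriminant at (φ, φ + 1). -/
theorem prime_symmetricEquation : Prime symmetricEquation := by
  obtain ⟨φ, hφ⟩ := exists_goldenRatio
  refine prime_quadratic ?_ ?_ ?_
  · intro h
    have := congrArg (aeval ![(2 : ℂ), 1]) h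
    simp [symmetricLead] at this
    norm_num at this
  · intro d hα hβ hγ
    rw [symmetricLead, dvd_neg] at hα
    rw [symmetricConst, dvd_neg] at hγ
    have hm : d ∣ (1 - X 0) * (1 - X 1) := by
      convert dvd_sub (dvd_sub hβ hα) hγ using 1
      rw [symmetricMid]
      ring
    have hp : (Polynomial.X - Polynomial.X ^ 2 : Polynomial ℂ) ≠ 0 := by
      intro h
      have := congrArg (Polynomial.eval 2) h
      norm_num at this
    refine isUnit_of_dvd_aeval_X hp hp ?_ ?_
    · convert dvd_add (hm.mul_left (X 0)) hα using 1
      simp only [map_sub, map_pow, Polynomial.aeval_X]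
      ring
    · convert dvd_add (hm.mul_left (X 1)) hγ using 1
      simp only [map_sub, map_pow, Polynomial.aeval_X]
      ring
  · refine sq_ne_of_aeval_pderiv_ne_zero (x := ![φ, φ + 1]) 0 ?_ ?_
    · simp [symmetricLead, symmetricMid, symmetricConst]
      linear_combination -4 * φ ^ 3 * hφ
    · have : aeval ![φ, φ + 1] (pderiv 0 (symmetricMid ^ 2 - 4 * symmetricLead * symmetricConst)) =
          -4 * (7 * φ + 4) := by
        have h4 : pderiv 0 (4 : MvPolynomial (Fin 2) ℂ) = 0 := by
          exact_mod_cast (pderiv (0 : Fin 2)).map_natCast (R := ℂ) 4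
        simp [symmetricLead, symmetricMid, symmetricConst, Derivation.leibniz_pow, h4]
        linear_combination (-16 - 12 * φ - 12 * φ ^ 2) * hφ
      rw [this]
      intro h
      have : (5 : ℂ) = 0 := by
        linear_combination -49 * hφ + (-1 / 4) * (7 * φ - 11) * h
      norm_num at this

theorem aeval_pderiv_symmetricEquation {K : Type} [Field K] [Algebra ℂ K] (x : Fin 3 → K) :
    aeval x (pderiv 0 symmetricEquation) = (1 - x 1) * (1 - x 2) +
      x 1 * x 2 * (1 - x 2 - x 0 * (1 - x 1)) + x 1 * x 2 * (1 - x 0) * (1 - x 1) ∧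
    aeval x (pderiv 1 symmetricEquation) = -(x 0 * (1 - x 2)) -
      x 2 * (1 - x 0) * (1 - x 2 - x 0 * (1 - x 1)) - x 1 * x 2 * (1 - x 0) * x 0 ∧
    aeval x (pderiv 2 symmetricEquation) = -(x 0 * (1 - x 1)) -
      x 1 * (1 - x 0) * (1 - x 2 - x 0 * (1 - x 1)) + x 1 * x 2 * (1 - x 0) := by
  refine ⟨?_, ?_, ?_⟩
  all_goals
    simp [symmetricEquation, quadratic, symmetricLead, symmetricMid, symmetricConst,
      Derivation.leibniz_pow, pderiv_X]
    ring

/-- At a singular point the derivatives in a and g force g = 1 - a. Then `m₂` splits as a difference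
of squares, and `m₃` makes b linear in a in one case and -1 in the other; both contradict `m₁`. -/
theorem symmetricSurface_smooth {K : Type} [Field K] [Algebra ℂ K] (x : Fin 3 → K)
    (hF : aeval x symmetricEquation = 0) (hd : ∀ i, aeval x (pderiv i symmetricEquation) = 0) :
    aeval x symmetricUnit = 0 := by
  have : CharZero K := charZero_of_injective_algebraMap (algebraMap ℂ K).injective
  by_contra hG
  obtain ⟨e₀, e₁, e₂⟩ := aeval_pderiv_symmetricEquation x
  have h0 := hd 0
  have h1 := hd 1
  have h2 := hd 2
  rw [aeval_symmetricEquation] at hF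
  rw [aeval_symmetricUnit] at hG
  rw [e₀] at h0
  rw [e₁] at h1
  rw [e₂] at h2
  clear e₀ e₁ e₂ hd
  generalize x 0 = g at *
  generalize x 1 = a at *
  generalize x 2 = b at *
  simp only [mul_eq_zero, not_or] at hG
  obtain ⟨⟨⟨a0, a1⟩, b0, b1⟩, g0, g1⟩ := hG
  have k₁ : 1 - b + a ^ 2 * b * (1 - g) = 0 := by
    refine mul_left_cancel₀ g0 ?_
    linear_combination hF - a * h1
  have k₂ : g * (1 - a) = a * b ^ 2 * (1 - g) := by
    linear_combination hF - b * h2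
  have k₃ : 1 - b + a * b * (1 - g) ^ 2 = 0 := by
    refine mul_left_cancel₀ a1 ?_
    linear_combination (1 - g) * h0 + hF
  have hg : g = 1 - a := by
    refine mul_left_cancel₀ (mul_ne_zero (mul_ne_zero a0 b0) g1) ?_
    linear_combination k₁ - k₃
  subst hg
  have m₁ : 1 - b + a ^ 3 * b = 0 := by linear_combination k₁
  have m₂ : (1 - a - a * b) * (1 - a + a * b) = 0 := by linear_combination k₂
  have m₃ : a * b = a + b := by
    refine mul_left_cancel₀ (mul_ne_zero (pow_ne_zero 4 a0) (pow_ne_zero 2 b0)) ?_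
    linear_combination -hF + (1 - a) ^ 2 * m₁ - a ^ 2 * b * m₁ - a ^ 3 * b * m₂ + a ^ 2 * b * m₂
  rcases mul_eq_zero.mp m₂ with h | h
  · have hb : b = 1 - 2 * a := by linear_combination -h - m₃
    subst hb
    have : (1 : K) = 0 := by
      linear_combination (1 + 2 / 5 * a + 2 / 5 * a ^ 2 - 4 / 5 * a ^ 3) * h +
        (4 / 5 - 4 / 5 * a) * m₁
    norm_num at this
  · have hb : b = -1 := by linear_combination h - m₃
    subst hb
    have : (15 : K) = 0 := by
      linear_combination 8 * m₁ - (4 * a ^ 2 + 2 * a + 1) * h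
    norm_num at this

end SymmetricSurface

/-! ### The symmetric component is a connected smooth irreducible surface -/

section SymmetricComponent

theorem symmetricChart_of_aeval {g a b : ℂ} (hF : aeval ![g, a, b] symmetricEquation = 0)
    (hG : aeval ![g, a, b] symmetricUnit ≠ 0) :
    SymmetricChart g a b (g * (1 - a) / (1 - b)) := by
  rw [aeval_symmetricEquation] at hF
  rw [aeval_symmetricUnit] at hG
  simp only [Matrix.cons_val, mul_ne_zero_iff] at hF hG
  obtain ⟨⟨⟨a0, a1⟩, b0, b1⟩, g0, g1⟩ := hG
  exact ⟨sub_eq_zero.mp hF, a0.isUnit, a1.isUnit, b0.isUnit, b1.isUnit, g0.isUnit, g1.isUnit,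
    div_mul_cancel₀ _ b1⟩

theorem SymmetricChart.aeval_eq {g a b e : ℂ} (H : SymmetricChart g a b e) :
    aeval ![g, a, b] symmetricEquation = 0 ∧ aeval ![g, a, b] symmetricUnit ≠ 0 := by
  rw [aeval_symmetricEquation, aeval_symmetricUnit]
  exact ⟨sub_eq_zero.mpr H.surface, mul_ne_zero (mul_ne_zero (mul_ne_zero H.a0.ne_zero H.a1.ne_zero)
    (mul_ne_zero H.b0.ne_zero H.b1.ne_zero)) (mul_ne_zero H.g0.ne_zero H.g1.ne_zero)⟩

/-- The ring of regular functions on the surface of symmetric charts. -/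
abbrev SymmetricRing : Type := HypersurfaceRing symmetricEquation symmetricUnit

theorem exists_symmetricChart_symmetricRing : ∃ e : SymmetricRing,
    SymmetricChart (HypersurfaceRing.mk symmetricEquation symmetricUnit (X 0))
      (HypersurfaceRing.mk symmetricEquation symmetricUnit (X 1))
      (HypersurfaceRing.mk symmetricEquation symmetricUnit (X 2)) e := by
  have hF := HypersurfaceRing.mk_self symmetricEquation symmetricUnit
  have hG := HypersurfaceRing.isUnit_mk symmetricEquation symmetricUnit
  rw [HypersurfaceRing.mk_eq_aeval, aeval_symmetricEquation] at hF
  rw [HypersurfaceRing.mk_eq_aeval, aeval_symmetricUnit] at hG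
  simp only [IsUnit.mul_iff] at hG
  obtain ⟨⟨⟨a0, a1⟩, b0, b1⟩, g0, g1⟩ := hG
  exact ⟨_, sub_eq_zero.mp hF, a0, a1, b0, b1, g0, g1, Ring.inverse_mul_cancel_right _ _ b1⟩

theorem SymmetricChart.exists_algHom {e : SymmetricRing}
    (H : SymmetricChart (HypersurfaceRing.mk symmetricEquation symmetricUnit (X 0))
      (HypersurfaceRing.mk symmetricEquation symmetricUnit (X 1))
      (HypersurfaceRing.mk symmetricEquation symmetricUnit (X 2)) e)
    {g a b e' : ℂ} (H' : SymmetricChart g a b e') :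
    ∃ ψ : SymmetricRing →ₐ[ℂ] ℂ,
      ψ (HypersurfaceRing.mk symmetricEquation symmetricUnit (X 0)) = g ∧
      ψ (HypersurfaceRing.mk symmetricEquation symmetricUnit (X 1)) = a ∧
      ψ (HypersurfaceRing.mk symmetricEquation symmetricUnit (X 2)) = b ∧ ψ e = e' := by
  obtain ⟨hF, hG⟩ := H'.aeval_eq
  have hX : ∀ i, HypersurfaceRing.lift (aeval ![g, a, b]) hF hG.isUnit
      (HypersurfaceRing.mk symmetricEquation symmetricUnit (X i)) = ![g, a, b] i := fun i => by
    rw [HypersurfaceRing.lift_mk, aeval_X]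
  refine ⟨HypersurfaceRing.lift (aeval ![g, a, b]) hF hG.isUnit, hX 0, hX 1, hX 2, ?_⟩
  have he := congrArg (HypersurfaceRing.lift (aeval ![g, a, b]) hF hG.isUnit) H.he
  simp only [map_mul, map_sub, map_one, hX, Matrix.cons_val] at he
  exact mul_right_cancel₀ H'.b1.ne_zero (he.trans H'.he.symm)

/-- The symmetric component of the deformation variety. -/
def symmetricComponent : Set (OrientedEdge 2 → ℂ) :=
  {z | ∃ g a b e, SymmetricChart g a b e ∧ z = shapePoint a b a b e e g g}

theorem symmetricChart_special : SymmetricChart (-5 / 3 : ℂ) 3 (-5 / 3) (5 / 4) := by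
  refine ⟨?_, ?_, ?_, ?_, ?_, ?_, ?_, ?_⟩
  all_goals first | (refine Ne.isUnit ?_; norm_num) | norm_num

open Subalgebra in
theorem isSmoothSurface_symmetricComponent : IsSmoothSurface symmetricComponent := by
  obtain ⟨e, H⟩ := exists_symmetricChart_symmetricRing
  have hD : symmetricComponent = complexPoints (shapeFamily
      ![![HypersurfaceRing.mk symmetricEquation symmetricUnit (X 1),
        HypersurfaceRing.mk symmetricEquation symmetricUnit (X 2),
        HypersurfaceRing.mk symmetricEquation symmetricUnit (X 1),
        HypersurfaceRing.mk symmetricEquation symmetricUnit (X 2)],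
        ![e, e, HypersurfaceRing.mk symmetricEquation symmetricUnit (X 0),
        HypersurfaceRing.mk symmetricEquation symmetricUnit (X 0)]]) := by
    ext z
    rw [mem_complexPoints_shapeFamily H.isUnit]
    constructor
    · rintro ⟨g', a', b', e', H', rfl⟩
      obtain ⟨ψ, rfl, rfl, rfl, rfl⟩ := H.exists_algHom H'
      exact ⟨ψ, rfl⟩
    · rintro ⟨ψ, rfl⟩
      exact ⟨_, _, _, _, H.map ψ.toRingHom, rfl⟩
  rw [hD]
  have hu := mem_unitsSet_range_shapeFamily H.isUnit
  have h0 := symmetricChart_special.aeval_eq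
  obtain ⟨h1, h2, h3⟩ := HypersurfaceRing.complexPoints_shapeFamily prime_symmetricEquation h0.1
    h0.2 (fun K _ _ x => symmetricSurface_smooth x) rfl
    (fun i => by fin_cases i; exacts [(hu 1 2).1.1, (hu 0 0).1.1, (hu 0 1).1.1]) (by
      rw [HypersurfaceRing.mk_eq_aeval symmetricUnit, aeval_symmetricUnit]
      exact mul_mem_unitsSet (mul_mem_unitsSet (mul_mem_unitsSet (hu 0 0).1 (hu 0 0).2)
        (mul_mem_unitsSet (hu 0 1).1 (hu 0 1).2)) (mul_mem_unitsSet (hu 1 2).1 (hu 1 2).2))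
  exact ⟨h1, h2, h3⟩

/-- The surface of symmetric charts. -/
def symmetricSurface : Set (ℂ × (Fin 2 → ℂ)) :=
  {z | aeval z.2 symmetricLead * z.1 ^ 2 + aeval z.2 symmetricMid * z.1 +
    aeval z.2 symmetricConst = 0 ∧ z ∈ {z | aeval ![z.1, z.2 0, z.2 1] symmetricUnit ≠ 0}}

theorem isConnected_symmetricSurface : IsConnected symmetricSurface := by
  obtain ⟨φ, hφ⟩ := exists_goldenRatio
  have hφ0 : φ ≠ 0 := by
    rintro rfl
    norm_num at hφ
  have hφ1 : 1 - φ ≠ 0 := by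
    intro h
    rw [← sub_eq_zero.mp h] at hφ
    norm_num at hφ
  have hφ2 : φ + 1 ≠ 0 := by
    rw [← hφ]
    exact pow_ne_zero 2 hφ0
  refine isConnected_quadraticCover (α := fun x => aeval x symmetricLead)
    (β := fun x => aeval x symmetricMid) (γ := fun x => aeval x symmetricConst)
    (MvPolynomial.continuous_aeval _) (MvPolynomial.continuous_aeval _)
    (MvPolynomial.continuous_aeval _) (X 0 * (1 - X 0) * (X 1 * (1 - X 1)))
    (Ω := {z | aeval ![z.1, z.2 0, z.2 1] symmetricUnit ≠ 0}) ?_ ?_ ?_ (x₀ := ![φ, φ + 1]) ?_ ?_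
  · intro z hz
    rw [Set.mem_ofPred_eq, aeval_symmetricUnit] at hz
    simp only [Matrix.cons_val, mul_ne_zero_iff] at hz
    simp only [symmetricLead, map_neg, map_sub, map_mul, aeval_X, map_one]
    exact neg_ne_zero.mpr (mul_ne_zero (mul_ne_zero hz.1.1.1 hz.1.2.1) hz.1.1.2)
  · intro x hx g hg
    rw [Set.mem_ofPred_eq, aeval_symmetricUnit]
    simp only [symmetricLead, symmetricMid, symmetricConst, map_add, map_sub, map_mul, aeval_X,
      map_one, map_neg] at hg hx
    simp only [Matrix.cons_val]
    generalize x 0 = a at *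
    generalize x 1 = b at *
    have hx' := hx
    simp only [mul_ne_zero_iff] at hx'
    obtain ⟨⟨a0, a1⟩, b0, b1⟩ := hx'
    -- The quadratic takes the values -ab(1-b) at g = 0 and (1-a)(1-b) at g = 1, so neither is a
    -- root.
    refine mul_ne_zero hx (mul_ne_zero ?_ ?_)
    · rintro rfl
      exact mul_ne_zero (mul_ne_zero a0 b0) b1 (by linear_combination -hg)
    · intro h
      rw [← sub_eq_zero.mp h] at hg
      exact mul_ne_zero a1 b1 (by linear_combination hg)
  · intro x hx
    simp only [symmetricLead, map_neg, map_sub, map_mul, aeval_X, map_one, mul_ne_zero_iff,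
      neg_ne_zero] at hx ⊢
    exact ⟨⟨hx.1.1, hx.2.1⟩, hx.1.2⟩
  · simp only [map_sub, map_mul, aeval_X, map_one, Matrix.cons_val]
    refine mul_ne_zero (mul_ne_zero hφ0 hφ1) (mul_ne_zero hφ2 ?_)
    rw [sub_add_cancel_right]
    exact neg_ne_zero.mpr hφ0
  · simp only [symmetricLead, symmetricMid, symmetricConst, map_add, map_sub, map_mul, aeval_X,
      map_one, map_neg, Matrix.cons_val]
    linear_combination -4 * φ ^ 3 * hφ

theorem symmetricChart_of_mem {z : ℂ × (Fin 2 → ℂ)} (hz : z ∈ symmetricSurface) :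
    SymmetricChart z.1 (z.2 0) (z.2 1) (z.1 * (1 - z.2 0) / (1 - z.2 1)) :=
  symmetricChart_of_aeval (by
    have := hz.1
    rw [aeval_symmetricEquation]
    simp only [symmetricLead, symmetricMid, symmetricConst, map_add, map_sub, map_mul, aeval_X,
      map_one, map_neg] at this
    simp only [Matrix.cons_val]
    linear_combination this) hz.2

theorem SymmetricChart.mem_symmetricSurface {g a b e : ℂ} (H : SymmetricChart g a b e) :
    (g, ![a, b]) ∈ symmetricSurface := by
  refine ⟨?_, by simpa using H.aeval_eq.2⟩
  simp only [symmetricLead, symmetricMid, symmetricConst, map_add, map_sub, map_mul, aeval_X,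
    map_one, map_neg, Matrix.cons_val]
  linear_combination H.surface

theorem isConnected_symmetricComponent : IsConnected symmetricComponent := by
  have hD : symmetricComponent = (fun z : ℂ × (Fin 2 → ℂ) => shapePoint (z.2 0) (z.2 1) (z.2 0)
      (z.2 1) (z.1 * (1 - z.2 0) / (1 - z.2 1)) (z.1 * (1 - z.2 0) / (1 - z.2 1)) z.1 z.1) ''
        symmetricSurface := by
    ext z
    constructor
    · rintro ⟨g, a, b, e, H, rfl⟩
      refine ⟨_, H.mem_symmetricSurface, ?_⟩
      rw [eq_div_of_mul_eq H.b1.ne_zero H.he]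
      rfl
    · rintro ⟨z, hz, rfl⟩
      exact ⟨_, _, _, _, symmetricChart_of_mem hz, rfl⟩
  have he : ContinuousOn (fun z : ℂ × (Fin 2 → ℂ) => z.1 * (1 - z.2 0) / (1 - z.2 1))
      symmetricSurface :=
    ContinuousOn.div (by fun_prop) (by fun_prop) fun z hz => (symmetricChart_of_mem hz).b1.ne_zero
  have hu : ∀ z ∈ symmetricSurface, ∀ T i, _ := fun z hz => (symmetricChart_of_mem hz).isUnit
  rw [hD]
  refine isConnected_symmetricSurface.image _ (continuousOn_shapePoint
    (a := fun z : ℂ × (Fin 2 → ℂ) => z.2 0) (b := fun z => z.2 1) (c := fun z => z.2 0)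
    (d := fun z => z.2 1) (e := fun z => z.1 * (1 - z.2 0) / (1 - z.2 1))
    (f := fun z => z.1 * (1 - z.2 0) / (1 - z.2 1)) (g := fun z => z.1) (h := fun z => z.1)
    fun T i => ⟨?_, fun z hz => ?_⟩)
  · have h0 : ContinuousOn (fun z : ℂ × (Fin 2 → ℂ) => z.2 0) symmetricSurface := by fun_prop
    have h1 : ContinuousOn (fun z : ℂ × (Fin 2 → ℂ) => z.2 1) symmetricSurface := by fun_prop
    have h2 : ContinuousOn (fun z : ℂ × (Fin 2 → ℂ) => z.1) symmetricSurface := by fun_prop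
    fin_cases T <;> fin_cases i
    exacts [h0, h1, h0, h1, he, he, h2, h2]
  · have h := hu z hz T i
    fin_cases T <;> fin_cases i <;> exact ⟨h.1.ne_zero, h.2.ne_zero⟩

end SymmetricComponent

/-! ### The three components, their common point and their union -/

section Union

theorem branchComponent_subset : branchComponent ⊆ figureEight.deformationVariety := by
  rintro z ⟨v, p, r, a, b, c, d, e, f, g, h, H, rfl⟩
  exact (mem_deformationVariety_iff _).mpr ⟨_, _, _, _, _, _, _, _, H.figureEightEquations, rfl⟩

theorem branchComponent'_subset : branchComponent' ⊆ figureEight.deformationVariety := by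
  rintro z ⟨v, p, r, a, b, c, d, e, f, g, h, H, rfl⟩
  exact (mem_deformationVariety_iff _).mpr
    ⟨_, _, _, _, _, _, _, _, H.figureEightEquations.involution, rfl⟩

theorem symmetricComponent_subset : symmetricComponent ⊆ figureEight.deformationVariety := by
  rintro z ⟨g, a, b, e, H, rfl⟩
  exact (mem_deformationVariety_iff _).mpr ⟨_, _, _, _, _, _, _, _, H.figureEightEquations, rfl⟩

section

variable {a b c d e f g h : ℂ} (H : FigureEightEquations a b c d e f g h)
include H

theorem FigureEightEquations.mem_branchComponent (hb : BranchEquations a b d e f g h) :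
    shapePoint a b c d e f g h ∈ branchComponent :=
  ⟨_, _, _, _, _, _, _, _, _, _, _, hb.branchChart H, rfl⟩

theorem FigureEightEquations.mem_branchComponent'
    (hb : BranchEquations (1 - h) (1 - f) (1 - e) (1 - d) (1 - b) (1 - c) (1 - a)) :
    shapePoint a b c d e f g h ∈ branchComponent' :=
  ⟨_, _, _, _, _, _, _, _, _, _, _, hb.branchChart H.involution, by simp only [sub_sub_cancel]⟩

theorem FigureEightEquations.mem_symmetricComponent (hs : SymmetricEquations a b c d e f g h) :
    shapePoint a b c d e f g h ∈ symmetricComponent := by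
  have hchart := hs.symmetricChart H
  obtain ⟨rfl, rfl, rfl, rfl, -, -⟩ := hs
  exact ⟨_, _, _, _, hchart, rfl⟩

end

theorem branchEquations_of_mem {a b c d e f g h : ℂ}
    (H : shapePoint a b c d e f g h ∈ branchComponent) : BranchEquations a b d e f g h := by
  obtain ⟨v, p, r, a', b', c', d', e', f', g', h', H', hz⟩ := H
  obtain ⟨rfl, rfl, rfl, rfl, rfl, rfl, rfl, rfl⟩ := shapePoint_injective hz
  exact H'.branchEquations

theorem branchEquations_of_mem' {a b c d e f g h : ℂ}
    (H : shapePoint a b c d e f g h ∈ branchComponent') :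
    BranchEquations (1 - h) (1 - f) (1 - e) (1 - d) (1 - b) (1 - c) (1 - a) := by
  obtain ⟨v, p, r, a', b', c', d', e', f', g', h', H', hz⟩ := H
  obtain ⟨rfl, rfl, rfl, rfl, rfl, rfl, rfl, rfl⟩ := shapePoint_injective hz
  simpa only [sub_sub_cancel] using H'.branchEquations

theorem eq_of_mem_symmetricComponent {a b c d e f g h : ℂ}
    (H : shapePoint a b c d e f g h ∈ symmetricComponent) : a = c := by
  obtain ⟨g', a', b', e', H', hz⟩ := H
  obtain ⟨rfl, rfl, rfl, rfl, rfl, rfl, rfl, rfl⟩ := shapePoint_injective hz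
  rfl

theorem figureEight_deformationVariety_eq : figureEight.deformationVariety =
    ⋃ i, (![symmetricComponent, branchComponent, branchComponent'] :
      Fin 3 → Set (OrientedEdge 2 → ℂ)) i := by
  apply Set.Subset.antisymm
  · intro z hz
    obtain ⟨a, b, c, d, e, f, g, h, H, rfl⟩ := (mem_deformationVariety_iff z).mp hz
    rw [Set.mem_iUnion]
    rcases H.cases with hs | hb | hb
    · exact ⟨0, H.mem_symmetricComponent hs⟩
    · exact ⟨1, H.mem_branchComponent hb⟩
    · exact ⟨2, H.mem_branchComponent' hb⟩
  · refine Set.iUnion_subset fun i => ?_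
    fin_cases i
    exacts [symmetricComponent_subset, branchComponent_subset, branchComponent'_subset]

/-- The rational special points, together with the image of the branch one under the involution, lie
on one component each: on the other two an explicit equation fails. -/
theorem not_subset_components (i j : Fin 3) (hij : i ≠ j) :
    ¬ (![symmetricComponent, branchComponent, branchComponent'] :
      Fin 3 → Set (OrientedEdge 2 → ℂ)) i ⊆
    (![symmetricComponent, branchComponent, branchComponent'] :
      Fin 3 → Set (OrientedEdge 2 → ℂ)) j := by
  have hs : shapePoint _ _ _ _ _ _ _ _ ∈ symmetricComponent :=
    ⟨_, _, _, _, symmetricChart_special, rfl⟩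
  have hb : shapePoint _ _ _ _ _ _ _ _ ∈ branchComponent :=
    ⟨_, _, _, _, _, _, _, _, _, _, _, branchChart_special, rfl⟩
  have hb' : shapePoint _ _ _ _ _ _ _ _ ∈ branchComponent' :=
    ⟨_, _, _, _, _, _, _, _, _, _, _, branchChart_special, rfl⟩
  intro hsub
  fin_cases i <;> fin_cases j
  · exact hij rfl
  · have := (branchEquations_of_mem (hsub hs)).eq₁
    norm_num at this
  · have := (branchEquations_of_mem' (hsub hs)).eq₁
    norm_num at this
  · have := eq_of_mem_symmetricComponent (hsub hb)
    norm_num at this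
  · exact hij rfl
  · have := (branchEquations_of_mem' (hsub hb)).eq₁
    norm_num at this
  · have := eq_of_mem_symmetricComponent (hsub hb')
    norm_num at this
  · have := (branchEquations_of_mem (hsub hb')).eq₁
    norm_num at this
  · exact hij rfl

theorem exists_primitive_twelfth_root : ∃ p : ℂ, p ^ 4 - p ^ 2 + 1 = 0 := by
  obtain ⟨s, hs⟩ := IsAlgClosed.exists_pow_nat_eq (-3 : ℂ) two_pos
  obtain ⟨p, hp⟩ := IsAlgClosed.exists_pow_nat_eq ((1 + s) / 2) two_pos
  exact ⟨p, by linear_combination (p ^ 2 + (1 + s) / 2 - 1) * hp + (1 / 4) * hs⟩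

theorem iInter_components_nonempty :
    (⋂ i, (![symmetricComponent, branchComponent, branchComponent'] :
      Fin 3 → Set (OrientedEdge 2 → ℂ)) i).Nonempty := by
  obtain ⟨p, hp⟩ := exists_primitive_twelfth_root
  have H : SymmetricChart (p ^ 2 - p ^ 3) (1 - p ^ 2 - p ^ 3) (p ^ 3 - p) (1 - p + p ^ 3) := by
    -- The explicit inverses reduce all nonvanishing conditions to the equation of `p`.
    refine ⟨?_, IsUnit.of_mul_eq_one (1 - p + p ^ 3) ?_, IsUnit.of_mul_eq_one (1 - p) ?_,
      IsUnit.of_mul_eq_one (-p) ?_, IsUnit.of_mul_eq_one (1 - p ^ 2 + p ^ 3) ?_,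
      IsUnit.of_mul_eq_one (1 + p) ?_, IsUnit.of_mul_eq_one (1 + p - p ^ 3) ?_, ?_⟩
    · linear_combination (p + p ^ 2 - 2 * p ^ 3 - 2 * p ^ 4 + 2 * p ^ 6 + 2 * p ^ 7 - p ^ 8 -
        2 * p ^ 9 + p ^ 11) * hp
    · linear_combination (-p - p ^ 2) * hp
    · linear_combination -hp
    · linear_combination -hp
    · linear_combination (p - p ^ 2) * hp
    · linear_combination -hp
    · linear_combination (p - p ^ 2) * hp
    · linear_combination hp
  refine ⟨shapePoint (1 - p ^ 2 - p ^ 3) (p ^ 3 - p) (1 - p ^ 2 - p ^ 3) (p ^ 3 - p)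
    (1 - p + p ^ 3) (1 - p + p ^ 3) (p ^ 2 - p ^ 3) (p ^ 2 - p ^ 3),
    Set.mem_iInter.mpr fun i => ?_⟩
  fin_cases i
  · exact ⟨_, _, _, _, H, rfl⟩
  · refine H.figureEightEquations.mem_branchComponent ⟨?_, ?_⟩
    · linear_combination (1 + p + p ^ 2 + p ^ 3 - 3 * p ^ 5 - 4 * p ^ 6 + 4 * p ^ 8 + 2 * p ^ 9 -
        p ^ 10 - p ^ 11) * hp
    · linear_combination (p - 2 * p ^ 6 - 2 * p ^ 7 + 2 * p ^ 8 + 2 * p ^ 9 - p ^ 11) * hp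
  -- On this point the involution acts as p ↦ -p, which preserves the equation of `p`; the cofactors
  -- are those of the preceding case with p replaced by -p.
  · refine H.figureEightEquations.mem_branchComponent' ⟨?_, ?_⟩
    · linear_combination (1 - p + p ^ 2 - p ^ 3 + 3 * p ^ 5 - 4 * p ^ 6 + 4 * p ^ 8 - 2 * p ^ 9 -
        p ^ 10 + p ^ 11) * hp
    · linear_combination (-p - 2 * p ^ 6 + 2 * p ^ 7 + 2 * p ^ 8 - 2 * p ^ 9 + p ^ 11) * hp

theorem isConnected_figureEight_deformationVariety :
    IsConnected figureEight.deformationVariety := by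
  obtain ⟨z, hz⟩ := iInter_components_nonempty
  rw [figureEight_deformationVariety_eq]
  refine ⟨⟨z, Set.mem_iUnion.mpr ⟨0, Set.mem_iInter.mp hz 0⟩⟩,
    isPreconnected_iUnion ⟨z, hz⟩ fun i => ?_⟩
  fin_cases i
  exacts [isConnected_symmetricComponent.isPreconnected, isConnected_branchComponent.isPreconnected,
    isConnected_branchComponent'.isPreconnected]

end Union

theorem theorem3p1 :
    ∃ D : Fin 3 → Set (OrientedEdge 2 → ℂ),
      figureEight.deformationVariety = ⋃ i, D i ∧
      (∀ i, IsIrreducibleVariety (D i) ∧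
        ringKrullDim (CoordinateRing (D i)) = 2 ∧
        Algebra.Smooth ℂ (CoordinateRing (D i))) ∧
      (∀ i j, i ≠ j → ¬ D i ⊆ D j) ∧
      (⋂ i, D i).Nonempty ∧
      IsConnected figureEight.deformationVariety := by
  refine ⟨_, figureEight_deformationVariety_eq, fun i => ?_, not_subset_components,
    iInter_components_nonempty, isConnected_figureEight_deformationVariety⟩
  have key : ∀ {D : Set (OrientedEdge 2 → ℂ)}, IsSmoothSurface D → IsIrreducibleVariety D ∧
      ringKrullDim (CoordinateRing D) = 2 ∧ Algebra.Smooth ℂ (CoordinateRing D) :=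
    fun h => ⟨h.irreducible, h.dim, h.smooth⟩
  fin_cases i
  exacts [key isSmoothSurface_symmetricComponent, key isSmoothSurface_branchComponent,
    key isSmoothSurface_branchComponent']
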